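/- **Theorem (Gamma limit of the Kobayashi–Warren–Carter energy).** Let $M=[a,b]$ with $a<b$, or $M=\mathbf T=\mathbf R/\mathbf Z$; let $\mathring M=(a,b)$, respectively $\mathring M=\mathbf T$. Let $F\in C(\mathbf R)$ be nonnegative with $F(v)=0$ if and only if $v=1$, and $\liminf_{|v|\to\infty}F(v)>0$. Put $G(v)=\left|\int_1^v\sqrt{F(\tau)}\,d\tau\right|$ and let $\sigma\ge 0$. *Set-valued functions.* Let $\mathcal B$ be the set of set-valued functions $\Xi$ from $M$ to subsets of $\mathbf R$ whose graph $\{(x,y): y\in\Xi(x)\}$ is compact in $M\times\mathbf R$, and let $\mathcal A_0$ be the set of those $\Xi\in\mathcal B$ for which every $\Xi(x)$ is a nonempty closed interval and $\Xi(x)=\{1\}$ for all but countably many $x$. Let $\Sigma$ be the set of all $x$ for which $\Xi(x)$ has more than one point (exceptional points), and for $\Xi\in\mathcal A_0$ write $\Xi(x)=[\xi^-(x),\xi^+(x)]$. For continuous $v_\varepsilon$ on $M$, $v_\varepsilon\xrightarrow{g}\Xi$ means that the graphs of $v_\varepsilon$ converge to the graph of $\Xi$ in the Hausdorff distance as $\varepsilon\downarrow0$.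 *Energies.* For $u\in L^1(\mathring M)$ and $v\in H^1(M)\subset C(M)$ let $$E^\varepsilon_{\mathrm{sMM}}(v)=\frac{\varepsilon}{2}\int_M|v_x|^2dx+\frac1{2\varepsilon}\int_MF(v)\,dx,\qquad E^\varepsilon_{\mathrm{KWC}}(u,v)=\sigma\int_{\mathring M}v^2|u_x|+E^\varepsilon_{\mathrm{sMM}}(v),$$ $$\int_{\mathring M}v^2|u_x|:=\sup\Bigl\{\int_{\mathring M}\varphi_x\,u\,dx:\ \varphi\in C^1_c(\mathring M),\ |\varphi|\le v^2\Bigr\},$$ with the convention $0\cdot\infty=0$. For $u\in BV(\mathring M)$ let $|u_x|$ be its total variation measure, $d(x)=|u(x+0)-u(x-0)|$ the jump at $x\in\mathring M$ and $J_u=\{x\in\mathring M: d(x)>0\}$. For $\Xi\in\mathcal A_0$ let $$E^0_{\mathrm{sMM}}(\Xi,M)=\sum_{x\in\Sigma}\Bigl\{2\bigl(G(\xi^-(x))+G(\xi^+(x))\bigr)-\kappa(x)\max\bigl(G(\xi^-(x)),G(\xi^+(x))\bigr)\Bigr\},$$ where $\kappa(x)=0$ if $x\in\mathring M$ and $\kappa(x)=1$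 otherwise. Let $$E^0_{\mathrm{KWC}}(u,\Xi,M)=\sigma\,|u_x|\bigl(\mathring M\setminus(J_u\cap\Sigma)\bigr)+\sigma\sum_{x\in J_u\cap\Sigma}d(x)\,\xi^-(x)^2+E^0_{\mathrm{sMM}}(\Xi,M)$$ if $u\in BV(\mathring M)$ and $\Xi\in\mathcal A_0$, and $E^0_{\mathrm{KWC}}(u,\Xi,M)=\infty$ for all other $(u,\Xi)\in L^1(\mathring M)\times\mathcal B$. (i) (liminf inequality) Let $\{v_\varepsilon\}_{0<\varepsilon<1}\subset H^1(M)$ and $\{u_\varepsilon\}_{0<\varepsilon<1}\subset L^1(\mathring M)$ satisfy $v_\varepsilon\xrightarrow{g}\Xi\in\mathcal B$ and $u_\varepsilon\to u$ in $L^1(\mathring M)$ as $\varepsilon\to0$. Assume that $u\in BV(\mathring M)$ in case $\sigma=0$, and that, in case $u\in BV(\mathring M)$, $\min\Xi(x)\ge0$ for every $x\in J_u\cap\Sigma$. Then $$E^0_{\mathrm{KWC}}(u,\Xi,M)\le\liminf_{\varepsilon\to0}E^\varepsilon_{\mathrm{KWC}}(u_\varepsilon,v_\varepsilon).$$ (ii)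 (limsup inequality) For every $\Xi\in\mathcal A_0$ and $u\in BV(\mathring M)$ there are $\{w_\varepsilon\}_{0<\varepsilon<1}\subset H^1(M)$ and $\{u_\varepsilon\}_{0<\varepsilon<1}\subset L^1(\mathring M)$ with $w_\varepsilon\xrightarrow{g}\Xi$, $u_\varepsilon\to u$ in $L^1(\mathring M)$ and $$E^0_{\mathrm{KWC}}(u,\Xi,M)=\lim_{\varepsilon\to0}E^\varepsilon_{\mathrm{KWC}}(u_\varepsilon,w_\varepsilon).$$ -/

import Mathlib

open Set Filter Topology MeasureTheory
open scoped ENNReal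

namespace KWC

noncomputable section

/-- The one-dimensional compact space `M`: either a closed interval `[a, b]` with `a < b`, or the
torus `𝕋 = ℝ / ℤ`. -/
inductive Dom : Type
  | interval (a b : ℝ) (hab : a < b) : Dom
  | torus : Dom

namespace Dom

/-- The points of `M`. -/
def Pt : Dom → Type
  | interval a b _ => Set.Icc a b
  | torus => AddCircle (1 : ℝ)

/-- The distance of `M`: `|x - y|` on `[a, b]`, and `min_k |x - y + k|` on `ℝ / ℤ`. -/
instance instMetricSpacePt : (M : Dom) → MetricSpace M.Pt
  | interval a b _ => inferInstanceAs (MetricSpace (Set.Icc a b))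
  | torus => inferInstanceAs (MetricSpace (AddCircle (1 : ℝ)))

/-- Left end of the parameter interval of `M`. -/
def left : Dom → ℝ
  | interval a _ _ => a
  | torus => 0

/-- Right end of the parameter interval of `M`. -/
def right : Dom → ℝ
  | interval _ b _ => b
  | torus => 1

/-- The coordinate map `ℝ → M`. On `[a, b]` it is the identity of `[a, b]` (extended by the nearest
point outside), on `𝕋` it is the quotient map. A function `f` on `M` is differentiated and
integrated in this coordinate, that is, through `f ∘ M.param`. -/
def param : (M : Dom) → ℝ → M.Pt
  | interval a b hab => Set.projIcc a b hab.le
  | torus => fun t => (t : AddCircle (1 : ℝ))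

/-- A coordinate of a point: `M.param (M.coord x) = x`. On `𝕋` it is the representative
in `[0, 1)`. -/
def coord : (M : Dom) → M.Pt → ℝ
  | interval a b _ => fun x : Set.Icc a b => (x : ℝ)
  | torus => fun x : AddCircle (1 : ℝ) => (AddCircle.equivIco (1 : ℝ) 0 x : ℝ)

/-- The interior of `M`: the open interval for `[a, b]`, all of `𝕋` for the torus. -/
def inner (M : Dom) : Set M.Pt :=
  match M with
  | interval a b _ => {x : Set.Icc a b | (x : ℝ) ∈ Set.Ioo a b}
  | torus => Set.univ

/-- Lebesgue measure of `M`, in the coordinate of `M`. -/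
def leb (M : Dom) : Measure ℝ := volume.restrict (Set.Ioo M.left M.right)

end Dom

/-! ### Set-valued functions and graph convergence -/

section SetValued

variable {X : Type} [MetricSpace X]

/-- The graph of a set-valued function, as a subset of `X × ℝ` with the metric
`(d(x, x')² + |y - y'|²)^(1/2)`. -/
def graph (Γ : X → Set ℝ) : Set (WithLp 2 (X × ℝ)) := {z | z.snd ∈ Γ z.fst}

/-- The class `ℬ`: set-valued functions with compact graph. -/
def IsB (Γ : X → Set ℝ) : Prop := IsCompact (graph Γ)

/-- The class `𝒜₀`: elements of `ℬ` all of whose values are (nonempty) compact intervals, and which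
take the value `{1}` off a countable set. -/
structure IsA0 (Γ : X → Set ℝ) : Prop where
  isB : IsB Γ
  isInterval : ∀ x, ∃ p q : ℝ, p ≤ q ∧ Γ x = Set.Icc p q
  countable : {x | Γ x ≠ {1}}.Countable

/-- The set `Σ` of exceptional points: the points whose value is not a singleton. -/
def exceptional (Γ : X → Set ℝ) : Set X := {x | (Γ x).Nontrivial}

/-- Graph convergence `v_ε → Ξ` as `ε ↓ 0`: the graphs converge in the Hausdorff distance. -/
def GraphTendsto (v : ℝ → X → ℝ) (Ξ : X → Set ℝ) : Prop :=
  Tendsto (fun ε => Metric.hausdorffEDist (graph fun x => {v ε x}) (graph Ξ)) (𝓝[>] 0) (𝓝 0)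

end SetValued

/-! ### The function spaces -/

/-- `v ∈ H¹(M) ⊂ C(M)`: `v` is absolutely continuous with square integrable derivative. -/
def IsH1 (M : Dom) (v : M.Pt → ℝ) : Prop :=
  AbsolutelyContinuousOnInterval (v ∘ M.param) M.left M.right ∧
    MemLp (deriv (v ∘ M.param)) 2 M.leb

/-- `u ∈ L¹(M)`. -/
def IsL1 (M : Dom) (u : M.Pt → ℝ) : Prop := Integrable (u ∘ M.param) M.leb

/-- `u_ε → u` in `L¹(M)` as `ε ↓ 0`. -/
def L1Tendsto (M : Dom) (u : ℝ → M.Pt → ℝ) (u₀ : M.Pt → ℝ) : Prop :=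
  Tendsto (fun ε => eLpNorm ((u ε - u₀) ∘ M.param) 1 M.leb) (𝓝[>] 0) (𝓝 0)

/-- `φ ∈ C¹_c(A ∩ int M)`. Supports are automatically compact since `M` is; on an interval the
support condition makes `φ ∘ M.param` vanish near and beyond the end points. -/
def IsTest (M : Dom) (A : Set M.Pt) (φ : M.Pt → ℝ) : Prop :=
  ContDiff ℝ 1 (φ ∘ M.param) ∧ tsupport φ ⊆ A ∩ M.inner

/-- The total variation of `u` with weight `ρ ≥ 0` in the open set `A ∩ int M`:
the supremum of `∫ φ_x u dx` over `φ ∈ C¹_c(A ∩ int M)` with `|φ| ≤ ρ`. -/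
def weightedTV (M : Dom) (ρ : M.Pt → ℝ) (A : Set M.Pt) (u : M.Pt → ℝ) : ℝ≥0∞ :=
  ⨆ (φ : M.Pt → ℝ) (_ : IsTest M A φ) (_ : ∀ x, |φ x| ≤ ρ x),
    ENNReal.ofReal (∫ t, deriv (φ ∘ M.param) t * u (M.param t) ∂M.leb)

/-- `u ∈ BV(int M)`. -/
def IsBV (M : Dom) (u : M.Pt → ℝ) : Prop :=
  IsL1 M u ∧ weightedTV M (fun _ => 1) Set.univ u < ∞

/-- The total variation measure `|u_x|` of a set `B ⊆ int M`, by outer regularity: the infimum of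
the total variations of `u` in the open sets that contain `B`. -/
def variation (M : Dom) (u : M.Pt → ℝ) (B : Set M.Pt) : ℝ≥0∞ :=
  ⨅ (A : Set M.Pt) (_ : IsOpen A) (_ : B ⊆ A), weightedTV M (fun _ => 1) A u

/-- The trace `u(x+0)` from the right, an essential one-sided limit. -/
def traceRight (M : Dom) (u : M.Pt → ℝ) (x : M.Pt) : ℝ :=
  limUnder (𝓝[>] (M.coord x) ⊓ ae volume) (u ∘ M.param)

/-- The trace `u(x-0)` from the left, an essential one-sided limit. -/
def traceLeft (M : Dom) (u : M.Pt → ℝ) (x : M.Pt) : ℝ :=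
  limUnder (𝓝[<] (M.coord x) ⊓ ae volume) (u ∘ M.param)

/-- `d(x) = |u(x+0) - u(x-0)|`. -/
def jump (M : Dom) (u : M.Pt → ℝ) (x : M.Pt) : ℝ := |traceRight M u x - traceLeft M u x|

/-- The jump set `J_u ⊆ int M` of a function `u` of bounded variation. -/
def jumpSet (M : Dom) (u : M.Pt → ℝ) : Set M.Pt := {x | x ∈ M.inner ∧ 0 < jump M u x}

/-! ### The energies -/

/-- The single-well Modica--Mortola functional
`(ε/2) ∫ |v_x|² dx + (1/(2ε)) ∫ F(v) dx` for `v ∈ H¹(M)`. -/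
def sMM (M : Dom) (F : ℝ → ℝ) (ε : ℝ) (v : M.Pt → ℝ) : ℝ≥0∞ :=
  ENNReal.ofReal (ε / 2) * ∫⁻ t, ENNReal.ofReal (deriv (v ∘ M.param) t ^ 2) ∂M.leb +
    ENNReal.ofReal (1 / (2 * ε)) * ∫⁻ t, ENNReal.ofReal (F (v (M.param t))) ∂M.leb

/-- The Kobayashi--Warren--Carter energy `σ ∫ v² |u_x| + E_sMM^ε(v)`. -/
def energy (M : Dom) (F : ℝ → ℝ) (σ ε : ℝ) (u v : M.Pt → ℝ) : ℝ≥0∞ :=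
  ENNReal.ofReal σ * weightedTV M (fun x => v x ^ 2) Set.univ u + sMM M F ε v

/-- `G(v) = |∫_1^v √F(τ) dτ|`. -/
def potG (F : ℝ → ℝ) (v : ℝ) : ℝ := |∫ τ in (1 : ℝ)..v, Real.sqrt (F τ)|

open Classical in
/-- The number `κ`: `0` at interior points of `M`, `1` at the end points of an interval. -/
def kappa (M : Dom) (x : M.Pt) : ℝ := if x ∈ M.inner then 0 else 1

open Classical in
/-- The limit energy `E_sMM^0(Ξ, M)`. For `Ξ ∈ 𝒜₀` and `x ∈ Σ` the value `Ξ(x)` is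
`[ξ⁻, ξ⁺]` with `ξ⁻ = sInf (Ξ x)` and `ξ⁺ = sSup (Ξ x)`. -/
def sMM0 (M : Dom) (F : ℝ → ℝ) (Ξ : M.Pt → Set ℝ) : ℝ≥0∞ :=
  if IsA0 Ξ then
    ∑' x : exceptional Ξ, ENNReal.ofReal
      (2 * (potG F (sInf (Ξ x)) + potG F (sSup (Ξ x))) -
        kappa M x * max (potG F (sInf (Ξ x))) (potG F (sSup (Ξ x))))
  else ∞

open Classical in
/-- The limit energy `E_KWC^0(u, Ξ, M)`. Exceptional points outside `J_u` do not contribute to the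
sum of the jumps, since `d = 0` there. -/
def energy0 (M : Dom) (F : ℝ → ℝ) (σ : ℝ) (u : M.Pt → ℝ) (Ξ : M.Pt → Set ℝ) : ℝ≥0∞ :=
  if IsBV M u ∧ IsA0 Ξ then
    ENNReal.ofReal σ * variation M u (M.inner \ (jumpSet M u ∩ exceptional Ξ)) +
      ENNReal.ofReal σ * ∑' x : ↥(jumpSet M u ∩ exceptional Ξ),
        ENNReal.ofReal (jump M u x * sInf (Ξ x) ^ 2) +
      sMM0 M F Ξ
  else ∞

end

end KWC

open KWC

namespace KWC

/-! ### The coordinate of `M` -/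

namespace Dom

/-! The two terms of the energy are treated separately. They interact only through the graph limit
`Ξ`.

Variation term. In the coordinate, a function of bounded variation is almost everywhere a difference
of two monotone functions. Integration by parts then represents its derivative by Stieltjes
measures, with one more atom on the torus where the ends of the parameter interval meet. The polar
decomposition of this signed measure gives a finite measure `μ` whose atoms are the jumps of `u` and
for which every weighted variation is `∫ ρ dμ` (`IsBV.exists_isVariationMeasure`). Since a countable
set off the jump set is `μ`-null, the first two terms of the limit energy are `σ ∫ (ξ⁻)² dμ`
(`IsVariationMeasure.lintegral_eq`).

Modica–Mortola term. Let `H` be the primitive of `√F` that vanishes at `1`, so that `G = |H|`. By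
the arithmetic-geometric mean inequality the energy of `v` on an interval is at least the variation
of `H ∘ v` there (`ofReal_abs_primH_sub_le`). Bounded energy forces `v_ε` to come close to `1` in
every interval, and graph convergence forces it to come close to `ξ⁻(x)` and `ξ⁺(x)` near `x`.
Around an interior point `H ∘ v_ε` thus runs from about `0` through `-G(ξ⁻)` and `G(ξ⁺)`, in some
order, back to about `0`, at cost `2(G(ξ⁻) + G(ξ⁺))`. At an end point of an interval one outer leg
is absent, which saves at most the larger of the two `G`s. Disjoint balls add up, so bounded energy
makes the sum of the costs finite; with the intermediate value theorem this puts `Ξ` in `𝒜₀`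
(`isA0_and_sMM0_le`).

Liminf. Graph convergence keeps `v_ε²` above continuous minorants of `x ↦ min {y² | y ∈ Ξ x}`, up to
a small constant. The weighted variation is a supremum of `L¹`-continuous functionals of `u`, and
Fatou's lemma passes to the minimum itself (`IsVariationMeasure.lintegral_le_liminf`). At
exceptional jump points the sign condition makes this minimum `(ξ⁻)²`. When `σ > 0`, bounded
variation of `u` is a consequence: off the finite set where `Ξ` meets `[-1/2, 1/2]` the weights stay
away from zero, and a finite set is removable in one dimension (`isBV_of_liminf_lt_top`).

Limsup. Keep `u_ε = u` and build `w_ε` from nearly optimal profiles at finitely many exceptional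
points, two for each: one centred at the point itself, one beside it (`eventually_exists_bumps`). In
the interior the value at the point is exactly `ξ⁻`, so the jump there is weighted by `(ξ⁻)²`. At an
end point of an interval the costlier value sits at the end, where only one flank is paid for. The
remaining exceptional points and the punctured neighbourhoods of the chosen ones have small
`μ`-measure (`IsA0.eventually_exists_recovery`). A diagonal choice of the accuracy concludes
(`exists_recovery`). -/

instance instCompactSpacePt : (M : Dom) → CompactSpace M.Pt
  | interval a b _ => inferInstanceAs (CompactSpace (Set.Icc a b))
  | torus => by
    have : Fact ((0 : ℝ) < 1) := ⟨one_pos⟩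
    exact inferInstanceAs (CompactSpace (AddCircle (1 : ℝ)))

noncomputable instance instMeasurableSpacePt (M : Dom) : MeasurableSpace M.Pt := borel _

instance instBorelSpacePt (M : Dom) : BorelSpace M.Pt := ⟨rfl⟩

theorem left_lt_right : (M : Dom) → M.left < M.right
  | interval _ _ hab => hab
  | torus => one_pos

theorem param_coord : (M : Dom) → (x : M.Pt) → M.param (M.coord x) = x
  | interval _ _ hab, x => Set.projIcc_val hab.le x
  | torus, x => (AddCircle.equivIco (1 : ℝ) 0).symm_apply_apply x

theorem left_le_coord : (M : Dom) → (x : M.Pt) → M.left ≤ M.coord x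
  | interval _ _ _, x => x.2.1
  | torus, x => (AddCircle.equivIco (1 : ℝ) 0 x).2.1

theorem coord_le_right : (M : Dom) → (x : M.Pt) → M.coord x ≤ M.right
  | interval _ _ _, x => x.2.2
  | torus, x => by
    have := (AddCircle.equivIco (1 : ℝ) 0 x).2.2
    simp only [zero_add] at this
    exact this.le

theorem coord_torus_lt (x : torus.Pt) : torus.coord x < 1 := by
  have := (AddCircle.equivIco (1 : ℝ) 0 x).2.2
  simp only [zero_add] at this
  exact this

theorem param_torus_add_one (t : ℝ) : torus.param (t + 1) = torus.param t :=
  AddCircle.coe_add_period (1 : ℝ) t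

theorem param_torus_eq_iff {s t : ℝ} : torus.param s = torus.param t ↔ ∃ n : ℤ, s - t = n := by
  change (s : AddCircle (1 : ℝ)) = (t : AddCircle (1 : ℝ)) ↔ _
  rw [eq_comm, QuotientAddGroup.eq, AddSubgroup.mem_zmultiples_iff]
  simp only [zsmul_eq_mul, mul_one]
  constructor <;> rintro ⟨n, hn⟩ <;> exact ⟨n, by linarith⟩

theorem coord_param_of_mem_Ico {M : Dom} {t : ℝ} (ht : t ∈ Ico M.left M.right) :
    M.coord (M.param t) = t := by
  cases M with
  | interval a b hab =>
    exact congrArg Subtype.val (Set.projIcc_of_mem hab.le ⟨ht.1, ht.2.le⟩)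
  | torus =>
    have h : t ∈ Ico (0 : ℝ) (0 + 1) := by
      rw [zero_add]; exact ht
    exact congrArg Subtype.val ((AddCircle.equivIco (1 : ℝ) 0).apply_symm_apply ⟨t, h⟩)

theorem coord_param_interval {a b : ℝ} {hab : a < b} {t : ℝ} (ht : t ∈ Icc a b) :
    (interval a b hab).coord ((interval a b hab).param t) = t :=
  congrArg Subtype.val (Set.projIcc_of_mem hab.le ht)

theorem dist_param_le : (M : Dom) → (s t : ℝ) → dist (M.param s) (M.param t) ≤ |s - t|
  | interval a b hab, s, t => Set.abs_projIcc_sub_projIcc hab.le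
  | torus, s, t => by
    change dist (s : AddCircle (1 : ℝ)) (t : AddCircle (1 : ℝ)) ≤ _
    rw [dist_eq_norm, ← QuotientAddGroup.mk_sub]
    exact QuotientAddGroup.norm_mk_le_norm

theorem lipschitzWith_param (M : Dom) : LipschitzWith 1 M.param :=
  LipschitzWith.of_dist_le_mul fun s t => by
    simpa [Real.dist_eq] using M.dist_param_le s t

theorem continuous_param (M : Dom) : Continuous M.param := M.lipschitzWith_param.continuous

/-- The reals that are coordinates of a point of `M`: `[a, b]`, respectively `ℝ`. -/
def chart : Dom → Set ℝ
  | interval a b _ => Icc a b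
  | torus => univ

theorem coord_mem_chart : (M : Dom) → (x : M.Pt) → M.coord x ∈ M.chart
  | interval _ _ _, x => x.2
  | torus, _ => mem_univ _

/-- Points near `x` have coordinates near the one of `x`. -/
theorem exists_param_eq_of_dist_lt {M : Dom} {x y : M.Pt} {δ : ℝ} (h : dist y x < δ) :
    ∃ t ∈ M.chart, |t - M.coord x| < δ ∧ M.param t = y := by
  cases M with
  | interval a b hab => exact ⟨_, coord_mem_chart _ y, h, param_coord _ y⟩
  | torus =>
    -- Rounding picks the representative of `y` nearest to the coordinate of `x`. It may leave `[0,
    -- 1)`, which is why the chart of the torus is all of `ℝ`.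
    set s := torus.coord y - torus.coord x
    refine ⟨torus.coord y - round s, mem_univ _, ?_, ?_⟩
    · have h1 : dist (torus.param (torus.coord y)) (torus.param (torus.coord x)) < δ := by
        rwa [param_coord, param_coord]
      have h2 : dist (torus.param (torus.coord y)) (torus.param (torus.coord x))
          = |s - round s| := by
        change dist ((torus.coord y : ℝ) : AddCircle (1 : ℝ))
          ((torus.coord x : ℝ) : AddCircle (1 : ℝ)) = _
        rw [dist_eq_norm, ← QuotientAddGroup.mk_sub]
        exact UnitAddCircle.norm_eq
      rw [h2] at h1
      convert h1 using 2
      simp only [s]; ring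
    · conv_rhs => rw [← param_coord torus y]
      exact param_torus_eq_iff.2 ⟨-round s, by push_cast; ring⟩

/-- Continuity can be tested in the coordinate. -/
theorem continuous_of_continuousOn_comp_param {M : Dom} {Y : Type*} [TopologicalSpace Y]
    {f : M.Pt → Y} (hf : ContinuousOn (f ∘ M.param) (Icc M.left M.right)) : Continuous f := by
  refine continuous_iff_isClosed.2 fun C hC => ?_
  -- Preimages of closed sets are images of compact subsets of the parameter interval.
  have h : f ⁻¹' C = M.param '' (Icc M.left M.right ∩ (f ∘ M.param) ⁻¹' C) := by
    ext x
    constructor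
    · intro hx
      refine ⟨M.coord x, ⟨⟨M.left_le_coord x, M.coord_le_right x⟩, ?_⟩, M.param_coord x⟩
      simpa [M.param_coord] using hx
    · rintro ⟨t, ht, rfl⟩
      exact ht.2
  rw [h]
  exact ((isCompact_Icc.of_isClosed_subset (hf.preimage_isClosed_of_isClosed isClosed_Icc hC)
    inter_subset_left).image M.continuous_param).isClosed

theorem isOpen_inner : (M : Dom) → IsOpen M.inner
  | interval a b _ => (isOpen_Ioo (a := a) (b := b)).preimage continuous_subtype_val
  | torus => isOpen_univ

theorem param_mem_inner {M : Dom} {t : ℝ} (ht : t ∈ Ioo M.left M.right) :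
    M.param t ∈ M.inner := by
  cases M with
  | interval a b hab =>
    change t ∈ Ioo a b at ht
    change ((interval a b hab).coord ((interval a b hab).param t)) ∈ Ioo a b
    rwa [coord_param_interval (Ioo_subset_Icc_self ht)]
  | torus => exact mem_univ _

theorem coord_mem_Ioo_of_mem_inner {a b : ℝ} {hab : a < b} {x : (interval a b hab).Pt} :
    x ∈ (interval a b hab).inner ↔ (interval a b hab).coord x ∈ Ioo a b := Iff.rfl

/-- The complement of a countable subset of `M` is dense, even in the coordinate. -/
theorem exists_param_notMem_of_countable {M : Dom} {C : Set M.Pt} (hC : C.Countable) {s t : ℝ}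
    (hst : s < t) (hs : M.left ≤ s) (ht : t ≤ M.right) : ∃ r ∈ Ioo s t, M.param r ∉ C := by
  by_contra! h
  have : Ioo s t ⊆ M.coord '' C := fun r hr =>
    ⟨M.param r, h r hr, coord_param_of_mem_Ico ⟨hs.trans hr.1.le, hr.2.trans_le ht⟩⟩
  exact (Cardinal.Real.Ioo_countable_iff.1 ((hC.image _).mono this)).not_gt hst

/-- A one-sided interval is enough: it lies to the left of the coordinate, or to the right when the
coordinate is the left end. So end points need no separate treatment later. -/
theorem exists_subinterval {M : Dom} (x : M.Pt) {δ : ℝ} (hδ : 0 < δ) :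
    ∃ s t, s < t ∧ M.left ≤ s ∧ t ≤ M.right ∧ ∀ r ∈ Ioo s t, |r - M.coord x| < δ := by
  have h1 := M.left_le_coord x
  have h2 := M.coord_le_right x
  have h3 := M.left_lt_right
  rcases h1.lt_or_eq with h | h
  · refine ⟨max M.left (M.coord x - δ), M.coord x, by simp [h, hδ], le_max_left _ _, h2, ?_⟩
    rintro r ⟨hr1, hr2⟩
    rw [max_lt_iff] at hr1
    rw [abs_lt]; constructor <;> linarith
  · refine ⟨M.coord x, min M.right (M.coord x + δ), by simp [← h, h3, hδ], h1, min_le_left _ _, ?_⟩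
    rintro r ⟨hr1, hr2⟩
    rw [lt_min_iff] at hr2
    rw [abs_lt]; constructor <;> linarith

end Dom

/-! ### Functions of bounded variation on an open interval -/

/-- The test functions of the variation on `(α, β)`: the `C¹` functions with compact support in
`(α, β)` and values in `[-1, 1]`. -/
structure IsIntervalTest (α β : ℝ) (φ : ℝ → ℝ) : Prop where
  contDiff : ContDiff ℝ 1 φ
  exists_support : ∃ s t, α < s ∧ t < β ∧ ∀ x, x ∉ Icc s t → φ x = 0
  abs_le : ∀ x, |φ x| ≤ 1

/-! ### Mollification kernels and their primitives -/

section Kernel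

variable {ψ : ℝ → ℝ} {r : ℝ}

theorem hasDerivAt_kernelPrimitive (hψ : Continuous ψ) (t : ℝ) :
    HasDerivAt (fun t => ∫ s in (-r)..t, ψ s) (ψ t) t :=
  intervalIntegral.integral_hasDerivAt_right (hψ.intervalIntegrable _ _)
    hψ.aestronglyMeasurable.stronglyMeasurableAtFilter hψ.continuousAt

theorem kernelPrimitive_monotone (hψ : Continuous ψ) (h0 : ∀ t, 0 ≤ ψ t) :
    Monotone (fun t => ∫ s in (-r)..t, ψ s) :=
  monotone_of_deriv_nonneg (fun t => (hasDerivAt_kernelPrimitive hψ t).differentiableAt)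
    fun t => by rw [(hasDerivAt_kernelPrimitive hψ t).deriv]; exact h0 t

theorem kernelPrimitive_of_le (hs : ∀ t, r ≤ |t| → ψ t = 0) {t : ℝ} (ht : t ≤ -r) :
    ∫ s in (-r)..t, ψ s = 0 := by
  rw [intervalIntegral.integral_zero_ae]
  refine Eventually.of_forall fun s hs' => hs s ?_
  rw [uIoc_of_ge ht] at hs'
  have := neg_abs_le s
  have := hs'.2
  linarith [neg_le_abs s]

theorem kernelPrimitive_of_ge (hs : ∀ t, r ≤ |t| → ψ t = 0) (h1 : ∫ t, ψ t = 1)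
    {t : ℝ} (ht : r ≤ t) : ∫ s in (-r)..t, ψ s = 1 := by
  rw [intervalIntegral.integral_eq_integral_of_support_subset, h1]
  intro s h
  have : |s| < r := by
    by_contra! h'
    exact h (hs s h')
  rw [abs_lt] at this
  exact ⟨this.1, by linarith⟩

/-- A mollified function has its variation along finitely many points bounded by the values on
test functions. -/
theorem sum_abs_sub_mollified_le {α β : ℝ} {f : ℝ → ℝ} (hf : IntegrableOn f (Ioo α β)) {C : ℝ}
    (hC : ∀ φ, IsIntervalTest α β φ → ∫ x in Ioo α β, deriv φ x * f x ≤ C)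
    (hψ : Continuous ψ) (h0 : ∀ t, 0 ≤ ψ t) (hs : ∀ t, r ≤ |t| → ψ t = 0)
    (h1 : ∫ t, ψ t = 1) {n : ℕ} {x : ℕ → ℝ} (hx : Monotone x) (hα : α < x 0 - r)
    (hβ : x n + r < β) :
    ∑ i ∈ Finset.range n, |(∫ t in Ioo α β, ψ (t - x (i + 1)) * f t) -
      ∫ t in Ioo α β, ψ (t - x i) * f t| ≤ C := by
  set Ψ : ℝ → ℝ := fun t => ∫ s in (-r)..t, ψ s with hΨ
  set U : ℝ → ℝ := fun y => ∫ t in Ioo α β, ψ (t - y) * f t with hU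
  have hΨd : ∀ t, HasDerivAt Ψ (ψ t) t := hasDerivAt_kernelPrimitive hψ
  have hΨm : Monotone Ψ := kernelPrimitive_monotone hψ h0
  have hΨ0 : ∀ t, t ≤ -r → Ψ t = 0 := fun t => kernelPrimitive_of_le hs
  have hΨ1 : ∀ t, r ≤ t → Ψ t = 1 := fun t => kernelPrimitive_of_ge hs h1
  have hΨ0' : ∀ t, 0 ≤ Ψ t := fun t => by
    rcases le_total t (-r) with h | h
    · rw [hΨ0 t h]
    · rw [← hΨ0 (-r) le_rfl]; exact hΨm h
  have hΨ1' : ∀ t, Ψ t ≤ 1 := fun t => by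
    rcases le_total r t with h | h
    · rw [hΨ1 t h]
    · rw [← hΨ1 r le_rfl]; exact hΨm h
  -- The signs turn the increments of the mollified function into absolute values when `deriv φ` is
  -- paired with `f`.
  set s : ℕ → ℝ := fun i => SignType.sign (U (x i) - U (x (i + 1))) with hsdef
  have hs1 : ∀ i, |s i| ≤ 1 := fun i => by
    simp only [hsdef]
    rcases lt_trichotomy (U (x i) - U (x (i + 1))) 0 with h | h | h
    · simp [sign_neg h]
    · simp [h]
    · simp [sign_pos h]
  -- Since `Ψ` increases from `0` to `1` and the `x i` are ordered, the brackets are nonnegative and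
  -- telescope to at most `1`. This bounds `φ` for any choice of signs.
  set φ : ℝ → ℝ := fun t => ∑ i ∈ Finset.range n, s i * (Ψ (t - x i) - Ψ (t - x (i + 1))) with hφ
  have hφd : ∀ t, HasDerivAt φ (∑ i ∈ Finset.range n, s i * (ψ (t - x i) - ψ (t - x (i + 1)))) t :=
    fun t => by
      refine HasDerivAt.fun_sum fun i _ => ?_
      exact (((hΨd _).comp_sub_const t (x i)).sub
        ((hΨd _).comp_sub_const t (x (i + 1)))).const_mul (s i)
  have hφd' : deriv φ = fun t => ∑ i ∈ Finset.range n, s i * (ψ (t - x i) - ψ (t - x (i + 1))) :=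
    funext fun t => (hφd t).deriv
  have htest : IsIntervalTest α β φ := by
    refine ⟨?_, ⟨x 0 - r, x n + r, hα, hβ, ?_⟩, ?_⟩
    · rw [contDiff_one_iff_deriv, hφd']
      exact ⟨fun t => (hφd t).differentiableAt, by fun_prop⟩
    · intro t ht
      refine Finset.sum_eq_zero fun i hi => ?_
      have hi' : i < n := Finset.mem_range.1 hi
      have e1 : x 0 ≤ x i := hx (Nat.zero_le _)
      have e2 : x i ≤ x (i + 1) := hx (Nat.le_succ _)
      have e3 : x (i + 1) ≤ x n := hx hi'
      rcases not_and_or.1 ht with h | h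
      · rw [hΨ0 _ (by linarith), hΨ0 _ (by linarith)]; simp
      · rw [hΨ1 _ (by linarith), hΨ1 _ (by linarith)]; simp
    · intro t
      calc |φ t| ≤ ∑ i ∈ Finset.range n, |s i * (Ψ (t - x i) - Ψ (t - x (i + 1)))| :=
            Finset.abs_sum_le_sum_abs _ _
        _ ≤ ∑ i ∈ Finset.range n, (Ψ (t - x i) - Ψ (t - x (i + 1))) := by
            refine Finset.sum_le_sum fun i _ => ?_
            have h : 0 ≤ Ψ (t - x i) - Ψ (t - x (i + 1)) :=
              sub_nonneg.2 (hΨm (by linarith [hx (Nat.le_succ i)]))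
            rw [abs_mul, abs_of_nonneg h]
            exact mul_le_of_le_one_left h (hs1 i)
        _ = Ψ (t - x 0) - Ψ (t - x n) := Finset.sum_range_sub' (fun i => Ψ (t - x i)) n
        _ ≤ 1 := by linarith [hΨ0' (t - x n), hΨ1' (t - x 0)]
  have hcs : HasCompactSupport ψ := HasCompactSupport.intro (isCompact_Icc (a := -r) (b := r))
    fun t ht => hs t (by
      by_contra! h
      exact ht (abs_le.1 h.le))
  obtain ⟨B, hB⟩ := hψ.bounded_above_of_compact_support hcs
  have hInt : ∀ y, IntegrableOn (fun t => ψ (t - y) * f t) (Ioo α β) := fun y => by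
    refine Integrable.bdd_mul hf (c := B) (by fun_prop) (Eventually.of_forall fun t => hB _)
  have key := hC φ htest
  calc _ = ∑ i ∈ Finset.range n, s i * (U (x i) - U (x (i + 1))) := by
        refine Finset.sum_congr rfl fun i _ => ?_
        rw [abs_sub_comm]
        exact (sign_mul_self (U (x i) - U (x (i + 1)))).symm
    _ = ∫ t in Ioo α β, deriv φ t * f t := by
        simp only [hφd', Finset.sum_mul]
        rw [integral_finsetSum]
        · refine Finset.sum_congr rfl fun i _ => ?_
          simp only [hU]
          rw [← integral_sub (hInt _) (hInt _), ← integral_const_mul]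
          congr 1; ext t; ring
        · intro i _
          have := ((hInt (x i)).sub (hInt (x (i + 1)))).const_mul (s i)
          refine this.congr (Eventually.of_forall fun t => ?_)
          simp only [Pi.sub_apply]; ring
    _ ≤ C := key

end Kernel

/-- A function whose distributional derivative on `(α, β)` is bounded in the sup norm has bounded
variation on a subset of full measure. -/
theorem exists_eVariationOn_le {α β : ℝ} {f : ℝ → ℝ} (hf : IntegrableOn f (Ioo α β)) {C : ℝ}
    (hC : ∀ φ, IsIntervalTest α β φ → ∫ x in Ioo α β, deriv φ x * f x ≤ C) :
    ∃ D ⊆ Ioo α β, (∀ᵐ x ∂volume.restrict (Ioo α β), x ∈ D) ∧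
      eVariationOn f D ≤ ENNReal.ofReal C := by
  set b : ℕ → ContDiffBump (0 : ℝ) := fun n =>
    ⟨1 / (n + 1 : ℝ) / 2, 1 / (n + 1 : ℝ), by positivity, half_lt_self (by positivity)⟩ with hb
  set ψ : ℕ → ℝ → ℝ := fun n => (b n).normed volume with hψ
  set U : ℕ → ℝ → ℝ := fun n y => ∫ t in Ioo α β, ψ n (t - y) * f t with hU
  have hrt : Tendsto (fun n : ℕ => 1 / (n + 1 : ℝ)) atTop (𝓝 0) :=
    tendsto_one_div_add_atTop_nhds_zero_nat
  have hconv := ContDiffBump.ae_convolution_tendsto_right_of_locallyIntegrable (φ := b)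
    (μ := volume) (l := atTop) (K := 2) hrt
    (Eventually.of_forall fun n => by simp only [hb]; linarith)
    (hf.integrable_indicator measurableSet_Ioo).locallyIntegrable
  have hUeq : ∀ n y, convolution ((b n).normed volume) ((Ioo α β).indicator f)
      (ContinuousLinearMap.lsmul ℝ ℝ) volume y = U n y := fun n y => by
    rw [convolution_eq_swap]
    simp only [hU]
    rw [← integral_indicator measurableSet_Ioo]
    congr 1; ext t
    by_cases ht : t ∈ Ioo α β
    · simp only [indicator_of_mem ht, ContinuousLinearMap.lsmul_apply, smul_eq_mul, hψ]
      rw [← (b n).normed_neg (t - y), neg_sub]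
    · simp [indicator_of_notMem ht]
  -- `D` consists of the points where the mollifications converge to `f`. A variation sum along
  -- points of `D` is a limit of mollified sums, each at most `C` once the kernel radius fits
  -- between the points and the ends of the interval.
  refine ⟨{x | x ∈ Ioo α β ∧ Tendsto (fun n => U n x) atTop (𝓝 (f x))}, fun x hx => hx.1, ?_, ?_⟩
  · rw [ae_restrict_iff' measurableSet_Ioo]
    filter_upwards [hconv] with x hx hxI
    refine ⟨hxI, ?_⟩
    simp only [hUeq, indicator_of_mem hxI] at hx
    exact hx
  · refine iSup_le ?_
    rintro ⟨n, x, hx, hxD⟩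
    simp only
    have h1 : Tendsto (fun k => ∑ i ∈ Finset.range n, |U k (x (i + 1)) - U k (x i)|) atTop
        (𝓝 (∑ i ∈ Finset.range n, |f (x (i + 1)) - f (x i)|)) :=
      tendsto_finsetSum _ fun i _ => ((hxD (i + 1)).2.sub (hxD i).2).abs
    have h2 : ∀ᶠ k in atTop, ∑ i ∈ Finset.range n, |U k (x (i + 1)) - U k (x i)| ≤ C := by
      have e1 : 0 < x 0 - α := sub_pos.2 (hxD 0).1.1
      have e2 : 0 < β - x n := sub_pos.2 (hxD n).1.2
      filter_upwards [hrt.eventually_lt_const e1, hrt.eventually_lt_const e2] with k hk1 hk2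
      refine sum_abs_sub_mollified_le (r := 1 / (k + 1 : ℝ)) hf hC (b k).continuous_normed
        (fun t => (b k).nonneg_normed t) ?_ (b k).integral_normed hx
        (by linarith) (by linarith)
      intro t ht
      by_contra h
      have : t ∈ Function.support ((b k).normed volume) := h
      rw [(b k).support_normed_eq, mem_ball_zero_iff, Real.norm_eq_abs] at this
      exact absurd this (not_lt.2 ht)
    have h3 := le_of_tendsto h1 h2
    calc ∑ i ∈ Finset.range n, edist (f (x (i + 1))) (f (x i))
        = ENNReal.ofReal (∑ i ∈ Finset.range n, |f (x (i + 1)) - f (x i)|) := by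
          rw [ENNReal.ofReal_sum_of_nonneg fun i _ => abs_nonneg _]
          simp only [edist_dist, Real.dist_eq]
      _ ≤ ENNReal.ofReal C := ENNReal.ofReal_le_ofReal h3

/-- A function whose distributional derivative on `(α, β)` is bounded in the sup norm is almost
everywhere the difference of two monotone functions. -/
theorem exists_monotone_sub_monotone {α β : ℝ} {f : ℝ → ℝ}
    (hf : IntegrableOn f (Ioo α β)) {C : ℝ}
    (hC : ∀ φ, IsIntervalTest α β φ → ∫ x in Ioo α β, deriv φ x * f x ≤ C) :
    ∃ p q : ℝ → ℝ, Monotone p ∧ Monotone q ∧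
      ∀ᵐ x ∂volume.restrict (Ioo α β), f x = p x - q x := by
  obtain ⟨D, -, hD, hV⟩ := exists_eVariationOn_le hf hC
  -- If `D` is empty the restricted measure is zero. Otherwise the Jordan decomposition on `D` is
  -- based at a point `c`; its two monotone parts are bounded, hence extend monotonically to `ℝ`.
  rcases D.eq_empty_or_nonempty with rfl | ⟨c, hc⟩
  · exact ⟨0, 0, monotone_const, monotone_const, hD.mono fun x hx => hx.elim⟩
  have hbv : BoundedVariationOn f D := (hV.trans_lt ENNReal.ofReal_lt_top).ne
  have hloc := hbv.locallyBoundedVariationOn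
  set V := (eVariationOn f D).toReal
  have hp : ∀ x ∈ D, |variationOnFromTo f D c x| ≤ V := fun x hx => by
    rcases le_total c x with h | h
    · rw [variationOnFromTo.eq_of_le _ _ h, abs_of_nonneg ENNReal.toReal_nonneg]
      exact ENNReal.toReal_mono hbv (eVariationOn.mono f inter_subset_left)
    · rw [variationOnFromTo.eq_of_ge _ _ h, abs_neg, abs_of_nonneg ENNReal.toReal_nonneg]
      exact ENNReal.toReal_mono hbv (eVariationOn.mono f inter_subset_left)
  have hfb : ∀ x ∈ D, |f x - f c| ≤ V := fun x hx => by
    rw [← Real.dist_eq]; exact hbv.dist_le hx hc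
  obtain ⟨p, hpm, hpe⟩ := (variationOnFromTo.monotoneOn hloc hc).exists_monotone_extension
    ⟨-V, by rintro _ ⟨x, hx, rfl⟩; exact (abs_le.1 (hp x hx)).1⟩
    ⟨V, by rintro _ ⟨x, hx, rfl⟩; exact (abs_le.1 (hp x hx)).2⟩
  obtain ⟨q, hqm, hqe⟩ := (variationOnFromTo.sub_self_monotoneOn hloc hc).exists_monotone_extension
    ⟨-V - V - f c, by
      rintro _ ⟨x, hx, rfl⟩
      simp only [Pi.sub_apply]
      linarith [(abs_le.1 (hp x hx)).1, (abs_le.1 (hfb x hx)).2]⟩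
    ⟨V + V - f c, by
      rintro _ ⟨x, hx, rfl⟩
      simp only [Pi.sub_apply]
      linarith [(abs_le.1 (hp x hx)).2, (abs_le.1 (hfb x hx)).1]⟩
  refine ⟨p, q, hpm, hqm, hD.mono fun x hx => ?_⟩
  rw [← hpe hx, ← hqe hx]
  simp

/-- Integration by parts against a monotone function. -/
theorem integral_deriv_mul_monotone {p : ℝ → ℝ} (hp : Monotone p) {α β : ℝ} (hαβ : α < β)
    {φ : ℝ → ℝ} (hφ : ContDiff ℝ 1 φ) :
    ∫ x in Ioo α β, deriv φ x * p x = φ β * Function.leftLim p β - φ α * Function.rightLim p α -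
      ∫ x in Ioo α β, φ x ∂hp.stieltjesFunction.measure := by
  set S := hp.stieltjesFunction with hS
  have hφ' : Continuous (deriv φ) := hφ.continuous_deriv le_rfl
  have hφc : Continuous φ := hφ.continuous
  set μ := S.measure.restrict (Ioo α β) with hμ
  set I := volume.restrict (Ioo α β) with hI
  have hleft : Function.leftLim S β = Function.leftLim p β :=
    leftLim_rightLim (hp.tendsto_leftLim β)
  have hSm : ∀ s ∈ Ico α β, S.measure.real (Ioo s β) = Function.leftLim p β - S s := by
    intro s hs
    rw [measureReal_def, StieltjesFunction.measure_Ioo, hleft, ENNReal.toReal_ofReal]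
    rw [sub_nonneg]
    exact hp.rightLim_le_leftLim hs.2
  have : IsFiniteMeasure μ := ⟨by
    rw [hμ, Measure.restrict_apply_univ, StieltjesFunction.measure_Ioo]
    exact ENNReal.ofReal_lt_top⟩
  obtain ⟨B, hB⟩ := isCompact_Icc.exists_bound_of_continuousOn (hφ'.continuousOn (s := Icc α β))
  have hInt : Integrable (Function.uncurry fun t s => (Iio t).indicator (deriv φ) s)
      (μ.prod I) := by
    refine Integrable.of_bound (C := B) ?_ ?_
    · refine Measurable.aestronglyMeasurable ?_
      have : (Function.uncurry fun t s => (Iio t).indicator (deriv φ) s) =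
          {z : ℝ × ℝ | z.2 < z.1}.indicator (fun z => deriv φ z.2) := by
        ext ⟨t, s⟩; simp [indicator]
      rw [this]
      exact (hφ'.measurable.comp measurable_snd).indicator
        (measurableSet_lt measurable_snd measurable_fst)
    · have : ∀ᵐ z ∂(μ.prod I), z.2 ∈ Ioo α β :=
        Measure.quasiMeasurePreserving_snd.ae (ae_restrict_mem measurableSet_Ioo)
      filter_upwards [this] with z hz
      refine (norm_indicator_le_norm_self _ _).trans (hB _ (Ioo_subset_Icc_self hz))
  -- Write `φ t` as `φ α` plus the integral of its derivative over `(α, t)`. After Fubini the inner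
  -- integral is the Stieltjes mass of `(s, β)`.
  have h1 : ∫ t, φ t ∂μ = ∫ t, (φ α + ∫ s, (Iio t).indicator (deriv φ) s ∂I) ∂μ := by
    refine integral_congr_ae ?_
    filter_upwards [ae_restrict_mem measurableSet_Ioo] with t ht
    rw [integral_indicator measurableSet_Iio, hI, Measure.restrict_restrict measurableSet_Iio]
    have : Iio t ∩ Ioo α β = Ioo α t := by
      ext s; simp only [mem_inter_iff, mem_Iio, mem_Ioo]
      exact ⟨fun h => ⟨h.2.1, h.1⟩, fun h => ⟨h.2, h.1, h.2.trans ht.2⟩⟩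
    rw [this, ← integral_Ioc_eq_integral_Ioo, ← intervalIntegral.integral_of_le ht.1.le,
      intervalIntegral.integral_deriv_eq_sub (fun x _ => hφ.differentiable one_ne_zero x)
        (hφ'.intervalIntegrable _ _)]
    ring
  have h2 : ∫ s, ∫ t, (Iio t).indicator (deriv φ) s ∂μ ∂I =
      ∫ s, (deriv φ s * Function.leftLim p β - deriv φ s * p s) ∂I := by
    refine integral_congr_ae ?_
    -- The right-continuous version `S` agrees with `p` except at countably many points.
    have hcount : ∀ᵐ s ∂I, s ∉ {x | ¬ContinuousAt p x} :=
      ae_restrict_of_ae ((hp.countable_not_continuousAt).ae_notMem _)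
    filter_upwards [ae_restrict_mem measurableSet_Ioo, hcount] with s hs hsc
    have e1 : ∀ t, (Iio t).indicator (deriv φ) s = (Ioi s).indicator (fun _ => deriv φ s) t :=
      fun t => by simp [indicator]
    have e2 : S s = p s := by
      have h : ContinuousAt p s := by simpa using hsc
      rw [hS, hp.stieltjesFunction_eq]
      exact h.continuousWithinAt.rightLim_eq
    have e3 : Ioi s ∩ Ioo α β = Ioo s β := by
      ext t; simp only [mem_inter_iff, mem_Ioi, mem_Ioo]
      exact ⟨fun h => ⟨h.1, h.2.2⟩, fun h => ⟨h.1, hs.1.trans h.1, h.2⟩⟩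
    simp only [e1]
    rw [integral_indicator measurableSet_Ioi, hμ, Measure.restrict_restrict measurableSet_Ioi, e3,
      setIntegral_const, hSm s ⟨hs.1.le, hs.2⟩, e2, smul_eq_mul]
    ring
  have hi1 : Integrable (fun s => deriv φ s * Function.leftLim p β) I :=
    ((hφ'.mul continuous_const).integrableOn_Icc (a := α) (b := β)).mono_set Ioo_subset_Icc_self
  have hi2 : Integrable (fun s => deriv φ s * p s) I := by
    have hpI : Integrable p I :=
      (hp.locallyIntegrable.integrableOn_isCompact isCompact_Icc).mono_set
        (Ioo_subset_Icc_self (a := α) (b := β))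
    refine hpI.bdd_mul (c := B) hφ'.aestronglyMeasurable ?_
    filter_upwards [ae_restrict_mem measurableSet_Ioo] with s hs
    exact hB s (Ioo_subset_Icc_self hs)
  have h3 : ∫ s, deriv φ s ∂I = φ β - φ α := by
    rw [hI, ← integral_Ioc_eq_integral_Ioo, ← intervalIntegral.integral_of_le hαβ.le,
      intervalIntegral.integral_deriv_eq_sub (fun x _ => hφ.differentiable one_ne_zero x)
        (hφ'.intervalIntegrable _ _)]
  have h4 : Integrable (fun t => ∫ s, (Iio t).indicator (deriv φ) s ∂I) μ :=
    hInt.integral_prod_left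
  rw [integral_add (integrable_const _) h4, integral_const,
    integral_integral_swap hInt, h2, integral_sub hi1 hi2, integral_mul_const, h3, hμ,
    measureReal_restrict_apply_univ, hSm α ⟨le_rfl, hαβ⟩] at h1
  have e : S α = Function.rightLim p α := rfl
  rw [h1, e, smul_eq_mul]
  ring

/-! ### Test functions on `M` -/

/-- Periodic extension of a `C¹` function with compact support in `(0, 1)`, respectively its
restriction to `[a, b]`. -/
theorem IsIntervalTest.contDiff_comp_coord {M : Dom} {φ : ℝ → ℝ}
    (hφ : IsIntervalTest M.left M.right φ) : ContDiff ℝ 1 (φ ∘ M.coord ∘ M.param) := by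
  obtain ⟨s, t, hs, ht, h0⟩ := hφ.exists_support
  cases M with
  | interval a b hab =>
    convert hφ.contDiff using 1
    ext r
    change a < s at hs
    change t < b at ht
    simp only [Function.comp_apply]
    rcases lt_or_ge r a with h | h
    · have : (Dom.interval a b hab).param r = (Dom.interval a b hab).param a :=
        (Set.projIcc_of_le_left hab.le h.le).trans (Set.projIcc_left hab.le).symm
      rw [this, Dom.coord_param_interval ⟨le_rfl, hab.le⟩,
        h0 a (fun h' => hs.not_ge h'.1), h0 r (fun h' => (h.trans hs).not_ge h'.1)]
    · rcases lt_or_ge b r with h' | h'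
      · have : (Dom.interval a b hab).param r = (Dom.interval a b hab).param b :=
          (Set.projIcc_of_right_le hab.le h'.le).trans (Set.projIcc_right hab.le).symm
        rw [this, Dom.coord_param_interval ⟨hab.le, le_rfl⟩,
          h0 b (fun h' => ht.not_ge h'.2), h0 r (fun h'' => (ht.trans h').not_ge h''.2)]
      · rw [Dom.coord_param_interval ⟨h, h'⟩]
  | torus =>
    change (0 : ℝ) < s at hs
    change t < (1 : ℝ) at ht
    set f : ℝ → ℝ := φ ∘ Dom.torus.coord ∘ Dom.torus.param with hf
    have hf1 : ∀ r ∈ Ico (0 : ℝ) 1, f r = φ r := fun r hr => by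
      simp only [hf, Function.comp_apply]
      rw [Dom.coord_param_of_mem_Ico hr]
    have hfp : ∀ (n : ℤ) (r : ℝ), f (r - n) = f r := fun n r => by
      simp only [hf, Function.comp_apply]
      rw [Dom.param_torus_eq_iff.2 ⟨-n, by push_cast; ring⟩]
    have key : ∀ r ∈ Ico (0 : ℝ) 1, ContDiffAt ℝ 1 f r := fun r hr => by
      rcases hr.1.lt_or_eq with h | h
      · refine hφ.contDiff.contDiffAt.congr_of_eventuallyEq ?_
        filter_upwards [Ioo_mem_nhds h hr.2] with r' hr'
        exact hf1 r' ⟨hr'.1.le, hr'.2⟩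
      · subst h
        -- At the seam the periodic extension vanishes on both sides, since the support of `φ` keeps
        -- a distance from `0` and from `1`.
        refine (contDiffAt_const (c := (0 : ℝ))).congr_of_eventuallyEq ?_
        obtain ⟨c, h1, h2⟩ : ∃ c : ℝ, 0 < c ∧ c < min (min s (1 - t)) 1 :=
          exists_between (by simp only [lt_min_iff]; exact ⟨⟨hs, by linarith⟩, one_pos⟩)
        simp only [lt_min_iff] at h2
        obtain ⟨⟨h4, h5⟩, h6⟩ := h2
        filter_upwards [Ioo_mem_nhds (neg_neg_of_pos h1) h1] with r' hr'
        rcases le_or_gt 0 r' with h3 | h3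
        · rw [hf1 r' ⟨h3, by linarith [hr'.2]⟩]
          exact h0 _ fun h => by linarith [h.1, hr'.2]
        · rw [← hfp (-1) r', hf1 _ ⟨by push_cast; linarith [hr'.1], by push_cast; linarith⟩]
          exact h0 _ fun h => by push_cast at h; linarith [h.2, hr'.1]
    rw [contDiff_iff_contDiffAt]
    intro r
    have h1 := key (Int.fract r) ⟨Int.fract_nonneg r, Int.fract_lt_one r⟩
    have h2 : f = fun r' => f (r' - ⌊r⌋) := funext fun r' => (hfp _ _).symm
    rw [h2]
    exact ContDiffAt.comp r (g := f) (f := fun r' => r' - (⌊r⌋ : ℝ)) h1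
      (contDiffAt_id.sub contDiffAt_const)

theorem IsIntervalTest.mono {α β α' β' : ℝ} {φ : ℝ → ℝ} (hφ : IsIntervalTest α β φ)
    (hα : α' ≤ α) (hβ : β ≤ β') : IsIntervalTest α' β' φ := by
  obtain ⟨s, t, hs, ht, h0⟩ := hφ.exists_support
  exact ⟨hφ.contDiff, ⟨s, t, hα.trans_lt hs, ht.trans_le hβ, h0⟩, hφ.abs_le⟩

theorem IsIntervalTest.isTest_comp_coord {M : Dom} {α β : ℝ} {φ : ℝ → ℝ}
    (hφ : IsIntervalTest α β φ) (hα : M.left ≤ α) (hβ : β ≤ M.right) {A : Set M.Pt}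
    (hA : ∀ t ∈ Ioo α β, M.param t ∈ A) : IsTest M A (φ ∘ M.coord) := by
  refine ⟨(hφ.mono hα hβ).contDiff_comp_coord, ?_⟩
  obtain ⟨s, t, hs, ht, h0⟩ := hφ.exists_support
  have h1 : tsupport (φ ∘ M.coord) ⊆ M.param '' Icc s t := by
    refine closure_minimal ?_ (isCompact_Icc.image M.continuous_param).isClosed
    intro x hx
    refine ⟨M.coord x, ?_, M.param_coord x⟩
    by_contra h
    exact hx (h0 _ h)
  refine h1.trans ?_
  rintro _ ⟨r, hr, rfl⟩
  have hr' : r ∈ Ioo α β := ⟨hs.trans_le hr.1, hr.2.trans_lt ht⟩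
  exact ⟨hA r hr', Dom.param_mem_inner ⟨hα.trans_lt hr'.1, hr'.2.trans_le hβ⟩⟩

/-- The variation of `u` bounds the variation in the coordinate. -/
theorem ofReal_integral_deriv_mul_le_weightedTV {M : Dom} {α β : ℝ} {φ : ℝ → ℝ}
    (hφ : IsIntervalTest α β φ) (hα : M.left ≤ α) (hβ : β ≤ M.right) {A : Set M.Pt}
    (hA : ∀ t ∈ Ioo α β, M.param t ∈ A) (u : M.Pt → ℝ) :
    ENNReal.ofReal (∫ t in Ioo α β, deriv φ t * u (M.param t)) ≤
      weightedTV M (fun _ => 1) A u := by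
  have h1 := hφ.isTest_comp_coord hα hβ hA
  refine le_iSup_of_le (φ ∘ M.coord) (le_iSup_of_le h1 (le_iSup_of_le (fun x => hφ.abs_le _) ?_))
  refine ENNReal.ofReal_le_ofReal (le_of_eq ?_)
  have hsub : Ioo α β ⊆ Ioo M.left M.right := Ioo_subset_Ioo hα hβ
  obtain ⟨s, t, hs, ht, h0⟩ := hφ.exists_support
  have h2 : ∀ r ∈ Ioo M.left M.right, deriv ((φ ∘ M.coord) ∘ M.param) r = deriv φ r := by
    intro r hr
    refine EventuallyEq.deriv_eq ?_
    filter_upwards [Ioo_mem_nhds hr.1 hr.2] with r' hr'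
    simp only [Function.comp_apply]
    rw [Dom.coord_param_of_mem_Ico ⟨hr'.1.le, hr'.2⟩]
  have h3 : ∀ r ∉ Ioo α β, deriv φ r = 0 := by
    intro r hr
    have : φ =ᶠ[𝓝 r] fun _ => 0 := by
      filter_upwards [isClosed_Icc.isOpen_compl.mem_nhds (show r ∈ (Icc s t)ᶜ from
        fun h => hr ⟨hs.trans_le h.1, h.2.trans_lt ht⟩)] with r' hr'
      exact h0 r' hr'
    rw [this.deriv_eq]; simp
  have h4 : ∫ r in Ioo M.left M.right, deriv ((φ ∘ M.coord) ∘ M.param) r * u (M.param r) =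
      ∫ r in Ioo M.left M.right, deriv φ r * u (M.param r) :=
    setIntegral_congr_fun measurableSet_Ioo fun r hr => by simp only [h2 r hr]
  rw [Dom.leb, h4]
  refine (setIntegral_eq_of_subset_of_forall_sdiff_eq_zero measurableSet_Ioo hsub ?_).symm
  intro r hr
  rw [h3 r hr.2, zero_mul]

/-! ### Smoothing of continuous functions -/

/-- Steklov average of a function. -/
noncomputable def steklov (h : ℝ) (f : ℝ → ℝ) (t : ℝ) : ℝ :=
  (2 * h)⁻¹ * ∫ s in (t - h)..(t + h), f s

/-- The derivative is the symmetric difference quotient of `f`, which is continuous. -/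
theorem contDiff_steklov {f : ℝ → ℝ} (hf : Continuous f) (h : ℝ) : ContDiff ℝ 1 (steklov h f) := by
  have hd : ∀ t, HasDerivAt (steklov h f) ((2 * h)⁻¹ * (f (t + h) - f (t - h))) t := fun t => by
    have h1 : ∀ r, HasDerivAt (fun r => ∫ s in (0 : ℝ)..r, f s) (f r) r := fun r =>
      intervalIntegral.integral_hasDerivAt_right (hf.intervalIntegrable _ _)
        hf.aestronglyMeasurable.stronglyMeasurableAtFilter hf.continuousAt
    have h2 := ((((h1 (t + h)).comp_add_const t h).sub ((h1 (t - h)).comp_sub_const t h)).const_mul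
      (2 * h)⁻¹)
    refine h2.congr_of_eventuallyEq (Eventually.of_forall fun r => ?_)
    simp only [steklov, Pi.sub_apply]
    rw [intervalIntegral.integral_interval_sub_left (hf.intervalIntegrable _ _)
      (hf.intervalIntegrable _ _)]
  rw [contDiff_one_iff_deriv]
  refine ⟨fun t => (hd t).differentiableAt, ?_⟩
  rw [funext fun t => (hd t).deriv]
  fun_prop

/-- An average inherits every bound that holds on its window. This single form yields vanishing (`c
= B = 0`), domination (`c = 0`) and closeness to a given value. -/
theorem abs_steklov_sub_le {f : ℝ → ℝ} (hf : Continuous f) {h : ℝ} (hh : 0 < h) {t c B : ℝ}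
    (hB : ∀ s, |s - t| ≤ h → |f s - c| ≤ B) : |steklov h f t - c| ≤ B := by
  have h1 : steklov h f t - c = (2 * h)⁻¹ * ∫ s in (t - h)..(t + h), (f s - c) := by
    rw [intervalIntegral.integral_sub (hf.intervalIntegrable _ _) (by simp), steklov]
    simp only [intervalIntegral.integral_const, smul_eq_mul]
    field_simp
    ring
  have h2 : ‖∫ s in (t - h)..(t + h), (f s - c)‖ ≤ B * |t + h - (t - h)| := by
    refine intervalIntegral.norm_integral_le_of_norm_le_const fun s hs => ?_
    rw [uIoc_of_le (by linarith)] at hs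
    exact hB s (abs_le.2 ⟨by linarith [hs.1], by linarith [hs.2]⟩)
  have h3 : t + h - (t - h) = 2 * h := by ring
  rw [h3, abs_of_pos (by positivity), Real.norm_eq_abs] at h2
  rw [h1, abs_mul, abs_of_pos (by positivity), inv_mul_le_iff₀ (by positivity)]
  linarith

/-- Soft thresholding. -/
def soft (d y : ℝ) : ℝ := max (y - d) 0 + min (y + d) 0

theorem continuous_soft (d : ℝ) : Continuous (soft d) := by unfold soft; fun_prop

theorem abs_soft {d : ℝ} (hd : 0 ≤ d) (y : ℝ) : |soft d y| = max (|y| - d) 0 := by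
  unfold soft; grind

theorem abs_soft_sub_le {d : ℝ} (hd : 0 ≤ d) (y : ℝ) : |soft d y - y| ≤ d := by
  unfold soft; grind

/-- A continuous function on `M` that vanishes off an open set is approximated from below by test
functions. -/
theorem exists_isTest_approx {M : Dom} {A : Set M.Pt} {g : M.Pt → ℝ} (hg : Continuous g)
    (hA : ∀ x, x ∉ A ∩ M.inner → g x = 0) {δ : ℝ} (hδ : 0 < δ) :
    ∃ φ, IsTest M A φ ∧ (∀ x, |φ x| ≤ |g x|) ∧ ∀ x, |φ x - g x| ≤ δ := by
  set d := δ / 2 with hd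
  have hd0 : 0 < d := by positivity
  obtain ⟨h0, hh0, hunif⟩ := Metric.uniformContinuous_iff.1
    (CompactSpace.uniformContinuous_of_continuous hg) (d / 2) (by positivity)
  set h := h0 / 2 with hhdef
  have hh : 0 < h := by positivity
  set f : ℝ → ℝ := fun t => soft d (g (M.param t)) with hf
  have hfc : Continuous f := (continuous_soft d).comp (hg.comp M.continuous_param)
  -- On a window of radius `h` the oscillation of `g` is at most `d / 2`, below the threshold `d`.
  -- Thresholding therefore leaves room for averaging: the result vanishes where `|g| ≤ d / 2`,
  -- stays below `|g|`, and is within `d + d / 2 ≤ δ` of `g`.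
  have hclose : ∀ s t, |s - t| ≤ h → |g (M.param s) - g (M.param t)| ≤ d / 2 := fun s t hst => by
    have := hunif (a := M.param s) (b := M.param t)
      ((M.dist_param_le s t).trans_lt (hst.trans_lt (half_lt_self hh0)))
    rw [Real.dist_eq] at this
    exact this.le
  have hzero : ∀ t, |g (M.param t)| ≤ d / 2 → steklov h f t = 0 := fun t ht => by
    have := abs_steklov_sub_le hfc hh (t := t) (c := 0) (B := 0) fun s hs => by
      rw [sub_zero, hf, abs_soft hd0.le]
      have := hclose s t hs
      grind
    simpa using this
  have hle : ∀ t, |steklov h f t| ≤ |g (M.param t)| := fun t => by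
    have := abs_steklov_sub_le hfc hh (t := t) (c := 0) (B := |g (M.param t)|) fun s hs => by
      rw [sub_zero, hf, abs_soft hd0.le]
      have := hclose s t hs
      grind
    simpa using this
  have hdist : ∀ t, |steklov h f t - g (M.param t)| ≤ δ := fun t => by
    refine abs_steklov_sub_le hfc hh fun s hs => ?_
    have h1 := hclose s t hs
    have h2 := abs_soft_sub_le hd0.le (g (M.param s))
    simp only [hf]
    have h3 := abs_sub_le (soft d (g (M.param s))) (g (M.param s)) (g (M.param t))
    linarith
  -- The average descends to a function on `M`: on an interval because it vanishes outside `[a, b]`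
  -- and at the ends, on the torus because it is periodic.
  have hcp : ∀ t, steklov h f (M.coord (M.param t)) = steklov h f t := by
    intro t
    cases M with
    | interval a b hab =>
      by_cases ht : t ∈ Icc a b
      · rw [Dom.coord_param_interval ht]
      · have hpt : g ((Dom.interval a b hab).param t) = 0 := by
          refine hA _ fun hmem => ?_
          have h2 : (Dom.interval a b hab).coord ((Dom.interval a b hab).param t) ∈ Ioo a b :=
            hmem.2
          rcases not_and_or.1 ht with h | h
          · have : (Dom.interval a b hab).param t = (Dom.interval a b hab).param a :=
              (Set.projIcc_of_le_left hab.le (not_le.1 h).le).trans (Set.projIcc_left hab.le).symm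
            rw [this, Dom.coord_param_interval ⟨le_rfl, hab.le⟩] at h2
            exact h2.1.false
          · have : (Dom.interval a b hab).param t = (Dom.interval a b hab).param b :=
              (Set.projIcc_of_right_le hab.le (not_le.1 h).le).trans (Set.projIcc_right hab.le).symm
            rw [this, Dom.coord_param_interval ⟨hab.le, le_rfl⟩] at h2
            exact h2.2.false
        rw [hzero t (by rw [hpt, abs_zero]; positivity), hzero _ (by
          rw [Dom.param_coord, hpt, abs_zero]; positivity)]
    | torus =>
      obtain ⟨n, hn⟩ := Dom.param_torus_eq_iff.1
        (Dom.param_coord Dom.torus (Dom.torus.param t))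
      have hper : ∀ s, f (s + n) = f s := fun s => by
        simp only [hf]
        rw [Dom.param_torus_eq_iff.2 ⟨n, by ring⟩]
      have : Dom.torus.coord (Dom.torus.param t) = t + n := by linarith
      rw [this]
      simp only [steklov]
      congr 1
      rw [show t + n - h = (t - h) + n by ring, show t + n + h = (t + h) + n by ring,
        ← intervalIntegral.integral_comp_add_right]
      simp only [hper]
  have hcomp : (steklov h f ∘ M.coord) ∘ M.param = steklov h f := funext hcp
  refine ⟨steklov h f ∘ M.coord, ⟨by rw [hcomp]; exact contDiff_steklov hfc h, ?_⟩, fun x => ?_,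
    fun x => ?_⟩
  · have h1 : tsupport (steklov h f ∘ M.coord) ⊆ {x | d / 2 ≤ |g x|} := by
      refine closure_minimal ?_ (isClosed_le continuous_const hg.abs)
      intro x hx
      by_contra h
      refine hx (hzero _ ?_)
      rw [M.param_coord]
      exact (not_le.1 h).le
    refine h1.trans fun x hx => ?_
    by_contra h
    rw [mem_ofPred_eq, hA x h, abs_zero] at hx
    linarith
  · simpa [M.param_coord] using hle (M.coord x)
  · simpa [M.param_coord] using hdist (M.coord x)

/-! ### The variation measure -/

/-- Polar decomposition of the difference of two finite measures. -/
theorem exists_polar_decomposition {X : Type*} [MeasurableSpace X] [MeasurableSingletonClass X]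
    (ν₁ ν₂ : Measure X) [IsFiniteMeasure ν₁] [IsFiniteMeasure ν₂] :
    ∃ (μ : Measure X) (s : X → ℝ), IsFiniteMeasure μ ∧ Measurable s ∧ (∀ x, |s x| = 1) ∧
      μ ≪ ν₁ + ν₂ ∧ (∀ x, μ {x} = ENNReal.ofReal |ν₁.real {x} - ν₂.real {x}|) ∧
      ∀ φ : X → ℝ, Integrable φ ν₁ → Integrable φ ν₂ →
        ∫ x, φ x ∂ν₁ - ∫ x, φ x ∂ν₂ = ∫ x, s x * φ x ∂μ := by
  set l := ν₁ + ν₂ with hl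
  have hac₁ : ν₁ ≪ l := Measure.absolutelyContinuous_of_le (Measure.le_add_right le_rfl)
  have hac₂ : ν₂ ≪ l := Measure.absolutelyContinuous_of_le (Measure.le_add_left le_rfl)
  set θ : X → ℝ := fun x => (ν₁.rnDeriv l x).toReal - (ν₂.rnDeriv l x).toReal with hθ
  have hθm : Measurable θ := (Measure.measurable_rnDeriv _ _).ennreal_toReal.sub
    (Measure.measurable_rnDeriv _ _).ennreal_toReal
  have hθi : Integrable θ l :=
    (Measure.integrable_toReal_rnDeriv).sub Measure.integrable_toReal_rnDeriv
  have hm : Measurable fun x => ENNReal.ofReal |θ x| := hθm.norm.ennreal_ofReal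
  have hsing : ∀ (ν : Measure X) [IsFiniteMeasure ν], ν ≪ l → ∀ x,
      ν.real {x} = (ν.rnDeriv l x).toReal * l.real {x} := fun ν _ hν x => by
    have : ν {x} = ν.rnDeriv l x * l {x} := by
      conv_lhs => rw [← Measure.withDensity_rnDeriv_eq ν l hν]
      rw [withDensity_apply _ (measurableSet_singleton x), lintegral_singleton]
    rw [measureReal_def, this, ENNReal.toReal_mul, measureReal_def]
  -- `θ` is the density of `ν₁ - ν₂` with respect to `ν₁ + ν₂`. The sign is set to `1` where `θ`
  -- vanishes, so that it has modulus one everywhere.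
  refine ⟨l.withDensity fun x => ENNReal.ofReal |θ x|, fun x => if 0 ≤ θ x then 1 else -1,
    ?_, ?_, ?_, withDensity_absolutelyContinuous _ _, ?_, ?_⟩
  · exact isFiniteMeasure_withDensity_ofReal hθi.abs.hasFiniteIntegral
  · exact Measurable.ite (measurableSet_le measurable_const hθm) measurable_const measurable_const
  · intro x
    dsimp only
    split_ifs <;> simp
  · intro x
    rw [withDensity_apply _ (measurableSet_singleton x), lintegral_singleton, hsing ν₁ hac₁,
      hsing ν₂ hac₂, ← sub_mul, abs_mul, abs_of_nonneg (measureReal_nonneg (μ := l)),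
      ENNReal.ofReal_mul (abs_nonneg _), ofReal_measureReal]
  · intro φ h1 h2
    rw [integral_withDensity_eq_integral_toReal_smul hm (Eventually.of_forall fun x =>
      ENNReal.ofReal_lt_top), ← integral_rnDeriv_smul hac₁, ← integral_rnDeriv_smul hac₂,
      ← integral_sub]
    · refine integral_congr_ae (Eventually.of_forall fun x => ?_)
      simp only [smul_eq_mul, ENNReal.toReal_ofReal (abs_nonneg _)]
      split_ifs with h
      · rw [abs_of_nonneg h]; simp only [hθ]; ring
      · rw [abs_of_neg (not_le.1 h)]; simp only [hθ]; ring
    · exact (integrable_rnDeriv_smul_iff hac₁).2 h1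
    · exact (integrable_rnDeriv_smul_iff hac₂).2 h2

theorem IsTest.continuous {M : Dom} {A : Set M.Pt} {φ : M.Pt → ℝ} (hφ : IsTest M A φ) :
    Continuous φ :=
  Dom.continuous_of_continuousOn_comp_param hφ.1.continuous.continuousOn

/-- The number `s * k` lies in `[-k, k]`, and projecting `g` onto that interval does not move it
away from any point of the interval. -/
theorem abs_sub_clamp_le {s k g : ℝ} (hk : 0 ≤ k) (hs : |s| = 1) :
    |s * k - max (-k) (min k g)| ≤ |s * k - g| := by
  rcases (abs_eq one_pos.le).1 hs with rfl | rfl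
  · rw [one_mul]
    rcases le_total k g with h | h
    · rw [min_eq_left h, max_eq_right (by linarith), sub_self, abs_zero]
      exact abs_nonneg _
    · rw [min_eq_right h, abs_of_nonneg (by rw [sub_nonneg]; exact max_le (by linarith) h),
        abs_of_nonneg (by linarith)]
      linarith [le_max_right (-k) g]
  · rw [neg_one_mul]
    rcases le_total (-k) g with h | h
    · have h1 : -k ≤ min k g := le_min (by linarith) h
      rw [max_eq_right h1, abs_sub_comm, abs_sub_comm (-k), abs_of_nonneg (by linarith),
        abs_of_nonneg (by linarith)]
      linarith [min_le_right k g]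
    · rw [min_eq_right (by linarith), max_eq_left h, sub_self, abs_zero]
      exact abs_nonneg _

/-- Since `s² = 1`, `k = s * (s * k) = s * f + s * (s * k - f)`. -/
theorem le_sign_mul_add_abs {s k f : ℝ} (hs : |s| = 1) : k ≤ s * f + |s * k - f| := by
  rcases (abs_eq one_pos.le).1 hs with rfl | rfl
  · linarith [le_abs_self (1 * k - f)]
  · linarith [neg_abs_le (-1 * k - f)]

/-- The total variation of a measure with sign is attained on test functions. -/
theorem weightedTV_eq_setLIntegral {M : Dom} {u : M.Pt → ℝ} {μ : Measure M.Pt} [IsFiniteMeasure μ]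
    {s : M.Pt → ℝ} (hs : Measurable s) (hs1 : ∀ x, |s x| = 1) (hμ : μ M.innerᶜ = 0)
    (hu : ∀ φ, IsTest M univ φ →
      ∫ t, deriv (φ ∘ M.param) t * u (M.param t) ∂M.leb = ∫ x, s x * φ x ∂μ)
    {ρ : M.Pt → ℝ} (hρ : Continuous ρ) (hρ0 : ∀ x, 0 ≤ ρ x) {A : Set M.Pt} (hA : IsOpen A) :
    weightedTV M ρ A u = ∫⁻ x in A, ENNReal.ofReal (ρ x) ∂μ := by
  have hu' : ∀ φ, IsTest M A φ →
      ∫ t, deriv (φ ∘ M.param) t * u (M.param t) ∂M.leb = ∫ x, s x * φ x ∂μ := fun φ hφ =>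
    hu φ ⟨hφ.1, hφ.2.trans (inter_subset_inter_left _ (subset_univ _))⟩
  apply le_antisymm
  · refine iSup_le fun φ => iSup_le fun hφ => iSup_le fun hle => ?_
    rw [hu' φ hφ]
    calc ENNReal.ofReal (∫ x, s x * φ x ∂μ) ≤ ‖∫ x, s x * φ x ∂μ‖ₑ := by
          rw [← ofReal_norm]
          exact ENNReal.ofReal_le_ofReal (Real.le_norm_self _)
      _ ≤ ∫⁻ x, ‖s x * φ x‖ₑ ∂μ := enorm_integral_le_lintegral_enorm _
      _ ≤ ∫⁻ x, A.indicator (fun x => ENNReal.ofReal (ρ x)) x ∂μ := by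
          refine lintegral_mono fun x => ?_
          rw [← ofReal_norm, norm_mul, Real.norm_eq_abs, Real.norm_eq_abs, hs1, one_mul]
          by_cases hx : x ∈ A
          · rw [indicator_of_mem hx]
            exact ENNReal.ofReal_le_ofReal (hle x)
          · rw [indicator_of_notMem hx, image_eq_zero_of_notMem_tsupport
              (fun h => hx (hφ.2 h).1)]
            simp
      _ = _ := lintegral_indicator hA.measurableSet _
  · set W := A ∩ M.inner with hW
    have hWo : IsOpen W := hA.inter M.isOpen_inner
    have hAW : ∫⁻ x in A, ENNReal.ofReal (ρ x) ∂μ = ∫⁻ x in W, ENNReal.ofReal (ρ x) ∂μ := by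
      refine setLIntegral_congr ?_
      rw [hW]
      refine (inter_ae_eq_left_of_ae_eq_univ ?_).symm
      rwa [ae_eq_univ]
    rw [hAW]
    set μ' := μ.withDensity fun x => ENNReal.ofReal (ρ x) with hμ'
    -- Inner regularity by hand: exhaust `W` by closed sets and cut the weight off continuously to
    -- `k`, which vanishes off `W`. It then remains to approximate `s * k` in `L¹(μ)` by test
    -- functions dominated by `k`.
    obtain ⟨Fn, hFc, hFW, hFU, hFm⟩ := hWo.exists_iUnion_isClosed
    have e1 : ∫⁻ x in W, ENNReal.ofReal (ρ x) ∂μ = μ' W :=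
      (withDensity_apply _ hWo.measurableSet).symm
    rw [e1, ← hFU, hFm.measure_iUnion]
    refine iSup_le fun n => ?_
    obtain ⟨c, hc0, hc1, hc⟩ := exists_continuous_zero_one_of_isClosed hWo.isClosed_compl (hFc n)
      (disjoint_left.2 fun x hx hx' => hx (hFW n hx'))
    set k : M.Pt → ℝ := fun x => c x * ρ x with hk
    have hkc : Continuous k := c.continuous.mul hρ
    have hk0 : ∀ x, 0 ≤ k x := fun x => mul_nonneg (hc x).1 (hρ0 x)
    have hkρ : ∀ x, k x ≤ ρ x := fun x => mul_le_of_le_one_left (hρ0 x) (hc x).2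
    have e2 : μ' (Fn n) ≤ ∫⁻ x, ENNReal.ofReal (k x) ∂μ := by
      rw [hμ', withDensity_apply _ (hFc n).measurableSet]
      refine (setLIntegral_mono' (hFc n).measurableSet fun x hx => ?_).trans
        (setLIntegral_le_lintegral (Fn n) _)
      rw [hk]; simp only
      rw [hc1 hx]; simp
    refine e2.trans ?_
    obtain ⟨B, hB⟩ := (isCompact_univ (X := M.Pt)).exists_bound_of_continuousOn hkc.continuousOn
    have hInt : ∀ g : M.Pt → ℝ, Measurable g → (∀ x, |g x| ≤ k x) → Integrable g μ :=
      fun g hg hgk => Integrable.of_bound (C := B) hg.aestronglyMeasurable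
        (Eventually.of_forall fun x => (hgk x).trans ((le_abs_self _).trans (hB x (mem_univ x))))
    have hski : Integrable (fun x => s x * k x) μ :=
      hInt _ (hs.mul hkc.measurable) fun x => by
        rw [abs_mul, hs1, one_mul, abs_of_nonneg (hk0 x)]
    refine ENNReal.le_of_forall_pos_le_add fun ε hε _ => ?_
    have hm : 0 < (μ univ).toReal + 1 := by positivity
    -- Half of `ε` pays for the `L¹` approximation of `s * k`, half for the uniform error `δ`
    -- integrated against `μ`; the `+ 1` covers `μ = 0`.
    set δ : ℝ := ε / 2 / ((μ univ).toReal + 1) with hδ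
    have hδ0 : 0 < δ := by have : (0 : ℝ) < ε := hε; positivity
    obtain ⟨g₀, hg₀, -⟩ := hski.exists_boundedContinuous_lintegral_sub_le
      (ε := ENNReal.ofReal (ε / 2)) (by
        have : (0 : ℝ) < ε := hε
        simp only [ne_eq, ENNReal.ofReal_eq_zero, not_le]; positivity)
    set g : M.Pt → ℝ := fun x => max (-k x) (min (k x) (g₀ x)) with hg
    have hgc : Continuous g := by have := g₀.continuous; fun_prop
    have hgk : ∀ x, |g x| ≤ k x := fun x =>
      abs_le.2 ⟨le_max_left _ _, max_le (by linarith [hk0 x]) (min_le_left _ _)⟩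
    have hgd : ∀ x, |s x * k x - g x| ≤ |s x * k x - g₀ x| :=
      fun x => abs_sub_clamp_le (hk0 x) (hs1 x)
    obtain ⟨φ, hφ, hφg, hφd⟩ := exists_isTest_approx (A := A) hgc (fun x hx => by
      have h1 := hgk x
      have h2 : k x = 0 := by simp only [hk]; rw [hc0 hx]; simp
      rw [h2] at h1
      exact abs_nonpos_iff.1 h1) hδ0
    have hφk : ∀ x, |φ x| ≤ k x := fun x => (hφg x).trans (hgk x)
    have hφm : Measurable φ := hφ.continuous.measurable
    have hφi : Integrable (fun x => s x * φ x) μ := hInt _ (hs.mul hφm) fun x => by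
      rw [abs_mul, hs1, one_mul]; exact hφk x
    have hφi' : Integrable φ μ := hInt _ hφm hφk
    have hdi : Integrable (fun x => |s x * k x - φ x|) μ := (hski.sub hφi').abs
    have e3 : ∫ x, k x ∂μ ≤ ∫ x, s x * φ x ∂μ + ∫ x, |s x * k x - φ x| ∂μ := by
      rw [← integral_add hφi hdi]
      exact integral_mono (hInt k hkc.measurable fun x => (abs_of_nonneg (hk0 x)).le)
        (hφi.add hdi) fun x => le_sign_mul_add_abs (hs1 x)
    have e4 : ENNReal.ofReal (∫ x, |s x * k x - φ x| ∂μ) ≤ ε := by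
      rw [ofReal_integral_eq_lintegral_ofReal hdi
        (Eventually.of_forall fun x => abs_nonneg _)]
      calc ∫⁻ x, ENNReal.ofReal |s x * k x - φ x| ∂μ
          ≤ ∫⁻ x, (‖s x * k x - g₀ x‖ₑ + ENNReal.ofReal δ) ∂μ := by
            refine lintegral_mono fun x => ?_
            rw [← ofReal_norm, ← ENNReal.ofReal_add (norm_nonneg _) hδ0.le]
            refine ENNReal.ofReal_le_ofReal ?_
            have h1 := hgd x
            have h2 := hφd x
            rw [Real.norm_eq_abs]
            have h3 := abs_sub_le (s x * k x) (g x) (φ x)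
            rw [abs_sub_comm (g x)] at h3
            linarith
        _ ≤ ENNReal.ofReal (ε / 2) + ENNReal.ofReal δ * μ univ := by
            rw [lintegral_add_right _ measurable_const, lintegral_const]
            exact add_le_add_left hg₀ _
        _ ≤ ENNReal.ofReal (ε / 2) + ENNReal.ofReal (ε / 2) := by
            gcongr
            rw [← ENNReal.ofReal_toReal (measure_ne_top μ univ),
              ← ENNReal.ofReal_mul hδ0.le]
            refine ENNReal.ofReal_le_ofReal ?_
            rw [hδ, div_mul_eq_mul_div, div_le_iff₀ hm]
            have : (0 : ℝ) ≤ ε / 2 := by positivity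
            nlinarith
        _ = ε := by
            rw [← ENNReal.ofReal_add (by positivity) (by positivity), add_halves,
              ENNReal.ofReal_coe_nnreal]
    calc ∫⁻ x, ENNReal.ofReal (k x) ∂μ = ENNReal.ofReal (∫ x, k x ∂μ) :=
          (ofReal_integral_eq_lintegral_ofReal (hInt k hkc.measurable fun x =>
            (abs_of_nonneg (hk0 x)).le) (Eventually.of_forall hk0)).symm
      _ ≤ ENNReal.ofReal (∫ x, s x * φ x ∂μ) + ENNReal.ofReal (∫ x, |s x * k x - φ x| ∂μ) :=
          (ENNReal.ofReal_le_ofReal e3).trans ENNReal.ofReal_add_le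
      _ ≤ weightedTV M ρ A u + ε := by
          refine add_le_add ?_ e4
          rw [← hu' φ hφ]
          exact le_iSup_of_le φ (le_iSup_of_le hφ (le_iSup_of_le
            (fun x => (hφk x).trans (hkρ x)) le_rfl))

/-! ### One-sided traces -/

/-- A one-sided neighbourhood has positive measure, so it meets every set of full measure. Without
this an essential limit would not determine the value of `limUnder`. -/
instance neBot_nhdsGT_inf_ae (t : ℝ) : (𝓝[>] t ⊓ ae volume).NeBot := by
  rw [Filter.inf_neBot_iff]
  intro s hs s' hs'
  obtain ⟨r, hr, hrs⟩ := mem_nhdsGT_iff_exists_Ioo_subset.1 hs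
  by_contra h
  rw [not_nonempty_iff_eq_empty, ← disjoint_iff_inter_eq_empty] at h
  have h1 : Ioo t r ⊆ s'ᶜ := hrs.trans h.subset_compl_right
  have h2 := measure_mono_null h1 hs'
  rw [Real.volume_Ioo, ENNReal.ofReal_eq_zero] at h2
  have : t < r := hr
  linarith

instance neBot_nhdsLT_inf_ae (t : ℝ) : (𝓝[<] t ⊓ ae volume).NeBot := by
  rw [Filter.inf_neBot_iff]
  intro s hs s' hs'
  obtain ⟨r, hr, hrs⟩ := mem_nhdsLT_iff_exists_Ioo_subset.1 hs
  by_contra h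
  rw [not_nonempty_iff_eq_empty, ← disjoint_iff_inter_eq_empty] at h
  have h1 : Ioo r t ⊆ s'ᶜ := hrs.trans h.subset_compl_right
  have h2 := measure_mono_null h1 hs'
  rw [Real.volume_Ioo, ENNReal.ofReal_eq_zero] at h2
  have : r < t := hr
  linarith

theorem limUnder_inf_ae_eq {l : Filter ℝ} [(l ⊓ ae volume).NeBot] {f g : ℝ → ℝ} {I : Set ℝ}
    (hI : I ∈ l) (hIm : MeasurableSet I) (hfg : ∀ᵐ t ∂volume.restrict I, f t = g t) {y : ℝ}
    (hg : Tendsto g l (𝓝 y)) : limUnder (l ⊓ ae volume) f = y := by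
  refine Tendsto.limUnder_eq ?_
  refine (hg.mono_left inf_le_left).congr' ?_
  rw [ae_restrict_iff' hIm] at hfg
  have h1 : ∀ᶠ t in l ⊓ ae volume, t ∈ I := inf_le_left (a := l) hI
  have h2 : ∀ᶠ t in l ⊓ ae volume, t ∈ I → f t = g t := inf_le_right (a := l) hfg
  filter_upwards [h1, h2] with t h3 h4
  exact (h4 h3).symm

/-! ### The derivative of a function of bounded variation is a measure -/

/-- A function of bounded variation is, in the coordinate, the difference of two monotone functions
almost everywhere. -/
theorem IsBV.exists_monotone {M : Dom} {u : M.Pt → ℝ} (hu : IsBV M u) :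
    ∃ p q : ℝ → ℝ, Monotone p ∧ Monotone q ∧
      ∀ᵐ t ∂volume.restrict (Ioo M.left M.right), u (M.param t) = p t - q t := by
  refine exists_monotone_sub_monotone (f := u ∘ M.param)
    (C := (weightedTV M (fun _ => 1) univ u).toReal) hu.1 fun φ hφ => ?_
  refine (ENNReal.ofReal_le_iff_le_toReal hu.2.ne).1 ?_
  exact ofReal_integral_deriv_mul_le_weightedTV hφ le_rfl le_rfl (fun _ _ => mem_univ _) u

/-- Integration by parts against a function that is almost everywhere the difference of two
monotone functions. -/
theorem integral_deriv_mul_eq_of_ae_eq {p q f : ℝ → ℝ} (hp : Monotone p) (hq : Monotone q)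
    {α β : ℝ} (hαβ : α < β) (hf : ∀ᵐ t ∂volume.restrict (Ioo α β), f t = p t - q t)
    {φ : ℝ → ℝ} (hφ : ContDiff ℝ 1 φ) :
    ∫ t in Ioo α β, deriv φ t * f t =
      φ β * (Function.leftLim p β - Function.leftLim q β) -
        φ α * (Function.rightLim p α - Function.rightLim q α) -
        (∫ t in Ioo α β, φ t ∂hp.stieltjesFunction.measure -
          ∫ t in Ioo α β, φ t ∂hq.stieltjesFunction.measure) := by
  have hφ' : Continuous (deriv φ) := hφ.continuous_deriv le_rfl
  obtain ⟨B, hB⟩ := isCompact_Icc.exists_bound_of_continuousOn (hφ'.continuousOn (s := Icc α β))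
  have hi : ∀ g : ℝ → ℝ, Monotone g → IntegrableOn (fun t => deriv φ t * g t) (Ioo α β) := by
    intro g hg
    have hgI : IntegrableOn g (Ioo α β) :=
      (hg.locallyIntegrable.integrableOn_isCompact isCompact_Icc).mono_set
        (Ioo_subset_Icc_self (a := α) (b := β))
    refine Integrable.bdd_mul hgI (c := B) hφ'.aestronglyMeasurable ?_
    filter_upwards [ae_restrict_mem measurableSet_Ioo] with s hs
    exact hB s (Ioo_subset_Icc_self hs)
  have h1 : ∫ t in Ioo α β, deriv φ t * f t =
      ∫ t in Ioo α β, (deriv φ t * p t - deriv φ t * q t) := by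
    refine integral_congr_ae ?_
    filter_upwards [hf] with t ht
    rw [ht]; ring
  rw [h1, integral_sub (hi p hp) (hi q hq), integral_deriv_mul_monotone hp hαβ hφ,
    integral_deriv_mul_monotone hq hαβ hφ]
  ring

open Classical in
/-- The total atom of the derivative at the point where the ends of the parameter interval meet:
it is present on the torus only. -/
noncomputable def seamMass (M : Dom) (c : ℝ) : ℝ :=
  if M.param M.left = M.param M.right then c else 0

/-- On an interval test functions vanish at both ends. On the torus both ends are the same point,
and the two boundary terms merge into one atom there. -/
theorem IsTest.boundary_eq {M : Dom} {A : Set M.Pt} {φ : M.Pt → ℝ} (hφ : IsTest M A φ) (c d : ℝ) :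
    φ (M.param M.right) * c - φ (M.param M.left) * d =
      seamMass M (c - d) * φ (M.param M.left) := by
  unfold seamMass
  split_ifs with h
  · rw [h]; ring
  · have h0 : ∀ x ∉ M.inner, φ x = 0 := fun x hx =>
      image_eq_zero_of_notMem_tsupport fun h => hx (hφ.2 h).2
    cases M with
    | interval a b hab =>
      rw [h0 _, h0 _]
      · ring
      · intro hm
        have hm' : (Dom.interval a b hab).coord ((Dom.interval a b hab).param a) ∈ Ioo a b := hm
        rw [Dom.coord_param_interval ⟨le_rfl, hab.le⟩] at hm'
        exact hm'.1.false
      · intro hm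
        have hm' : (Dom.interval a b hab).coord ((Dom.interval a b hab).param b) ∈ Ioo a b := hm
        rw [Dom.coord_param_interval ⟨hab.le, le_rfl⟩] at hm'
        exact hm'.2.false
    | torus =>
      refine absurd ?_ h
      exact Dom.param_torus_eq_iff.2 ⟨-1, by simp [Dom.left, Dom.right]⟩

theorem seamMass_eq_zero_of_left_notMem_inner {M : Dom} (h : M.param M.left ∉ M.inner) (c : ℝ) :
    seamMass M c = 0 := by
  cases M with
  | interval a b hab =>
    refine if_neg fun heq => hab.ne ?_
    have := congrArg (Dom.interval a b hab).coord heq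
    change (Dom.interval a b hab).coord ((Dom.interval a b hab).param a) =
      (Dom.interval a b hab).coord ((Dom.interval a b hab).param b) at this
    rwa [Dom.coord_param_interval ⟨le_rfl, hab.le⟩, Dom.coord_param_interval ⟨hab.le, le_rfl⟩]
      at this
  | torus => exact absurd (mem_univ _) h

/-- The part in `M` of the Stieltjes measure of a monotone function of the coordinate, plus a
Dirac mass at the seam. -/
noncomputable def coordMeasure (M : Dom) {p : ℝ → ℝ} (hp : Monotone p) (c : ℝ) : Measure M.Pt :=
  (hp.stieltjesFunction.measure.restrict (Ioo M.left M.right)).map M.param +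
    ENNReal.ofReal c • Measure.dirac (M.param M.left)

instance isFiniteMeasure_restrict_stieltjes {p : ℝ → ℝ} (hp : Monotone p) (α β : ℝ) :
    IsFiniteMeasure (hp.stieltjesFunction.measure.restrict (Ioo α β)) :=
  ⟨by
    rw [Measure.restrict_apply_univ, StieltjesFunction.measure_Ioo]
    exact ENNReal.ofReal_lt_top⟩

instance isFiniteMeasure_coordMeasure (M : Dom) {p : ℝ → ℝ} (hp : Monotone p) (c : ℝ) :
    IsFiniteMeasure (coordMeasure M hp c) := by
  have h1 : IsFiniteMeasure
      ((hp.stieltjesFunction.measure.restrict (Ioo M.left M.right)).map M.param) :=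
    Measure.isFiniteMeasure_map _ _
  have h2 : IsFiniteMeasure (ENNReal.ofReal c • Measure.dirac (M.param M.left)) :=
    Measure.smul_finite _ ENNReal.ofReal_ne_top
  unfold coordMeasure
  infer_instance

/-- The weight of the Dirac mass is truncated at zero. A seam atom of either sign is later carried
as a positive part by one measure and a negative part by another. -/
theorem integral_coordMeasure (M : Dom) {p : ℝ → ℝ} (hp : Monotone p) (c : ℝ) {φ : M.Pt → ℝ}
    (hφ : Continuous φ) :
    ∫ x, φ x ∂coordMeasure M hp c =
      ∫ t in Ioo M.left M.right, φ (M.param t) ∂hp.stieltjesFunction.measure +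
        max c 0 * φ (M.param M.left) := by
  have hi : ∀ ν : Measure M.Pt, IsFiniteMeasure ν → Integrable φ ν := fun ν _ => by
    obtain ⟨B, hB⟩ := (isCompact_univ (X := M.Pt)).exists_bound_of_continuousOn hφ.continuousOn
    exact Integrable.of_bound (C := B) hφ.aestronglyMeasurable
      (Eventually.of_forall fun x => hB x (mem_univ x))
  unfold coordMeasure
  rw [integral_add_measure, integral_map M.continuous_param.aemeasurable hφ.aestronglyMeasurable,
    integral_smul_measure, integral_dirac, smul_eq_mul]
  · rw [ENNReal.toReal_ofReal']
  · exact hi _ (Measure.isFiniteMeasure_map _ _)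
  · exact hi _ (Measure.smul_finite _ ENNReal.ofReal_ne_top)

/-- The only mass that could sit outside the interior is the Dirac mass, and `seamMass` removes it
on an interval. -/
theorem coordMeasure_compl_inner (M : Dom) {p : ℝ → ℝ} (hp : Monotone p) (c : ℝ) :
    coordMeasure M hp (seamMass M c) M.innerᶜ = 0 := by
  have hm : MeasurableSet M.innerᶜ := M.isOpen_inner.measurableSet.compl
  unfold coordMeasure
  rw [Measure.add_apply, Measure.map_apply M.continuous_param.measurable hm, Measure.smul_apply,
    Measure.restrict_apply (M.continuous_param.measurable hm)]
  have h1 : M.param ⁻¹' M.innerᶜ ∩ Ioo M.left M.right = ∅ := by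
    ext t
    simp only [mem_inter_iff, mem_preimage, mem_compl_iff, mem_empty_iff_false, iff_false, not_and]
    exact fun h h' => h (Dom.param_mem_inner h')
  rw [h1, measure_empty, zero_add, smul_eq_mul, Measure.dirac_apply' _ hm]
  by_cases h : M.param M.left ∈ M.inner
  · simp [h]
  · rw [seamMass_eq_zero_of_left_notMem_inner h]; simp

theorem coordMeasure_real_singleton (M : Dom) {p : ℝ → ℝ} (hp : Monotone p) (c : ℝ) (x : M.Pt) :
    (M.coord x ∈ Ioo M.left M.right → (coordMeasure M hp c).real {x} =
      Function.rightLim p (M.coord x) - Function.leftLim p (M.coord x)) ∧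
    (M.coord x = M.left → (coordMeasure M hp c).real {x} = max c 0) := by
  have hm : MeasurableSet {x} := measurableSet_singleton x
  have h0 : M.coord (M.param M.left) = M.left :=
    Dom.coord_param_of_mem_Ico ⟨le_rfl, M.left_lt_right⟩
  have h1 : coordMeasure M hp c {x} =
      hp.stieltjesFunction.measure (M.param ⁻¹' {x} ∩ Ioo M.left M.right) +
        ENNReal.ofReal c * Measure.dirac (M.param M.left) {x} := by
    unfold coordMeasure
    rw [Measure.add_apply, Measure.map_apply M.continuous_param.measurable hm, Measure.smul_apply,
      Measure.restrict_apply (M.continuous_param.measurable hm), smul_eq_mul]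
  constructor
  · intro hx
    have h2 : M.param ⁻¹' {x} ∩ Ioo M.left M.right = {M.coord x} := by
      ext t
      simp only [mem_inter_iff, mem_preimage, mem_singleton_iff]
      constructor
      · rintro ⟨rfl, ht⟩
        exact (Dom.coord_param_of_mem_Ico ⟨ht.1.le, ht.2⟩).symm
      · rintro rfl
        exact ⟨M.param_coord x, hx⟩
    have h3 : M.param M.left ∉ ({x} : Set M.Pt) := by
      intro h
      rw [mem_singleton_iff] at h
      rw [← h, h0] at hx
      exact hx.1.false
    rw [measureReal_def, h1, h2, Measure.dirac_apply' _ hm, indicator_of_notMem h3, mul_zero,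
      add_zero, StieltjesFunction.measure_singleton, ENNReal.toReal_ofReal]
    · have : Function.leftLim hp.stieltjesFunction (M.coord x) = Function.leftLim p (M.coord x) :=
        leftLim_rightLim (hp.tendsto_leftLim _)
      rw [this, hp.stieltjesFunction_eq]
    · rw [sub_nonneg]
      exact hp.stieltjesFunction.mono.leftLim_le le_rfl
  · intro hx
    have h2 : M.param ⁻¹' {x} ∩ Ioo M.left M.right = ∅ := by
      ext t
      simp only [mem_inter_iff, mem_preimage, mem_singleton_iff, mem_empty_iff_false, iff_false,
        not_and]
      rintro rfl ht
      rw [Dom.coord_param_of_mem_Ico ⟨ht.1.le, ht.2⟩] at hx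
      exact ht.1.ne hx.symm
    have h3 : M.param M.left ∈ ({x} : Set M.Pt) := by
      rw [mem_singleton_iff, ← hx, M.param_coord]
    rw [measureReal_def, h1, h2, measure_empty, Measure.dirac_apply' _ hm, indicator_of_mem h3,
      zero_add, Pi.one_apply, mul_one, ENNReal.toReal_ofReal']

theorem jump_eq_of_ae_eq {M : Dom} {u : M.Pt → ℝ} {p q : ℝ → ℝ} (hp : Monotone p) (hq : Monotone q)
    (hu : ∀ᵐ t ∂volume.restrict (Ioo M.left M.right), u (M.param t) = p t - q t) {x : M.Pt}
    (hx : M.coord x ∈ Ioo M.left M.right) :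
    jump M u x = |(Function.rightLim p (M.coord x) - Function.rightLim q (M.coord x)) -
      (Function.leftLim p (M.coord x) - Function.leftLim q (M.coord x))| := by
  unfold jump traceRight traceLeft
  rw [limUnder_inf_ae_eq (f := u ∘ M.param) 
      (Ioo_mem_nhdsGT_of_mem ⟨hx.1.le, hx.2⟩) measurableSet_Ioo hu
      ((hp.tendsto_rightLim _).sub (hq.tendsto_rightLim _)),
    limUnder_inf_ae_eq (f := u ∘ M.param) (Ioo_mem_nhdsLT_of_mem ⟨hx.1, hx.2.le⟩)
      measurableSet_Ioo hu
      ((hp.tendsto_leftLim _).sub (hq.tendsto_leftLim _))]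

/-- At the seam the left trace reads `u` on `(-1, 0)`. By periodicity the representation there is
the shifted one, whose left limits are those at `1`. -/
theorem jump_torus_zero_of_ae_eq {u : Dom.torus.Pt → ℝ} {p q : ℝ → ℝ} (hp : Monotone p)
    (hq : Monotone q)
    (hu : ∀ᵐ t ∂volume.restrict (Ioo (0 : ℝ) 1), u (Dom.torus.param t) = p t - q t)
    {x : Dom.torus.Pt} (hx : Dom.torus.coord x = 0) :
    jump Dom.torus u x = |(Function.rightLim p 0 - Function.rightLim q 0) -
      (Function.leftLim p 1 - Function.leftLim q 1)| := by
  have hshift : ∀ᵐ t ∂volume.restrict (Ioo (-1 : ℝ) 0),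
      u (Dom.torus.param t) = p (t + 1) - q (t + 1) := by
    rw [ae_restrict_iff' measurableSet_Ioo] at hu ⊢
    have := (measurePreserving_add_right volume (1 : ℝ)).quasiMeasurePreserving.ae hu
    filter_upwards [this] with t ht hmem
    rw [← Dom.param_torus_add_one]
    exact ht ⟨by linarith [hmem.1], by linarith [hmem.2]⟩
  have htend : ∀ g : ℝ → ℝ, Monotone g →
      Tendsto (fun t => g (t + 1)) (𝓝[<] 0) (𝓝 (Function.leftLim g 1)) := fun g hg => by
    refine (hg.tendsto_leftLim 1).comp ?_
    refine tendsto_nhdsWithin_of_tendsto_nhds_of_eventually_within _ ?_ ?_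
    · have : Tendsto (fun t : ℝ => t + 1) (𝓝 0) (𝓝 (0 + 1)) := by
        exact (continuous_add_const 1).tendsto 0
      rw [zero_add] at this
      exact this.mono_left nhdsWithin_le_nhds
    · filter_upwards [self_mem_nhdsWithin] with t ht
      have : t < 0 := ht
      change t + 1 < 1
      linarith
  unfold jump traceRight traceLeft
  rw [hx, limUnder_inf_ae_eq (f := u ∘ Dom.torus.param) (Ioo_mem_nhdsGT_of_mem ⟨le_rfl, one_pos⟩)
      measurableSet_Ioo hu
      ((hp.tendsto_rightLim _).sub (hq.tendsto_rightLim _)),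
    limUnder_inf_ae_eq (f := u ∘ Dom.torus.param) (Ioo_mem_nhdsLT_of_mem ⟨neg_one_lt_zero, le_rfl⟩)
      measurableSet_Ioo hshift
      ((htend p hp).sub (htend q hq))]

/-- The total variation measure `|u_x|` of a function of bounded variation: it represents the
weighted variations, and its atoms are the jumps. -/
structure IsVariationMeasure (M : Dom) (u : M.Pt → ℝ) (μ : Measure M.Pt) : Prop where
  isFinite : IsFiniteMeasure μ
  compl_inner : μ M.innerᶜ = 0
  singleton : ∀ x ∈ M.inner, μ {x} = ENNReal.ofReal (jump M u x)
  weightedTV_eq : ∀ ρ : M.Pt → ℝ, Continuous ρ → (∀ x, 0 ≤ ρ x) → ∀ A : Set M.Pt, IsOpen A →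
    weightedTV M ρ A u = ∫⁻ x in A, ENNReal.ofReal (ρ x) ∂μ

/-- Integration by parts writes `∫ φ' u` as the integral of `φ` against the Stieltjes measure of `q`
minus that of `p`, plus the seam atom `c`. The positive part of `c` goes to the former measure and
the negative part to the latter; `μ` is the modulus in the polar decomposition of the difference. -/
theorem IsBV.exists_isVariationMeasure {M : Dom} {u : M.Pt → ℝ} (hu : IsBV M u) :
    ∃ μ, IsVariationMeasure M u μ := by
  obtain ⟨p, q, hp, hq, hpq⟩ := hu.exists_monotone
  set c := seamMass M ((Function.leftLim p M.right - Function.leftLim q M.right) -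
    (Function.rightLim p M.left - Function.rightLim q M.left)) with hc
  have hcneg : -c = seamMass M (-((Function.leftLim p M.right - Function.leftLim q M.right) -
    (Function.rightLim p M.left - Function.rightLim q M.left))) := by
    rw [hc]; unfold seamMass; split_ifs <;> simp
  obtain ⟨μ, s, hfin, hs, hs1, hac, hsing, hrep⟩ :=
    exists_polar_decomposition (coordMeasure M hq c) (coordMeasure M hp (-c))
  have hinner : μ M.innerᶜ = 0 := by
    refine hac ?_
    rw [Measure.add_apply, hcneg, hc, coordMeasure_compl_inner, coordMeasure_compl_inner, add_zero]
  have hi : ∀ (φ : M.Pt → ℝ), Continuous φ → ∀ ν : Measure M.Pt, IsFiniteMeasure ν →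
      Integrable φ ν := fun φ hφ ν _ => by
    obtain ⟨B, hB⟩ := (isCompact_univ (X := M.Pt)).exists_bound_of_continuousOn hφ.continuousOn
    exact Integrable.of_bound (C := B) hφ.aestronglyMeasurable
      (Eventually.of_forall fun x => hB x (mem_univ x))
  refine ⟨μ, hfin, hinner, fun x hx => ?_, fun ρ hρ hρ0 A hA =>
    weightedTV_eq_setLIntegral hs hs1 hinner (fun φ hφ => ?_) hρ hρ0 hA⟩
  · rw [hsing x]
    congr 1
    rcases (M.left_le_coord x).lt_or_eq with h | h
    · have hx' : M.coord x ∈ Ioo M.left M.right := by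
        cases M with
        | interval a b hab => exact hx
        | torus => exact ⟨h, Dom.coord_torus_lt x⟩
      rw [(coordMeasure_real_singleton M hp _ x).1 hx',
        (coordMeasure_real_singleton M hq _ x).1 hx', jump_eq_of_ae_eq hp hq hpq hx',
        abs_sub_comm]
      congr 1
      ring
    · rw [(coordMeasure_real_singleton M hp _ x).2 h.symm,
        (coordMeasure_real_singleton M hq _ x).2 h.symm]
      cases M with
      | interval a b hab => exact absurd h (Dom.coord_mem_Ioo_of_mem_inner.1 hx).1.ne
      | torus =>
        have h1 : c = (Function.leftLim p 1 - Function.leftLim q 1) -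
            (Function.rightLim p 0 - Function.rightLim q 0) := by
          rw [hc, seamMass, if_pos (Dom.param_torus_eq_iff.2
            ⟨-1, by simp [Dom.left, Dom.right]⟩)]
          rfl
        have h2 : max c 0 - max (-c) 0 = c := by
          rcases le_total 0 c with h | h
          · rw [max_eq_left h, max_eq_right (by linarith), sub_zero]
          · rw [max_eq_right h, max_eq_left (by linarith)]; ring
        rw [h2, jump_torus_zero_of_ae_eq hp hq hpq h.symm, h1, abs_sub_comm]
  · rw [← hrep φ (hi φ hφ.continuous _ inferInstance) (hi φ hφ.continuous _ inferInstance),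
      integral_coordMeasure M hq c hφ.continuous, integral_coordMeasure M hp (-c) hφ.continuous,
      Dom.leb, integral_deriv_mul_eq_of_ae_eq hp hq M.left_lt_right hpq hφ.1]
    have h1 := hφ.boundary_eq (Function.leftLim p M.right - Function.leftLim q M.right)
      (Function.rightLim p M.left - Function.rightLim q M.left)
    rw [← hc] at h1
    simp only [Function.comp_apply]
    rw [h1]
    have h2 : max c 0 - max (-c) 0 = c := by
      rcases le_total 0 c with h | h
      · rw [max_eq_left h, max_eq_right (by linarith), sub_zero]
      · rw [max_eq_right h, max_eq_left (by linarith)]; ring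
    linear_combination (-(φ (M.param M.left))) * h2

/-- This is the outer regularity of the finite Borel measure `μ`, as the two agree on open sets. -/
theorem IsVariationMeasure.variation_eq {M : Dom} {u : M.Pt → ℝ} {μ : Measure M.Pt}
    (hμ : IsVariationMeasure M u μ) (B : Set M.Pt) : variation M u B = μ B := by
  have := hμ.isFinite
  rw [B.measure_eq_iInf_isOpen μ, variation]
  refine iInf_congr fun A => ?_
  rw [iInf_comm]
  refine iInf_congr fun _ => iInf_congr fun hA => ?_
  rw [hμ.weightedTV_eq _ continuous_const (fun _ => zero_le_one) A hA]
  simp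

/-! ### Graph convergence -/

section Graph

variable {X : Type} [MetricSpace X] {Ξ : X → Set ℝ}

/-- The Euclidean and the maximum metric on the product give the same topology; compactness
arguments are run in the latter. -/
theorem IsB.isCompact_prod (hΞ : IsB Ξ) : IsCompact {p : X × ℝ | p.2 ∈ Ξ p.1} := by
  have h : {p : X × ℝ | p.2 ∈ Ξ p.1} = WithLp.ofLp '' graph Ξ := by
    ext p
    constructor
    · intro hp
      exact ⟨WithLp.toLp 2 p, hp, rfl⟩
    · rintro ⟨z, hz, rfl⟩
      exact hz
  rw [h]
  exact hΞ.image (WithLp.prod_lipschitzWith_ofLp 2 X ℝ).continuous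

theorem dist_fst_snd_lt_of_edist_lt {z w : WithLp 2 (X × ℝ)} {δ : ℝ} (hδ : 0 < δ)
    (h : edist z w < ENNReal.ofReal δ) : dist z.fst w.fst < δ ∧ |z.snd - w.snd| < δ := by
  have h1 : dist z w < δ := by
    rwa [edist_dist, ENNReal.ofReal_lt_ofReal_iff hδ] at h
  have h2 : dist (WithLp.ofLp z) (WithLp.ofLp w) ≤ dist z w := by
    simpa using (WithLp.prod_lipschitzWith_ofLp 2 X ℝ).dist_le_mul z w
  rw [Prod.dist_eq] at h2
  have h3 := (le_max_left _ _).trans h2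
  have h4 := (le_max_right _ _).trans h2
  exact ⟨h3.trans_lt h1, h4.trans_lt h1⟩

/-- The Euclidean metric is at most `√2` times the maximum metric; the factor is rounded up to `2`.
-/
theorem edist_toLp_le {x z : X} {y w δ : ℝ} (h1 : dist x z ≤ δ) (h2 : |y - w| ≤ δ) :
    edist (WithLp.toLp 2 (x, y)) (WithLp.toLp 2 (z, w)) ≤ ENNReal.ofReal (2 * δ) := by
  have h0 : 0 ≤ δ := dist_nonneg.trans h1
  rw [edist_dist]
  refine ENNReal.ofReal_le_ofReal ?_
  have e1 := (WithLp.prod_lipschitzWith_toLp 2 X ℝ).dist_le_mul (x, y) (z, w)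
  have e2 : dist (x, y) (z, w) ≤ δ := by
    rw [Prod.dist_eq]; exact max_le h1 h2
  have e3 : (((2 : NNReal) ^ ((1 : ℝ≥0∞) / 2).toReal : NNReal) : ℝ) ≤ 2 := by
    have : (2 : NNReal) ^ ((1 : ℝ≥0∞) / 2).toReal ≤ 2 ^ (1 : ℝ) :=
      NNReal.rpow_le_rpow_of_exponent_le one_le_two (by
        rw [ENNReal.toReal_div]; norm_num)
    rw [NNReal.rpow_one] at this
    exact_mod_cast this
  exact e1.trans (mul_le_mul e3 e2 dist_nonneg zero_le_two)

/-- The two halves of Hausdorff convergence play different roles. This one confines `v ε` to the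
vicinity of the limit graph; the other makes `v ε` come close to every value of it. -/
theorem GraphTendsto.eventually_near_graph {v : ℝ → X → ℝ} (hv : GraphTendsto v Ξ) {δ : ℝ}
    (hδ : 0 < δ) :
    ∀ᶠ ε in 𝓝[>] 0, ∀ x, ∃ z, ∃ y ∈ Ξ z, dist x z < δ ∧ |v ε x - y| < δ := by
  filter_upwards [hv.eventually_lt_const (ENNReal.ofReal_pos.2 hδ)] with ε hε x
  obtain ⟨w, hw, hd⟩ := Metric.exists_edist_lt_of_hausdorffEDist_lt
    (x := WithLp.toLp 2 (x, v ε x)) (s := graph fun x => {v ε x}) rfl hε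
  exact ⟨w.fst, w.snd, hw, dist_fst_snd_lt_of_edist_lt hδ hd⟩

theorem GraphTendsto.eventually_graph_near {v : ℝ → X → ℝ} (hv : GraphTendsto v Ξ) {δ : ℝ}
    (hδ : 0 < δ) :
    ∀ᶠ ε in 𝓝[>] 0, ∀ z, ∀ y ∈ Ξ z, ∃ x, dist x z < δ ∧ |v ε x - y| < δ := by
  filter_upwards [hv.eventually_lt_const (ENNReal.ofReal_pos.2 hδ)] with ε hε z y hy
  rw [Metric.hausdorffEDist_comm] at hε
  obtain ⟨w, hw, hd⟩ := Metric.exists_edist_lt_of_hausdorffEDist_lt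
    (x := WithLp.toLp 2 (z, y)) (s := graph Ξ) hy hε
  have h := dist_fst_snd_lt_of_edist_lt hδ hd
  have hw' : w.snd = v ε w.fst := hw
  refine ⟨w.fst, by rw [dist_comm]; exact h.1, ?_⟩
  rw [← hw', abs_sub_comm]
  exact h.2

theorem IsB.exists_bound (hΞ : IsB Ξ) : ∃ B, 0 < B ∧ ∀ x, ∀ y ∈ Ξ x, |y| ≤ B := by
  obtain ⟨B, hB⟩ := hΞ.isCompact_prod.exists_bound_of_continuousOn continuous_snd.continuousOn
  exact ⟨max B 1, by positivity, fun x y hy => (hB (x, y) hy).trans (le_max_left _ _)⟩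

/-- Off the graph, a neighbourhood is disjoint from the graph. -/
theorem IsB.exists_forall_notMem (hΞ : IsB Ξ) {x : X} {y : ℝ} (h : y ∉ Ξ x) :
    ∃ δ > 0, ∀ z w, dist z x < δ → |w - y| < δ → w ∉ Ξ z := by
  have h1 : {p : X × ℝ | p.2 ∈ Ξ p.1}ᶜ ∈ 𝓝 (x, y) :=
    hΞ.isCompact_prod.isClosed.isOpen_compl.mem_nhds h
  obtain ⟨δ, hδ, hb⟩ := Metric.mem_nhds_iff.1 h1
  refine ⟨δ, hδ, fun z w hz hw => ?_⟩
  have : (z, w) ∈ Metric.ball (x, y) δ := by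
    rw [Metric.mem_ball, Prod.dist_eq]
    exact max_lt hz hw
  exact hb this

theorem IsB.isCompact_value (hΞ : IsB Ξ) (x : X) : IsCompact (Ξ x) := by
  have h : Ξ x = Prod.snd '' ({p : X × ℝ | p.2 ∈ Ξ p.1} ∩ Prod.fst ⁻¹' {x}) := by
    ext y
    constructor
    · intro hy
      exact ⟨(x, y), ⟨hy, rfl⟩, rfl⟩
    · rintro ⟨⟨z, w⟩, ⟨h1, rfl⟩, rfl⟩
      exact h1
  rw [h]
  exact (hΞ.isCompact_prod.inter_right (isClosed_singleton.preimage continuous_fst)).image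
    continuous_snd

/-- The set of points at which `Ξ` meets a closed set is closed. -/
theorem IsB.isCompact_setOf_exists_mem (hΞ : IsB Ξ) {C : Set ℝ} (hC : IsClosed C) :
    IsCompact {x | ∃ y ∈ Ξ x, y ∈ C} := by
  have h : {x | ∃ y ∈ Ξ x, y ∈ C} =
      Prod.fst '' ({p : X × ℝ | p.2 ∈ Ξ p.1} ∩ Prod.snd ⁻¹' C) := by
    ext x
    constructor
    · rintro ⟨y, hy, hyC⟩
      exact ⟨(x, y), ⟨hy, hyC⟩, rfl⟩
    · rintro ⟨⟨z, w⟩, ⟨h1, h2⟩, rfl⟩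
      exact ⟨w, h1, h2⟩
  rw [h]
  exact (hΞ.isCompact_prod.inter_right (hC.preimage continuous_snd)).image continuous_fst

end Graph

/-! ### Lower semicontinuity of the weighted variation -/

theorem tendsto_integral_deriv_mul {M : Dom} {u : ℝ → M.Pt → ℝ} {u₀ : M.Pt → ℝ}
    (hu : ∀ ε ∈ Ioo (0 : ℝ) 1, IsL1 M (u ε)) (hu₀ : IsL1 M u₀) (h : L1Tendsto M u u₀)
    {A : Set M.Pt} {φ : M.Pt → ℝ} (hφ : IsTest M A φ) :
    Tendsto (fun ε => ∫ t, deriv (φ ∘ M.param) t * u ε (M.param t) ∂M.leb) (𝓝[>] 0)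
      (𝓝 (∫ t, deriv (φ ∘ M.param) t * u₀ (M.param t) ∂M.leb)) := by
  have hφ' : Continuous (deriv (φ ∘ M.param)) := hφ.1.continuous_deriv le_rfl
  obtain ⟨B, hB⟩ := isCompact_Icc.exists_bound_of_continuousOn
    (hφ'.continuousOn (s := Icc M.left M.right))
  have hB' : ∀ᵐ t ∂M.leb, ‖deriv (φ ∘ M.param) t‖ ≤ B := by
    filter_upwards [ae_restrict_mem measurableSet_Ioo] with t ht
    exact hB t (Ioo_subset_Icc_self ht)
  have hi : ∀ w : M.Pt → ℝ, IsL1 M w →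
      Integrable (fun t => deriv (φ ∘ M.param) t * w (M.param t)) M.leb := fun w hw =>
    Integrable.bdd_mul hw (c := B) hφ'.aestronglyMeasurable hB'
  refine tendsto_integral_of_L1 _ (hi u₀ hu₀).1 ?_ ?_
  · filter_upwards [Ioo_mem_nhdsGT (zero_lt_one (α := ℝ))] with ε hε
    exact hi _ (hu ε hε)
  · have h1 : Tendsto (fun ε => ENNReal.ofReal B * eLpNorm ((u ε - u₀) ∘ M.param) 1 M.leb)
        (𝓝[>] 0) (𝓝 0) := by
      have := ENNReal.Tendsto.const_mul h (Or.inr (ENNReal.ofReal_ne_top (r := B)))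
      rwa [mul_zero] at this
    refine tendsto_of_tendsto_of_tendsto_of_le_of_le tendsto_const_nhds h1 (fun _ => zero_le)
      fun ε => ?_
    simp only
    rw [eLpNorm_one_eq_lintegral_enorm, ← lintegral_const_mul' _ _ ENNReal.ofReal_ne_top]
    refine lintegral_mono_ae ?_
    filter_upwards [hB'] with t ht
    rw [← mul_sub, enorm_mul]
    gcongr
    · rw [← ofReal_norm]
      exact ENNReal.ofReal_le_ofReal ht
    · rfl

/-- A test function dominated by `ρ` is admissible for all small `ε`, and its pairing with `u ε`
converges. A supremum of such functionals is lower semicontinuous. -/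
theorem weightedTV_le_liminf {M : Dom} {v u : ℝ → M.Pt → ℝ} {u₀ : M.Pt → ℝ}
    (hu : ∀ ε ∈ Ioo (0 : ℝ) 1, IsL1 M (u ε)) (hu₀ : IsL1 M u₀) (h : L1Tendsto M u u₀)
    {ρ : M.Pt → ℝ} (hρ : ∀ᶠ ε in 𝓝[>] 0, ∀ x, ρ x ≤ v ε x ^ 2) :
    weightedTV M ρ univ u₀ ≤
      liminf (fun ε => weightedTV M (fun x => v ε x ^ 2) univ (u ε)) (𝓝[>] 0) := by
  refine iSup_le fun φ => iSup_le fun hφ => iSup_le fun hle => ?_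
  have h1 := (ENNReal.continuous_ofReal.tendsto _).comp (tendsto_integral_deriv_mul hu hu₀ h hφ)
  rw [← h1.liminf_eq]
  refine liminf_le_liminf ?_
  filter_upwards [hρ] with ε hε
  exact le_iSup_of_le φ (le_iSup_of_le hφ (le_iSup_of_le (fun x => (hle x).trans (hε x)) le_rfl))

/-! ### Continuous minorants of the least square in the limit graph -/

section LowerEnvelope

variable {X : Type} [MetricSpace X] {Ξ : X → Set ℝ}

/-- Lipschitz approximation from below of `x ↦ min {y² | y ∈ Ξ x}`. -/
noncomputable def lowerEnvelope (Ξ : X → Set ℝ) (n : ℕ) (x : X) : ℝ :=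
  sInf ((fun p : X × ℝ => p.2 ^ 2 + n * dist x p.1) '' {p | p.2 ∈ Ξ p.1})

theorem lowerEnvelope_le (n : ℕ) (x : X) {z : X} {y : ℝ} (hy : y ∈ Ξ z) :
    lowerEnvelope Ξ n x ≤ y ^ 2 + n * dist x z :=
  csInf_le ⟨0, by rintro _ ⟨p, -, rfl⟩; positivity⟩ ⟨(z, y), hy, rfl⟩

theorem le_lowerEnvelope (hne : {p : X × ℝ | p.2 ∈ Ξ p.1}.Nonempty) {n : ℕ} {x : X} {c : ℝ}
    (h : ∀ z, ∀ y ∈ Ξ z, c ≤ y ^ 2 + n * dist x z) : c ≤ lowerEnvelope Ξ n x :=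
  le_csInf (hne.image _) (by rintro _ ⟨p, hp, rfl⟩; exact h _ _ hp)

/-- An infimum of functions with Lipschitz constant `n` has Lipschitz constant `n`. -/
theorem continuous_lowerEnvelope (hne : {p : X × ℝ | p.2 ∈ Ξ p.1}.Nonempty) (n : ℕ) :
    Continuous (lowerEnvelope Ξ n) := by
  refine (LipschitzWith.of_le_add_mul (n : NNReal) fun x x' => ?_).continuous
  rw [← sub_le_iff_le_add]
  refine le_lowerEnvelope hne fun z y hy => ?_
  have h1 := lowerEnvelope_le (Ξ := Ξ) n x hy
  have h2 := dist_triangle x x' z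
  have h3 : (n : ℝ) * dist x z ≤ n * (dist x x' + dist x' z) :=
    mul_le_mul_of_nonneg_left h2 (Nat.cast_nonneg n)
  simp only [NNReal.coe_natCast]
  linarith

theorem IsB.eventually_lowerEnvelope_le (hΞ : IsB Ξ) {v : ℝ → X → ℝ} (hv : GraphTendsto v Ξ)
    (n : ℕ) {δ : ℝ} (hδ : 0 < δ) :
    ∀ᶠ ε in 𝓝[>] 0, ∀ x, lowerEnvelope Ξ n x ≤ v ε x ^ 2 + δ := by
  obtain ⟨B, hB0, hB⟩ := hΞ.exists_bound
  -- A graph point within `η` of `(x, v ε x)` costs `n * η` in the penalty and at most `(2 * B + 1)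
  -- * η` in the square.
  set η := min 1 (δ / (2 * B + 1 + n)) with hη
  have hη0 : 0 < η := lt_min one_pos (by positivity)
  filter_upwards [hv.eventually_near_graph hη0] with ε hε x
  obtain ⟨z, y, hy, hd, hvy⟩ := hε x
  have h1 := lowerEnvelope_le (Ξ := Ξ) n x hy
  have h2 : (n : ℝ) * dist x z ≤ n * η := mul_le_mul_of_nonneg_left hd.le (Nat.cast_nonneg n)
  have h3 : η * (2 * B + 1 + n) ≤ δ := by
    have := min_le_right 1 (δ / (2 * B + 1 + n))
    rw [le_div_iff₀ (by positivity)] at this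
    exact this
  have h4 : y ^ 2 - v ε x ^ 2 ≤ η * (2 * B + 1) := by
    have e1 := hB z y hy
    have e2 : |y - v ε x| ≤ η := by rw [abs_sub_comm]; exact hvy.le
    have e3 : |y + v ε x| ≤ 2 * B + 1 := by
      have e4 : y + v ε x = 2 * y + (v ε x - y) := by ring
      rw [e4]
      refine (abs_add_le _ _).trans ?_
      rw [abs_mul, abs_two]
      have := hvy.le.trans (min_le_left _ _)
      linarith
    calc y ^ 2 - v ε x ^ 2 = (y - v ε x) * (y + v ε x) := by ring
      _ ≤ |(y - v ε x) * (y + v ε x)| := le_abs_self _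
      _ = |y - v ε x| * |y + v ε x| := abs_mul _ _
      _ ≤ η * (2 * B + 1) := mul_le_mul e2 e3 (abs_nonneg _) hη0.le
  nlinarith

/-- The points whose value contains some `y` with `y² ≤ c` form a closed set that misses `x`. Points
near `x` therefore contribute more than `c` by themselves, and farther points do so through the
penalty once `n * r ≥ c`. -/
theorem IsB.eventually_le_lowerEnvelope (hΞ : IsB Ξ)
    (hne : {p : X × ℝ | p.2 ∈ Ξ p.1}.Nonempty) {x : X} {c : ℝ} (hc : ∀ y ∈ Ξ x, c < y ^ 2) :
    ∀ᶠ n : ℕ in atTop, c ≤ lowerEnvelope Ξ n x := by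
  have hcl : IsClosed {x | ∃ y ∈ Ξ x, y ∈ {y : ℝ | y ^ 2 ≤ c}} :=
    (hΞ.isCompact_setOf_exists_mem (isClosed_le (by fun_prop) continuous_const)).isClosed
  have hx : x ∈ {x | ∃ y ∈ Ξ x, y ∈ {y : ℝ | y ^ 2 ≤ c}}ᶜ := by
    rintro ⟨y, hy, hy'⟩
    exact absurd (hc y hy) (not_lt.2 hy')
  obtain ⟨r, hr, hb⟩ := Metric.isOpen_iff.1 hcl.isOpen_compl x hx
  obtain ⟨N, hN⟩ := exists_nat_gt (c / r)
  filter_upwards [eventually_ge_atTop N] with n hn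
  refine le_lowerEnvelope hne fun z y hy => ?_
  by_cases hz : dist x z < r
  · have : z ∈ {x | ∃ y ∈ Ξ x, y ∈ {y : ℝ | y ^ 2 ≤ c}}ᶜ := hb (by
      rwa [Metric.mem_ball, dist_comm])
    have h1 : c < y ^ 2 := by
      by_contra! h
      exact this ⟨y, hy, h⟩
    have : 0 ≤ (n : ℝ) * dist x z := by positivity
    linarith
  · have h1 : c / r ≤ n := hN.le.trans (by exact_mod_cast hn)
    rw [div_le_iff₀ hr] at h1
    have h2 : (n : ℝ) * r ≤ n * dist x z :=
      mul_le_mul_of_nonneg_left (not_lt.1 hz) (Nat.cast_nonneg n)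
    nlinarith [sq_nonneg y]

end LowerEnvelope

/-- Lower bound of the weighted variations by the least squares of the limit graph. -/
theorem IsVariationMeasure.lintegral_le_liminf {M : Dom} {v u : ℝ → M.Pt → ℝ} {u₀ : M.Pt → ℝ}
    {Ξ : M.Pt → Set ℝ} {μ : Measure M.Pt} (hμ : IsVariationMeasure M u₀ μ)
    (hu : ∀ ε ∈ Ioo (0 : ℝ) 1, IsL1 M (u ε)) (hu₀ : IsL1 M u₀) (h : L1Tendsto M u u₀)
    (hΞ : IsB Ξ) (hv : GraphTendsto v Ξ) (hne : ∀ x, (Ξ x).Nonempty) {m : M.Pt → ℝ}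
    (hm : ∀ x, ∀ y ∈ Ξ x, m x ≤ y ^ 2) :
    ∫⁻ x, ENNReal.ofReal (m x) ∂μ ≤
      liminf (fun ε => weightedTV M (fun x => v ε x ^ 2) univ (u ε)) (𝓝[>] 0) := by
  have := hμ.isFinite
  have hne' : {p : M.Pt × ℝ | p.2 ∈ Ξ p.1}.Nonempty := by
    obtain ⟨y, hy⟩ := hne (M.param 0)
    exact ⟨(M.param 0, y), hy⟩
  set l := liminf (fun ε => weightedTV M (fun x => v ε x ^ 2) univ (u ε)) (𝓝[>] 0) with hl
  have h1 : ∀ n : ℕ, ∫⁻ x, ENNReal.ofReal (lowerEnvelope Ξ n x) ∂μ ≤ l := by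
    intro n
    have h2 : ∀ δ : ℝ, 0 < δ →
        ∫⁻ x, ENNReal.ofReal (lowerEnvelope Ξ n x) ∂μ ≤ l + ENNReal.ofReal δ * μ univ := by
      intro δ hδ
      -- The envelope is an admissible weight only up to `δ`. Lowering it by `δ` costs at most `δ`
      -- times the total mass, which is finite.
      have h3 : weightedTV M (fun x => max (lowerEnvelope Ξ n x - δ) 0) univ u₀ ≤ l := by
        refine weightedTV_le_liminf hu hu₀ h ?_
        filter_upwards [hΞ.eventually_lowerEnvelope_le hv n hδ] with ε hε x
        exact max_le (by linarith [hε x]) (sq_nonneg _)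
      have hc : Continuous fun x => max (lowerEnvelope Ξ n x - δ) 0 :=
        ((continuous_lowerEnvelope hne' n).sub continuous_const).max continuous_const
      rw [hμ.weightedTV_eq (fun x => max (lowerEnvelope Ξ n x - δ) 0) hc
        (fun x => le_max_right _ _) univ isOpen_univ, Measure.restrict_univ] at h3
      calc ∫⁻ x, ENNReal.ofReal (lowerEnvelope Ξ n x) ∂μ
          ≤ ∫⁻ x, (ENNReal.ofReal (max (lowerEnvelope Ξ n x - δ) 0) + ENNReal.ofReal δ) ∂μ := by
            refine lintegral_mono fun x => ?_
            rw [← ENNReal.ofReal_add (le_max_right _ _) hδ.le]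
            refine ENNReal.ofReal_le_ofReal ?_
            linarith [le_max_left (lowerEnvelope Ξ n x - δ) 0]
        _ = ∫⁻ x, ENNReal.ofReal (max (lowerEnvelope Ξ n x - δ) 0) ∂μ +
            ENNReal.ofReal δ * μ univ := by
            rw [lintegral_add_right _ measurable_const, lintegral_const]
        _ ≤ l + ENNReal.ofReal δ * μ univ := add_le_add_left h3 _
    have h4 : Tendsto (fun δ : ℝ => l + ENNReal.ofReal δ * μ univ) (𝓝[>] 0) (𝓝 (l + 0)) := by
      refine tendsto_const_nhds.add ?_
      have h5 : Tendsto (fun δ : ℝ => ENNReal.ofReal δ) (𝓝[>] 0) (𝓝 0) := by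
        have := (ENNReal.continuous_ofReal.tendsto 0).mono_left (nhdsWithin_le_nhds (s := Ioi 0))
        rwa [ENNReal.ofReal_zero] at this
      have := ENNReal.Tendsto.mul_const h5 (Or.inr (measure_ne_top μ univ))
      rwa [zero_mul] at this
    rw [add_zero] at h4
    exact ge_of_tendsto h4 (eventually_nhdsWithin_of_forall fun δ hδ => h2 δ hδ)
  calc ∫⁻ x, ENNReal.ofReal (m x) ∂μ
      -- Pointwise the envelopes recover at least `m`; Fatou's lemma moves the liminf outside.
      ≤ ∫⁻ x, liminf (fun n => ENNReal.ofReal (lowerEnvelope Ξ n x)) atTop ∂μ := by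
        refine lintegral_mono fun x => ?_
        refine le_of_forall_lt fun c hc => ?_
        obtain ⟨c', hc1, hc2⟩ := exists_between hc
        refine hc1.trans_le ?_
        have hc3 : c' ≠ ∞ := (hc2.trans ENNReal.ofReal_lt_top).ne
        have hc4 : c'.toReal < m x := (ENNReal.lt_ofReal_iff_toReal_lt hc3).1 hc2
        refine le_liminf_of_le (by isBoundedDefault) ?_
        filter_upwards [hΞ.eventually_le_lowerEnvelope hne'
          (fun y hy => hc4.trans_le (hm x y hy))] with n hn
        exact ENNReal.le_ofReal_iff_toReal_le hc3 (ENNReal.toReal_nonneg.trans hn) |>.2 hn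
    _ ≤ liminf (fun n => ∫⁻ x, ENNReal.ofReal (lowerEnvelope Ξ n x) ∂μ) atTop :=
        lintegral_liminf_le fun n =>
          (continuous_lowerEnvelope hne' n).measurable.ennreal_ofReal
    _ ≤ l := by
        refine (liminf_le_liminf (Eventually.of_forall h1)).trans ?_
        simp

/-! ### Splitting the weighted variation, and extension of bounded variation over finite sets -/

theorem IsVariationMeasure.measure_diff_jumpSet {M : Dom} {u : M.Pt → ℝ} {μ : Measure M.Pt}
    (hμ : IsVariationMeasure M u μ) {S : Set M.Pt} (hS : S.Countable) :
    μ (S \ jumpSet M u) = 0 := by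
  rw [← biUnion_of_singleton (S \ jumpSet M u),
    measure_biUnion_null_iff (hS.mono sdiff_subset)]
  rintro x ⟨-, hx⟩
  by_cases hi : x ∈ M.inner
  · rw [hμ.singleton x hi, ENNReal.ofReal_eq_zero]
    by_contra! h
    exact hx ⟨hi, h⟩
  · exact measure_mono_null (singleton_subset_iff.2 hi) hμ.compl_inner

/-- Off `J_u ∩ S` the weight is `1` almost everywhere, because the rest of the countable set `S`
carries no mass. On `J_u ∩ S` the measure is purely atomic, with the jumps as masses. -/
theorem IsVariationMeasure.lintegral_eq {M : Dom} {u : M.Pt → ℝ} {μ : Measure M.Pt}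
    (hμ : IsVariationMeasure M u μ) {S : Set M.Pt} (hS : S.Countable) {m : M.Pt → ℝ}
    (hm : ∀ x, x ∉ S → m x = 1) :
    ∫⁻ x, ENNReal.ofReal (m x) ∂μ = variation M u (M.inner \ (jumpSet M u ∩ S)) +
      ∑' x : ↥(jumpSet M u ∩ S), ENNReal.ofReal (jump M u x * m x) := by
  set T := jumpSet M u ∩ S with hT
  have hTc : T.Countable := hS.mono inter_subset_right
  have hTm : MeasurableSet T := hTc.measurableSet
  rw [← lintegral_add_compl _ hTm, add_comm]
  congr 1
  · rw [hμ.variation_eq]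
    have h1 : ∫⁻ x in Tᶜ, ENNReal.ofReal (m x) ∂μ = ∫⁻ x in Tᶜ, 1 ∂μ := by
      refine setLIntegral_congr_fun_ae hTm.compl ?_
      filter_upwards [compl_mem_ae_iff.2 (hμ.measure_diff_jumpSet hS)] with x hx hxT
      rw [hm x, ENNReal.ofReal_one]
      intro hxS
      exact hx ⟨hxS, fun hJ => hxT ⟨hJ, hxS⟩⟩
    rw [h1, setLIntegral_one]
    refine measure_congr ?_
    filter_upwards [compl_mem_ae_iff.2 hμ.compl_inner] with x hx
    have hx' : x ∈ M.inner := not_not.1 hx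
    exact propext ⟨fun h => ⟨hx', h⟩, fun h => h.2⟩
  · rw [lintegral_countable _ hTc]
    refine tsum_congr fun x => ?_
    rw [hμ.singleton x x.2.1.1, mul_comm (jump M u x)]
    exact (ENNReal.ofReal_mul' (abs_nonneg _)).symm

/-- The test functions are not required to vanish at the ends, so the bound contains the boundary
traces. That is what allows the interval to be cut at a point of `S` and the bounds of the pieces to
be added. -/
theorem exists_bound_integral_deriv_mul {f : ℝ → ℝ} (S : Finset ℝ) : ∀ {α β : ℝ}, α < β →
    IntegrableOn f (Ioo α β) →
    (∀ γ δ, α ≤ γ → γ < δ → δ ≤ β → (∀ s ∈ S, s ∉ Ioo γ δ) →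
      ∃ p q : ℝ → ℝ, Monotone p ∧ Monotone q ∧
        ∀ᵐ t ∂volume.restrict (Ioo γ δ), f t = p t - q t) →
    ∃ C : ℝ, ∀ φ : ℝ → ℝ, ContDiff ℝ 1 φ → (∀ t, |φ t| ≤ 1) →
      ∫ t in Ioo α β, deriv φ t * f t ≤ C := by
  induction S using Finset.induction_on with
  | empty =>
    intro α β hαβ _ h
    obtain ⟨p, q, hp, hq, hf⟩ := h α β le_rfl hαβ le_rfl (by simp)
    have hb : ∀ (ν : Measure ℝ) [IsFiniteMeasure (ν.restrict (Ioo α β))] (φ : ℝ → ℝ),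
        (∀ t, |φ t| ≤ 1) → |∫ t in Ioo α β, φ t ∂ν| ≤ (ν (Ioo α β)).toReal := by
      intro ν _ φ hφ
      have := norm_integral_le_of_norm_le_const (μ := ν.restrict (Ioo α β)) (f := φ) (C := 1)
        (Eventually.of_forall hφ)
      simpa [Measure.real] using this
    refine ⟨|Function.leftLim p β - Function.leftLim q β| +
      |Function.rightLim p α - Function.rightLim q α| +
      ((hp.stieltjesFunction.measure (Ioo α β)).toReal +
        (hq.stieltjesFunction.measure (Ioo α β)).toReal), fun φ hφ hφ1 => ?_⟩
    rw [integral_deriv_mul_eq_of_ae_eq hp hq hαβ hf hφ]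
    have h1 := abs_le.1 (hb hp.stieltjesFunction.measure φ hφ1)
    have h2 := abs_le.1 (hb hq.stieltjesFunction.measure φ hφ1)
    have h3 : ∀ a b : ℝ, |a| ≤ 1 → |a * b| ≤ |b| := fun a b ha => by
      rw [abs_mul]
      exact mul_le_of_le_one_left (abs_nonneg b) ha
    have h4 := (abs_le.1 (h3 _ (Function.leftLim p β - Function.leftLim q β) (hφ1 β))).2
    have h5 := (abs_le.1 (h3 _ (Function.rightLim p α - Function.rightLim q α) (hφ1 α))).1
    linarith [h1.1, h1.2, h2.1, h2.2]
  | insert s S _ ih =>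
    intro α β hαβ hf h
    by_cases hs : s ∈ Ioo α β
    · obtain ⟨C₁, hC₁⟩ := ih hs.1 (hf.mono_set (Ioo_subset_Ioo_right hs.2.le))
        fun γ δ h1 h2 h3 h4 => h γ δ h1 h2 (h3.trans hs.2.le) fun r hr => by
          rcases Finset.mem_insert.1 hr with rfl | hr
          · exact fun hm => absurd hm.2 (not_lt.2 h3)
          · exact h4 r hr
      obtain ⟨C₂, hC₂⟩ := ih hs.2 (hf.mono_set (Ioo_subset_Ioo_left hs.1.le))
        fun γ δ h1 h2 h3 h4 => h γ δ (hs.1.le.trans h1) h2 h3 fun r hr => by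
          rcases Finset.mem_insert.1 hr with rfl | hr
          · exact fun hm => absurd hm.1 (not_lt.2 h1)
          · exact h4 r hr
      refine ⟨C₁ + C₂, fun φ hφ hφ1 => ?_⟩
      have hφ' : Continuous (deriv φ) := hφ.continuous_deriv le_rfl
      obtain ⟨B, hB⟩ := isCompact_Icc.exists_bound_of_continuousOn
        (hφ'.continuousOn (s := Icc α β))
      have hi : IntegrableOn (fun t => deriv φ t * f t) (Ioo α β) := by
        refine Integrable.bdd_mul hf (c := B) hφ'.aestronglyMeasurable ?_
        filter_upwards [ae_restrict_mem measurableSet_Ioo] with t ht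
        exact hB t (Ioo_subset_Icc_self ht)
      have hi' : IntervalIntegrable (fun t => deriv φ t * f t) volume α β :=
        (intervalIntegrable_iff_integrableOn_Ioo_of_le hαβ.le).2 hi
      have hsm : s ∈ uIcc α β := by
        rw [uIcc_of_le hαβ.le]
        exact Ioo_subset_Icc_self hs
      have e := intervalIntegral.integral_add_adjacent_intervals
        (hi'.mono_set (uIcc_subset_uIcc_left hsm)) (hi'.mono_set (uIcc_subset_uIcc_right hsm))
      simp only [intervalIntegral.integral_of_le hs.1.le, intervalIntegral.integral_of_le hs.2.le,
        intervalIntegral.integral_of_le hαβ.le, integral_Ioc_eq_integral_Ioo] at e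
      rw [← e]
      exact add_le_add (hC₁ φ hφ hφ1) (hC₂ φ hφ hφ1)
    · refine ih hαβ hf fun γ δ h1 h2 h3 h4 => h γ δ h1 h2 h3 fun r hr => ?_
      rcases Finset.mem_insert.1 hr with rfl | hr
      · exact fun hm => hs ⟨h1.trans_lt hm.1, hm.2.trans_le h3⟩
      · exact h4 r hr

/-- A finite set is removable for functions of bounded variation of one variable. -/
theorem isBV_of_weightedTV_compl_lt_top {M : Dom} {u : M.Pt → ℝ} (hu : IsL1 M u) {Z : Set M.Pt}
    (hZ : Z.Finite) (h : weightedTV M (fun _ => 1) Zᶜ u < ∞) : IsBV M u := by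
  refine ⟨hu, ?_⟩
  have hu' : IntegrableOn (u ∘ M.param) (Ioo M.left M.right) := hu
  obtain ⟨C, hC⟩ := exists_bound_integral_deriv_mul (f := u ∘ M.param)
    (hZ.image M.coord).toFinset M.left_lt_right hu' fun γ δ h1 h2 h3 h4 =>
      exists_monotone_sub_monotone (hu'.mono_set (Ioo_subset_Ioo h1 h3))
        (C := (weightedTV M (fun _ => 1) Zᶜ u).toReal) fun φ hφ => by
          refine (ENNReal.ofReal_le_iff_le_toReal h.ne).1
            (ofReal_integral_deriv_mul_le_weightedTV hφ h1 h3 (A := Zᶜ) (fun t ht htZ => ?_) u)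
          refine h4 t ?_ ht
          rw [Set.Finite.mem_toFinset]
          exact ⟨_, htZ, Dom.coord_param_of_mem_Ico ⟨h1.trans ht.1.le, ht.2.trans_le h3⟩⟩
  refine lt_of_le_of_lt (b := ENNReal.ofReal C) ?_ ENNReal.ofReal_lt_top
  exact iSup_le fun φ => iSup_le fun hφ => iSup_le fun hle =>
    ENNReal.ofReal_le_ofReal (hC _ hφ.1 fun t => hle _)

theorem isBV_of_liminf_lt_top {M : Dom} {v u : ℝ → M.Pt → ℝ} {u₀ : M.Pt → ℝ}
    {Ξ : M.Pt → Set ℝ} (hu : ∀ ε ∈ Ioo (0 : ℝ) 1, IsL1 M (u ε)) (hu₀ : IsL1 M u₀)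
    (h : L1Tendsto M u u₀) (hv : GraphTendsto v Ξ)
    (hZ : {x | ∃ y ∈ Ξ x, |y| ≤ 1 / 2}.Finite)
    (hl : liminf (fun ε => weightedTV M (fun x => v ε x ^ 2) univ (u ε)) (𝓝[>] 0) < ∞) :
    IsBV M u₀ := by
  refine isBV_of_weightedTV_compl_lt_top hu₀ hZ ?_
  set l := liminf (fun ε => weightedTV M (fun x => v ε x ^ 2) univ (u ε)) (𝓝[>] 0) with hl'
  refine lt_of_le_of_lt (b := ENNReal.ofReal 16 * l) ?_
    (ENNReal.mul_lt_top ENNReal.ofReal_lt_top hl)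
  refine iSup_le fun φ => iSup_le fun hφ => iSup_le fun hle => ?_
  have hK : IsCompact (tsupport φ) := (isClosed_tsupport φ).isCompact
  obtain ⟨δ, hδ, hsub⟩ := hK.exists_thickening_subset_open hZ.isClosed.isOpen_compl
    (hφ.2.trans inter_subset_left)
  -- The support of `φ` keeps a distance from the finite set. There `|y| > 1 / 2` for nearby graph
  -- points, hence `|v ε x| > 1 / 4`, and `v²` exceeds `1 / 16 ≥ |φ| / 16`-type weights because `|φ|
  -- ≤ 1`.
  have h1 : weightedTV M (fun x => |φ x| / 16) univ u₀ ≤ l := by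
    refine weightedTV_le_liminf hu hu₀ h ?_
    filter_upwards [hv.eventually_near_graph (δ := min δ (1 / 4)) (by positivity)] with ε hε x
    by_cases hx : x ∈ tsupport φ
    · obtain ⟨z, y, hy, hd, hvy⟩ := hε x
      have hz : z ∉ {x | ∃ y ∈ Ξ x, |y| ≤ 1 / 2} := hsub
        (Metric.mem_thickening_iff.2 ⟨x, hx, by
          rw [dist_comm]; exact hd.trans_le (min_le_left _ _)⟩)
      have hy2 : 1 / 2 < |y| := by
        by_contra! hc
        exact hz ⟨y, hy, hc⟩
      have h3 : |y| - |v ε x| ≤ |v ε x - y| := by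
        rw [abs_sub_comm]
        exact abs_sub_abs_le_abs_sub y (v ε x)
      have h4 : 1 / 4 < |v ε x| := by linarith [hvy.trans_le (min_le_right δ (1 / 4))]
      rw [← sq_abs (v ε x)]
      nlinarith [hle x]
    · rw [image_eq_zero_of_notMem_tsupport hx]
      simp only [abs_zero, zero_div]
      positivity
  have h2 : IsTest M univ fun x => φ x / 16 := by
    refine ⟨hφ.1.div_const 16, ?_⟩
    refine subset_inter (subset_univ _) (Subset.trans ?_ (hφ.2.trans inter_subset_right))
    refine closure_mono fun x hx => ?_
    rw [Function.mem_support] at hx ⊢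
    exact fun h0 => hx (by rw [h0, zero_div])
  have h3 : ENNReal.ofReal (∫ t, deriv ((fun x => φ x / 16) ∘ M.param) t * u₀ (M.param t) ∂M.leb) ≤
      l := by
    refine le_trans ?_ h1
    exact le_iSup_of_le _ (le_iSup_of_le h2 (le_iSup_of_le (fun x => by
      rw [abs_div]; norm_num) le_rfl))
  have h4 : ∫ t, deriv (φ ∘ M.param) t * u₀ (M.param t) ∂M.leb =
      16 * ∫ t, deriv ((fun x => φ x / 16) ∘ M.param) t * u₀ (M.param t) ∂M.leb := by
    rw [← integral_const_mul]
    refine integral_congr_ae (Eventually.of_forall fun t => ?_)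
    have : (fun x => φ x / 16) ∘ M.param = fun t => (φ ∘ M.param) t / 16 := rfl
    simp only [this, deriv_div_const]
    ring
  rw [h4, ENNReal.ofReal_mul (by norm_num)]
  gcongr

/-! ### The Modica--Mortola density controls the variation of a primitive of `√F` -/

/-- The primitive of `√F` that vanishes at `1`; `potG F = |primH F|`. -/
noncomputable def primH (F : ℝ → ℝ) (y : ℝ) : ℝ := ∫ τ in (1 : ℝ)..y, Real.sqrt (F τ)

section PrimH

variable {F : ℝ → ℝ}

theorem potG_eq_abs_primH (F : ℝ → ℝ) (y : ℝ) : potG F y = |primH F y| := rfl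

theorem primH_one : primH F 1 = 0 := intervalIntegral.integral_same

theorem hasDerivAt_primH (hF : Continuous F) (y : ℝ) :
    HasDerivAt (primH F) (Real.sqrt (F y)) y :=
  (hF.sqrt).deriv_integral _ 1 y ▸ (intervalIntegral.integral_hasDerivAt_right
    (hF.sqrt.intervalIntegrable _ _) hF.sqrt.stronglyMeasurable.stronglyMeasurableAtFilter
    hF.sqrt.continuousAt).differentiableAt.hasDerivAt

theorem continuous_primH (hF : Continuous F) : Continuous (primH F) :=
  continuous_iff_continuousAt.2 fun y => (hasDerivAt_primH hF y).continuousAt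

theorem contDiff_primH (hF : Continuous F) : ContDiff ℝ 1 (primH F) := by
  rw [contDiff_one_iff_deriv]
  refine ⟨fun y => (hasDerivAt_primH hF y).differentiableAt, ?_⟩
  rw [show deriv (primH F) = fun y => Real.sqrt (F y) from
    funext fun y => (hasDerivAt_primH hF y).deriv]
  exact hF.sqrt

theorem monotone_primH (hF : Continuous F) : Monotone (primH F) :=
  monotone_of_hasDerivAt_nonneg (hasDerivAt_primH hF) fun _ => Real.sqrt_nonneg _

theorem potG_nonneg (F : ℝ → ℝ) (y : ℝ) : 0 ≤ potG F y := abs_nonneg _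

theorem primH_of_one_le (hF : Continuous F) {y : ℝ} (hy : 1 ≤ y) : primH F y = potG F y := by
  rw [potG_eq_abs_primH, abs_of_nonneg]
  rw [← primH_one (F := F)]
  exact monotone_primH hF hy

theorem primH_of_le_one (hF : Continuous F) {y : ℝ} (hy : y ≤ 1) : primH F y = - potG F y := by
  rw [potG_eq_abs_primH, abs_of_nonpos, neg_neg]
  rw [← primH_one (F := F)]
  exact monotone_primH hF hy

/-- The derivative `√F` vanishes only at `1`, so strict monotonicity holds on both closed half-lines
ending at `1` and glues there. -/
theorem strictMono_primH (hF : Continuous F) (hF0 : ∀ v, 0 ≤ F v) (hF1 : ∀ v, F v = 0 ↔ v = 1) :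
    StrictMono (primH F) := by
  have hpos : ∀ v, v ≠ 1 → 0 < Real.sqrt (F v) := fun v hv =>
    Real.sqrt_pos.2 ((hF0 v).lt_of_ne' fun h => hv ((hF1 v).1 h))
  have h1 : StrictMonoOn (primH F) (Iic 1) := by
    refine strictMonoOn_of_deriv_pos (convex_Iic 1) (continuous_primH hF).continuousOn ?_
    intro y hy
    rw [interior_Iic] at hy
    rw [(hasDerivAt_primH hF y).deriv]
    exact hpos y (ne_of_lt hy)
  have h2 : StrictMonoOn (primH F) (Ici 1) := by
    refine strictMonoOn_of_deriv_pos (convex_Ici 1) (continuous_primH hF).continuousOn ?_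
    intro y hy
    rw [interior_Ici] at hy
    rw [(hasDerivAt_primH hF y).deriv]
    exact hpos y (ne_of_gt hy)
  exact h1.Iic_union_Ici h2

theorem potG_pos (hF : Continuous F) (hF0 : ∀ v, 0 ≤ F v) (hF1 : ∀ v, F v = 0 ↔ v = 1) {y : ℝ}
    (hy : y ≠ 1) : 0 < potG F y := by
  rw [potG_eq_abs_primH, abs_pos, ← primH_one (F := F)]
  exact fun h => hy ((strictMono_primH hF hF0 hF1).injective h)

end PrimH

/-- The Modica--Mortola energy density. -/
noncomputable def density (F : ℝ → ℝ) (ε : ℝ) (g : ℝ → ℝ) (t : ℝ) : ℝ≥0∞ :=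
  ENNReal.ofReal (ε / 2) * ENNReal.ofReal (deriv g t ^ 2) +
    ENNReal.ofReal (1 / (2 * ε)) * ENNReal.ofReal (F (g t))

theorem sMM_eq_lintegral_density (M : Dom) (F : ℝ → ℝ) (ε : ℝ) (v : M.Pt → ℝ) :
    sMM M F ε v = ∫⁻ t in Ioo M.left M.right, density F ε (v ∘ M.param) t := by
  have hm : Measurable fun t => ENNReal.ofReal (deriv (v ∘ M.param) t ^ 2) :=
    ((measurable_deriv _).pow_const 2).ennreal_ofReal
  simp only [density, sMM]
  rw [lintegral_add_left (hm.const_mul _), lintegral_const_mul' _ _ ENNReal.ofReal_ne_top,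
    lintegral_const_mul' _ _ ENNReal.ofReal_ne_top]
  rfl

theorem measurable_density {F : ℝ → ℝ} (hF : Continuous F) (ε : ℝ) {g : ℝ → ℝ}
    (hg : Continuous g) : Measurable (density F ε g) :=
  (((measurable_deriv _).pow_const 2).ennreal_ofReal.const_mul _).add
    ((hF.comp hg).measurable.ennreal_ofReal.const_mul _)

theorem IsH1.continuous {M : Dom} {v : M.Pt → ℝ} (hv : IsH1 M v) : Continuous v := by
  refine Dom.continuous_of_continuousOn_comp_param ?_
  have := hv.1.continuousOn
  rwa [uIcc_of_le M.left_lt_right.le] at this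

/-- The function `g` is bounded, and a `C¹` function is Lipschitz on bounded intervals. -/
theorem absolutelyContinuousOnInterval_comp {g h : ℝ → ℝ} {a b : ℝ} (hh : ContDiff ℝ 1 h)
    (hg : AbsolutelyContinuousOnInterval g a b) : AbsolutelyContinuousOnInterval (h ∘ g) a b := by
  obtain ⟨B, hB⟩ := hg.exists_bound
  have hB' : ∀ t ∈ uIcc a b, g t ∈ Icc (-B) B := fun t ht => abs_le.1 (hB t ht)
  obtain ⟨K, hK⟩ := isCompact_Icc.exists_bound_of_continuousOn
    ((hh.continuous_deriv le_rfl).continuousOn (s := Icc (-B) B))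
  have hL : ∀ y ∈ Icc (-B) B, ∀ z ∈ Icc (-B) B, dist (h y) (h z) ≤ K * dist y z := by
    intro y hy z hz
    rw [dist_eq_norm, dist_eq_norm]
    exact (convex_Icc (-B) B).norm_image_sub_le_of_norm_deriv_le
      (fun w _ => (hh.differentiable one_ne_zero).differentiableAt) hK hz hy
  have h1 : Tendsto (fun E : ℕ × (ℕ → ℝ × ℝ) =>
      K * ∑ i ∈ Finset.range E.1, dist (g (E.2 i).1) (g (E.2 i).2))
      (AbsolutelyContinuousOnInterval.totalLengthFilter ⊓
        𝓟 (AbsolutelyContinuousOnInterval.disjWithin a b)) (𝓝 0) := by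
    have := Tendsto.const_mul K hg
    rwa [mul_zero] at this
  refine tendsto_of_tendsto_of_tendsto_of_le_of_le' tendsto_const_nhds h1
    (Eventually.of_forall fun E => Finset.sum_nonneg fun _ _ => dist_nonneg) ?_
  filter_upwards [mem_inf_of_right (mem_principal_self _)] with E hE
  rw [Finset.mul_sum]
  exact Finset.sum_le_sum fun i hi => hL _ (hB' _ (hE.1 i hi).1) _ (hB' _ (hE.1 i hi).2)

/-- Arithmetic-geometric mean inequality: the difference of the two sides is `(ε|d| - √a)² / (2ε)`.
-/
theorem ofReal_sqrt_mul_le {a d ε : ℝ} (ha : 0 ≤ a) (hε : 0 < ε) :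
    ENNReal.ofReal (Real.sqrt a * |d|) ≤
      ENNReal.ofReal (ε / 2) * ENNReal.ofReal (d ^ 2) +
        ENNReal.ofReal (1 / (2 * ε)) * ENNReal.ofReal a := by
  rw [← ENNReal.ofReal_mul (by positivity), ← ENNReal.ofReal_mul (by positivity),
    ← ENNReal.ofReal_add (by positivity) (by positivity)]
  refine ENNReal.ofReal_le_ofReal ?_
  have h1 : ε / 2 * d ^ 2 + 1 / (2 * ε) * a - Real.sqrt a * |d| =
      (ε * |d| - Real.sqrt a) ^ 2 / (2 * ε) := by
    rw [← sq_abs d]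
    nth_rewrite 1 [← Real.sq_sqrt ha]
    field_simp
    ring
  have h2 : 0 ≤ (ε * |d| - Real.sqrt a) ^ 2 / (2 * ε) := by positivity
  linarith

/-- The Modica–Mortola argument: almost everywhere the derivative of `primH F ∘ g` is `√F(g) g'`,
which the density dominates whatever `ε` is. -/
theorem ofReal_abs_primH_sub_le {F : ℝ → ℝ} (hF : Continuous F) (hF0 : ∀ v, 0 ≤ F v) {ε : ℝ}
    (hε : 0 < ε) {g : ℝ → ℝ} {s t : ℝ} (hst : s ≤ t)
    (hg : AbsolutelyContinuousOnInterval g s t) :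
    ENNReal.ofReal |primH F (g t) - primH F (g s)| ≤ ∫⁻ τ in Ioo s t, density F ε g τ := by
  have h1 := (absolutelyContinuousOnInterval_comp (contDiff_primH hF) hg).integral_deriv_eq_sub
  simp only [Function.comp_apply] at h1
  rw [← h1, intervalIntegral.integral_of_le hst, integral_Ioc_eq_integral_Ioo,
    ← Real.enorm_eq_ofReal_abs]
  refine (enorm_integral_le_lintegral_enorm _).trans ?_
  refine lintegral_mono_ae ?_
  filter_upwards [ae_restrict_mem measurableSet_Ioo,
    ae_restrict_of_ae hg.ae_differentiableAt] with τ hτ hd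
  have hd' := hd (by rw [uIcc_of_le hst]; exact Ioo_subset_Icc_self hτ)
  have e : deriv (primH F ∘ g) τ = Real.sqrt (F (g τ)) * deriv g τ :=
    ((hasDerivAt_primH hF (g τ)).comp τ hd'.hasDerivAt).deriv
  have e2 : ‖deriv (primH F ∘ g) τ‖ₑ = ENNReal.ofReal (Real.sqrt (F (g τ)) * |deriv g τ|) := by
    rw [e, Real.enorm_eq_ofReal_abs, abs_mul, abs_of_nonneg (Real.sqrt_nonneg _)]
  exact e2.trans_le (ofReal_sqrt_mul_le (hF0 _) hε)

theorem setLIntegral_Ioo_add_le {s m t : ℝ} (h1 : s ≤ m) (h2 : m ≤ t) (f : ℝ → ℝ≥0∞) :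
    (∫⁻ τ in Ioo s m, f τ) + (∫⁻ τ in Ioo m t, f τ) ≤ ∫⁻ τ in Ioo s t, f τ := by
  rw [← lintegral_union measurableSet_Ioo
    (Set.disjoint_left.2 fun x hx hy => absurd hx.2 (not_lt.2 hy.1.le))]
  exact lintegral_mono_set (union_subset (Ioo_subset_Ioo_right h2) (Ioo_subset_Ioo_left h1))

theorem ofReal_abs_sub_le_add (a b c : ℝ) :
    ENNReal.ofReal |a - c| ≤ ENNReal.ofReal |b - c| + ENNReal.ofReal |a - b| := by
  rw [← ENNReal.ofReal_add (abs_nonneg _) (abs_nonneg _)]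
  refine ENNReal.ofReal_le_ofReal ?_
  linarith [abs_sub_le a b c]

/-! ### Coordinate windows, which treat the interval and the torus alike -/

/-- An open coordinate interval around the coordinate of `x` that covers `M` once, up to null
sets. -/
structure IsWindow (M : Dom) (x : M.Pt) (L R : ℝ) : Prop where
  lt : L < R
  coord_mem : M.coord x ∈ Icc L R
  coord_mem_of_inner : x ∈ M.inner → M.coord x ∈ Ioo L R
  coord_eq_of_notMem_inner : x ∉ M.inner → M.coord x = L ∨ M.coord x = R
  dist_eq : ∀ t ∈ Icc L R, dist (M.param t) x = |t - M.coord x|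
  mem_of_near : ∃ δ > 0, ∀ t ∈ M.chart, |t - M.coord x| < δ → t ∈ Icc L R
  lintegral_eq : ∀ f : M.Pt → ℝ≥0∞,
    ∫⁻ t in Ioo M.left M.right, f (M.param t) = ∫⁻ t in Ioo L R, f (M.param t)
  lintegral_density_eq : ∀ (B : Set M.Pt), MeasurableSet B → ∀ F ε (v : M.Pt → ℝ),
    ∫⁻ t in Ioo M.left M.right ∩ M.param ⁻¹' B, density F ε (v ∘ M.param) t =
      ∫⁻ t in Ioo L R ∩ M.param ⁻¹' B, density F ε (v ∘ M.param) t
  primH_sub_le : ∀ {F : ℝ → ℝ}, Continuous F → (∀ v, 0 ≤ F v) → ∀ {ε : ℝ}, 0 < ε →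
    ∀ {v : M.Pt → ℝ}, IsH1 M v → ∀ {s t : ℝ}, L ≤ s → s ≤ t → t ≤ R →
      ENNReal.ofReal |primH F (v (M.param t)) - primH F (v (M.param s))| ≤
        ∫⁻ τ in Ioo s t, density F ε (v ∘ M.param) τ

theorem isWindow_interval {a b : ℝ} (hab : a < b) (x : (Dom.interval a b hab).Pt) :
    IsWindow (Dom.interval a b hab) x a b where
  lt := hab
  coord_mem := Dom.coord_mem_chart _ x
  coord_mem_of_inner hx := hx
  coord_eq_of_notMem_inner hx := by
    by_contra! h
    exact hx ⟨lt_of_le_of_ne (Dom.coord_mem_chart _ x).1 h.1.symm,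
      lt_of_le_of_ne (Dom.coord_mem_chart _ x).2 h.2⟩
  dist_eq t ht := by
    change |((Set.projIcc a b hab.le t : Icc a b) : ℝ) - _| = _
    rw [Set.projIcc_of_mem hab.le ht]
    rfl
  mem_of_near := ⟨1, one_pos, fun t ht _ => ht⟩
  lintegral_eq f := rfl
  lintegral_density_eq B _ F ε v := rfl
  primH_sub_le hF hF0 _ hε _ hv s t hs hst ht := by
    refine ofReal_abs_primH_sub_le hF hF0 hε hst (hv.1.mono ?_)
    rw [uIcc_of_le hst]
    exact (Icc_subset_Icc hs ht).trans Icc_subset_uIcc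

theorem setLIntegral_Ioo_add_one {f : ℝ → ℝ≥0∞} (hf : ∀ t, f (t + 1) = f t) (s t : ℝ) :
    ∫⁻ τ in Ioo (s + 1) (t + 1), f τ = ∫⁻ τ in Ioo s t, f τ := by
  have := (measurePreserving_add_right volume (1 : ℝ)).setLIntegral_comp_preimage_emb
    (measurableEmbedding_addRight 1) f (Ioo (s + 1) (t + 1))
  rw [← this]
  simp [hf]

theorem density_add_one (F : ℝ → ℝ) (ε : ℝ) {g : ℝ → ℝ} (hg : ∀ t, g (t + 1) = g t) (t : ℝ) :
    density F ε g (t + 1) = density F ε g t := by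
  have h1 : deriv g (t + 1) = deriv g t := by
    rw [← deriv_comp_add_const]
    simp only [hg]
  simp only [density, h1, hg]

theorem setLIntegral_torus_eq (c : ℝ) (f : Dom.torus.Pt → ℝ≥0∞) :
    ∫⁻ t in Ioo (0 : ℝ) 1, f (Dom.torus.param t) =
      ∫⁻ t in Ioo (c - 1 / 2) (c + 1 / 2), f (Dom.torus.param t) := by
  have h0 := UnitAddCircle.lintegral_preimage 0 f
  have h1 := UnitAddCircle.lintegral_preimage (c - 1 / 2) f
  rw [← h1, setLIntegral_congr Ioo_ae_eq_Ioc.symm, setLIntegral_congr Ioo_ae_eq_Ioc.symm] at h0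
  have e : c - 1 / 2 + 1 = c + 1 / 2 := by ring
  rw [zero_add, e] at h0
  exact h0

/-- The unit interval is centred at the coordinate of `x`, so that a neighbourhood of `x` is not cut
by the seam; up to half a period, distances on the torus are distances of coordinates. -/
theorem isWindow_torus (x : Dom.torus.Pt) :
    IsWindow Dom.torus x (Dom.torus.coord x - 1 / 2) (Dom.torus.coord x + 1 / 2) where
  lt := by linarith
  coord_mem := ⟨by linarith, by linarith⟩
  coord_mem_of_inner _ := ⟨by linarith, by linarith⟩
  coord_eq_of_notMem_inner hx := absurd (mem_univ x) hx
  dist_eq t ht := by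
    nth_rewrite 1 [← Dom.torus.param_coord x]
    change dist (t : AddCircle (1 : ℝ)) ((Dom.torus.coord x : ℝ) : AddCircle (1 : ℝ)) = _
    rw [dist_eq_norm, ← QuotientAddGroup.mk_sub]
    refine (AddCircle.norm_coe_eq_abs_iff (p := 1) one_ne_zero).2 ?_
    rw [abs_one, abs_le]
    exact ⟨by linarith [ht.1], by linarith [ht.2]⟩
  mem_of_near := ⟨1 / 2, by norm_num, fun t _ ht => by
    rw [abs_lt] at ht
    exact ⟨by linarith, by linarith⟩⟩
  lintegral_eq f := setLIntegral_torus_eq _ f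
  lintegral_density_eq B hB F ε v := by
    have hper : ∀ t, (v ∘ Dom.torus.param) (t + 1) = (v ∘ Dom.torus.param) t := fun t => by
      simp only [Function.comp_apply, Dom.param_torus_add_one]
    -- The density is periodic, hence a function on the torus, and its integral over a period does
    -- not depend on the period.
    have hz : ∀ t, density F ε (v ∘ Dom.torus.param) (Dom.torus.coord (Dom.torus.param t)) =
        density F ε (v ∘ Dom.torus.param) t := by
      intro t
      obtain ⟨n, hn⟩ := Dom.param_torus_eq_iff.1 (Dom.torus.param_coord (Dom.torus.param t))
      have hP : Function.Periodic (density F ε (v ∘ Dom.torus.param)) 1 :=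
        density_add_one F ε hper
      have := hP.int_mul n t
      rw [← this]
      congr 1
      linarith
    have hm : MeasurableSet (Dom.torus.param ⁻¹' B) :=
      Dom.torus.continuous_param.measurable hB
    have key := setLIntegral_torus_eq (Dom.torus.coord x) fun y =>
      B.indicator (fun y => density F ε (v ∘ Dom.torus.param) (Dom.torus.coord y)) y
    have hi : ∀ t, B.indicator
        (fun y => density F ε (v ∘ Dom.torus.param) (Dom.torus.coord y)) (Dom.torus.param t) =
        (Dom.torus.param ⁻¹' B).indicator (density F ε (v ∘ Dom.torus.param)) t := by
      intro t
      by_cases h : Dom.torus.param t ∈ B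
      · rw [indicator_of_mem h, indicator_of_mem (show t ∈ _ from h), hz]
      · rw [indicator_of_notMem h, indicator_of_notMem (show t ∉ _ from h)]
    simp only [hi, lintegral_indicator hm, Measure.restrict_restrict hm] at key
    rw [inter_comm, inter_comm (Ioo _ _)]
    exact key
  primH_sub_le {F} hF hF0 ε hε v hv s t hs hst ht := by
    set g := v ∘ Dom.torus.param with hg
    have hper : ∀ t, g (t + 1) = g t := fun t => by
      simp only [hg, Function.comp_apply, Dom.param_torus_add_one]
    let P : ℝ → ℝ → Prop := fun s t => ENNReal.ofReal |primH F (g t) - primH F (g s)| ≤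
        ∫⁻ τ in Ioo s t, density F ε g τ
    have hshift : ∀ s t, P (s + 1) (t + 1) ↔ P s t := by
      intro s t
      simp only [P, hper, setLIntegral_Ioo_add_one (density_add_one F ε hper)]
    -- Absolute continuity is given on `[0, 1]` only. Translation carries the estimate to `[-1, 0]`
    -- and `[1, 2]`, and the pieces are joined at the integers.
    have h0 : ∀ s t, 0 ≤ s → s ≤ t → t ≤ 1 → P s t := by
      intro s t hs hst ht
      refine ofReal_abs_primH_sub_le hF hF0 hε hst (hv.1.mono ?_)
      rw [uIcc_of_le hst]
      exact (Icc_subset_Icc hs ht).trans Icc_subset_uIcc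
    have hm : ∀ s t, -1 ≤ s → s ≤ t → t ≤ 0 → P s t := fun s t hs hst ht =>
      (hshift s t).1 (h0 _ _ (by linarith) (by linarith) (by linarith))
    have hp : ∀ s t, 1 ≤ s → s ≤ t → t ≤ 2 → P s t := fun s t hs hst ht => by
      have := (hshift (s - 1) (t - 1)).2 (h0 _ _ (by linarith) (by linarith) (by linarith))
      rwa [sub_add_cancel, sub_add_cancel] at this
    have hjoin : ∀ s m t, s ≤ m → m ≤ t → P s m → P m t → P s t := fun s m t h1 h2 h3 h4 =>
      (ofReal_abs_sub_le_add _ (primH F (g m)) _).trans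
        ((add_le_add h3 h4).trans (setLIntegral_Ioo_add_le h1 h2 _))
    have hc0 := Dom.torus.left_le_coord x
    have hc1 := Dom.torus.coord_le_right x
    change 0 ≤ _ at hc0
    change _ ≤ 1 at hc1
    have hs' : -1 ≤ s := by linarith
    have ht' : t ≤ 2 := by linarith
    have hleft : ∀ s t, -1 ≤ s → s ≤ t → t ≤ 1 → P s t := by
      intro s t hs hst ht
      rcases le_total t 0 with h | h
      · exact hm s t hs hst h
      rcases le_total 0 s with h' | h'
      · exact h0 s t h' hst ht
      · exact hjoin s 0 t h' h (hm s 0 hs h' le_rfl) (h0 0 t le_rfl h ht)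
    change P s t
    rcases le_total t 1 with h | h
    · exact hleft s t hs' hst h
    rcases le_total 1 s with h' | h'
    · exact hp s t h' hst ht'
    · exact hjoin s 1 t h' h (hleft s 1 hs' h' le_rfl) (hp 1 t le_rfl h ht')

theorem exists_isWindow (M : Dom) (x : M.Pt) : ∃ L R, IsWindow M x L R := by
  cases M with
  | interval a b hab => exact ⟨a, b, isWindow_interval hab x⟩
  | torus => exact ⟨_, _, isWindow_torus x⟩

/-! ### Lower bound of the Modica--Mortola energies -/

/-- The limit energy of a point with value `[y₁, y₂]`. -/
noncomputable def pointCost (M : Dom) (F : ℝ → ℝ) (x : M.Pt) (y₁ y₂ : ℝ) : ℝ :=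
  2 * (potG F y₁ + potG F y₂) - kappa M x * max (potG F y₁) (potG F y₂)

section LowerBound

variable {M : Dom} {F : ℝ → ℝ} {v : ℝ → M.Pt → ℝ} {Ξ : M.Pt → Set ℝ}

/-- Graph convergence keeps `v ε` in a compact set, on which `F` has a positive minimum `c` away
from `1`. Staying away from `1` on `(s, t)` would cost at least `c (t - s) / (2ε)`, which exceeds
`C` for small `ε`. -/
theorem eventually_exists_near_one (hF : Continuous F) (hF0 : ∀ v, 0 ≤ F v)
    (hF1 : ∀ v, F v = 0 ↔ v = 1) (hΞ : IsB Ξ) (hv : GraphTendsto v Ξ) {x : M.Pt} {L R : ℝ}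
    (hW : IsWindow M x L R) {C : ℝ≥0∞} (hC : C ≠ ∞) {s t : ℝ} (hs : L ≤ s) (hst : s < t)
    (ht : t ≤ R) {η : ℝ} (hη : 0 < η) :
    ∀ᶠ ε in 𝓝[>] 0, sMM M F ε (v ε) ≤ C → ∃ τ ∈ Ioo s t, |v ε (M.param τ) - 1| < η := by
  obtain ⟨B, hB0, hB⟩ := hΞ.exists_bound
  obtain ⟨c, hc, hcF⟩ := ((isCompact_Icc (a := -(B + 1)) (b := B + 1)).diff
    (Metric.isOpen_ball (x := (1 : ℝ)) (ε := η))).exists_forall_le' hF.continuousOn (a := 0)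
    fun y hy => (hF0 y).lt_of_ne' fun h => hy.2 (by
      rw [(hF1 y).1 h]; exact Metric.mem_ball_self hη)
  have hpos : 0 < c * (t - s) / (2 * (C.toReal + 1)) := by
    have := sub_pos.2 hst
    have := C.toReal_nonneg
    positivity
  filter_upwards [hv.eventually_near_graph one_pos, Ioo_mem_nhdsGT hpos] with ε hnear hε hle
  by_contra! hcon
  have hεpos := hε.1
  have h1 : ∀ τ ∈ Ioo s t, ENNReal.ofReal c ≤ ENNReal.ofReal (F (v ε (M.param τ))) := by
    intro τ hτ
    refine ENNReal.ofReal_le_ofReal (hcF _ ⟨?_, ?_⟩)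
    · obtain ⟨z, y, hy, -, hvy⟩ := hnear (M.param τ)
      have := abs_le.1 (hB z y hy)
      have := abs_lt.1 hvy
      exact ⟨by linarith, by linarith⟩
    · rw [Metric.mem_ball, Real.dist_eq, not_lt]
      exact hcon τ hτ
  have h2 : ENNReal.ofReal (1 / (2 * ε)) * (ENNReal.ofReal c * ENNReal.ofReal (t - s)) ≤ C := by
    refine le_trans ?_ hle
    refine le_trans ?_ (le_add_of_nonneg_left zero_le)
    gcongr
    have e := hW.lintegral_eq fun x => ENNReal.ofReal (F (v ε x))
    change _ ≤ ∫⁻ t in Ioo M.left M.right, _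
    rw [e]
    calc ENNReal.ofReal c * ENNReal.ofReal (t - s) = ∫⁻ _ in Ioo s t, ENNReal.ofReal c := by
          rw [setLIntegral_const, Real.volume_Ioo]
      _ ≤ ∫⁻ τ in Ioo s t, ENNReal.ofReal (F (v ε (M.param τ))) :=
          setLIntegral_mono' measurableSet_Ioo h1
      _ ≤ _ := lintegral_mono_set (Ioo_subset_Ioo hs ht)
  rw [← ENNReal.ofReal_mul hc.le, ← ENNReal.ofReal_mul (by positivity),
    ENNReal.ofReal_le_iff_le_toReal hC] at h2
  have h3 := hε.2
  rw [lt_div_iff₀ (by have := C.toReal_nonneg; positivity)] at h3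
  rw [one_div, inv_mul_le_iff₀ (by positivity)] at h2
  nlinarith

/-- Otherwise a box around `(x, 1)` misses the closed limit graph, whereas `v ε` takes values near
`1` close to `x`. -/
theorem one_mem_of_frequently (hF : Continuous F) (hF0 : ∀ v, 0 ≤ F v)
    (hF1 : ∀ v, F v = 0 ↔ v = 1) (hΞ : IsB Ξ) (hv : GraphTendsto v Ξ) {C : ℝ≥0∞} (hC : C ≠ ∞)
    (hfreq : ∃ᶠ ε in 𝓝[>] 0, sMM M F ε (v ε) ≤ C) (x : M.Pt) : 1 ∈ Ξ x := by
  by_contra hx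
  obtain ⟨δ, hδ, hbox⟩ := hΞ.exists_forall_notMem hx
  obtain ⟨L, R, hW⟩ := exists_isWindow M x
  have hst : max L (M.coord x - δ / 2) < min R (M.coord x + δ / 2) :=
    max_lt (lt_min hW.lt (by linarith [hW.coord_mem.1]))
      (lt_min (by linarith [hW.coord_mem.2]) (by linarith))
  have h1 := eventually_exists_near_one hF hF0 hF1 hΞ hv hW hC (le_max_left _ _) hst
    (min_le_left _ _) (half_pos hδ)
  obtain ⟨ε, hle, h2, h3⟩ := (hfreq.and_eventually
    (h1.and (hv.eventually_near_graph (half_pos hδ)))).exists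
  obtain ⟨τ, hτ, hτ1⟩ := h2 hle
  obtain ⟨z, y, hy, hd, hvy⟩ := h3 (M.param τ)
  have hτc : |τ - M.coord x| < δ / 2 := by
    have e1 := (le_max_right _ _).trans_lt hτ.1
    have e2 := hτ.2.trans_le (min_le_right _ _)
    rw [abs_lt]
    exact ⟨by linarith, by linarith⟩
  have hdx : dist (M.param τ) x < δ / 2 := by
    have := M.dist_param_le τ (M.coord x)
    rw [M.param_coord] at this
    exact this.trans_lt hτc
  refine hbox z y ?_ ?_ hy
  · rw [dist_comm] at hd
    exact (dist_triangle z (M.param τ) x).trans_lt (by linarith)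
  · have := abs_sub_le y (v ε (M.param τ)) 1
    rw [abs_sub_comm y (v ε _)] at this
    linarith

/-- By the intermediate value theorem `v ε` crosses any intermediate level near `x`, so a missing
level would contradict the closedness of the limit graph. -/
theorem GraphTendsto.ordConnected (hH1 : ∀ ε ∈ Ioo (0 : ℝ) 1, IsH1 M (v ε)) (hΞ : IsB Ξ)
    (hv : GraphTendsto v Ξ) (x : M.Pt) : (Ξ x).OrdConnected := by
  refine ⟨fun y₁ hy₁ y₂ hy₂ y hy => ?_⟩
  by_contra hx
  have hlt1 : y₁ < y := hy.1.lt_of_ne fun h => hx (h ▸ hy₁)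
  have hlt2 : y < y₂ := hy.2.lt_of_ne fun h => hx (h ▸ hy₂)
  obtain ⟨δ, hδ, hbox⟩ := hΞ.exists_forall_notMem hx
  set r := min (δ / 2) (min (y - y₁) (y₂ - y)) with hr
  have hr0 : 0 < r := lt_min (half_pos hδ) (lt_min (sub_pos.2 hlt1) (sub_pos.2 hlt2))
  have hr1 : r ≤ δ / 2 := min_le_left _ _
  have hr2 : r ≤ y - y₁ := (min_le_right _ _).trans (min_le_left _ _)
  have hr3 : r ≤ y₂ - y := (min_le_right _ _).trans (min_le_right _ _)
  obtain ⟨ε, hε, h1, h2⟩ := ((eventually_mem_set.2 (Ioo_mem_nhdsGT (zero_lt_one (α := ℝ)))).and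
    ((hv.eventually_graph_near hr0).and (hv.eventually_near_graph hr0))).exists
  obtain ⟨x₁, hx₁, hv₁⟩ := h1 x y₁ hy₁
  obtain ⟨x₂, hx₂, hv₂⟩ := h1 x y₂ hy₂
  obtain ⟨t₁, -, ht₁, rfl⟩ := Dom.exists_param_eq_of_dist_lt hx₁
  obtain ⟨t₂, -, ht₂, rfl⟩ := Dom.exists_param_eq_of_dist_lt hx₂
  have hcont : Continuous (v ε ∘ M.param) := (hH1 ε hε).continuous.comp M.continuous_param
  have hmem : y ∈ uIcc ((v ε ∘ M.param) t₁) ((v ε ∘ M.param) t₂) := by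
    refine Icc_subset_uIcc ⟨?_, ?_⟩
    · have := (abs_lt.1 hv₁).2
      simp only [Function.comp_apply]
      linarith
    · have := (abs_lt.1 hv₂).1
      simp only [Function.comp_apply]
      linarith
  obtain ⟨τ, hτ, hτy⟩ := intermediate_value_uIcc hcont.continuousOn hmem
  have hτc : |τ - M.coord x| < r := by
    rw [abs_lt] at *
    rcases le_total t₁ t₂ with h | h
    · rw [uIcc_of_le h] at hτ
      exact ⟨by linarith [hτ.1], by linarith [hτ.2]⟩
    · rw [uIcc_of_ge h] at hτ
      exact ⟨by linarith [hτ.1], by linarith [hτ.2]⟩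
  have hdx : dist (M.param τ) x < r := by
    have := M.dist_param_le τ (M.coord x)
    rw [M.param_coord] at this
    exact this.trans_lt hτc
  obtain ⟨z, w, hw, hd, hvw⟩ := h2 (M.param τ)
  refine hbox z w ?_ ?_ hw
  · rw [dist_comm] at hd
    exact (dist_triangle z (M.param τ) x).trans_lt (by linarith)
  · rw [← hτy, abs_sub_comm]
    exact hvw.trans_le (by linarith)

end LowerBound

/-- Here `h₁` and `h₂` stand for `H` near `ξ⁻` and `ξ⁺`, where `H` is `-G₁` and `G₂`. Each of the
three legs loses at most `2 * e`, and both orders of visiting have the same total length. -/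
theorem two_mul_add_sub_le {G₁ G₂ h₁ h₂ hp hq ha hb e : ℝ} (h1 : |h₁ + G₁| ≤ e)
    (h2 : |h₂ - G₂| ≤ e) (ha' : |ha| ≤ e) (hb' : |hb| ≤ e)
    (h : (hp = h₁ ∧ hq = h₂) ∨ (hp = h₂ ∧ hq = h₁)) :
    2 * (G₁ + G₂) - 6 * e ≤ |hp - ha| + |hq - hp| + |hb - hq| := by
  rw [abs_le] at *
  rcases h with ⟨rfl, rfl⟩ | ⟨rfl, rfl⟩
  · linarith [neg_abs_le (hp - ha), le_abs_self (hq - hp), neg_abs_le (hb - hq)]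
  · linarith [le_abs_self (hp - ha), neg_abs_le (hq - hp), le_abs_self (hb - hq)]

/-- Without the first leg the path starts at one of the two values and saves the `G` of that value,
hence at most the maximum. -/
theorem two_mul_add_sub_max_le {G₁ G₂ h₁ h₂ hp hq hb e : ℝ} (h1 : |h₁ + G₁| ≤ e)
    (h2 : |h₂ - G₂| ≤ e) (hb' : |hb| ≤ e)
    (h : (hp = h₁ ∧ hq = h₂) ∨ (hp = h₂ ∧ hq = h₁)) :
    2 * (G₁ + G₂) - max G₁ G₂ - 6 * e ≤ |hq - hp| + |hb - hq| := by
  have he : 0 ≤ e := (abs_nonneg _).trans hb'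
  rw [abs_le] at *
  have m1 := le_max_left G₁ G₂
  have m2 := le_max_right G₁ G₂
  rcases h with ⟨rfl, rfl⟩ | ⟨rfl, rfl⟩
  · linarith [le_abs_self (hq - hp), neg_abs_le (hb - hq)]
  · linarith [neg_abs_le (hq - hp), le_abs_self (hb - hq)]

section LowerBound

variable {M : Dom} {F : ℝ → ℝ} {v : ℝ → M.Pt → ℝ} {Ξ : M.Pt → Set ℝ}

theorem IsWindow.chain_le {x : M.Pt} {L R : ℝ} (hW : IsWindow M x L R) (hF : Continuous F)
    (hF0 : ∀ v, 0 ≤ F v) {ε : ℝ} (hε : 0 < ε) {w : M.Pt → ℝ} (hw : IsH1 M w) {a p q b : ℝ}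
    (hLa : L ≤ a) (hap : a ≤ p) (hpq : p ≤ q) (hqb : q ≤ b) (hbR : b ≤ R) :
    ENNReal.ofReal (|primH F (w (M.param p)) - primH F (w (M.param a))| +
      |primH F (w (M.param q)) - primH F (w (M.param p))| +
      |primH F (w (M.param b)) - primH F (w (M.param q))|) ≤
        ∫⁻ τ in Ioo a b, density F ε (w ∘ M.param) τ := by
  rw [ENNReal.ofReal_add (by positivity) (by positivity),
    ENNReal.ofReal_add (by positivity) (by positivity)]
  have h1 := hW.primH_sub_le hF hF0 hε hw hLa hap (by linarith)
  have h2 := hW.primH_sub_le hF hF0 hε hw (s := p) (t := q) (by linarith) hpq (by linarith)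
  have h3 := hW.primH_sub_le hF hF0 hε hw (s := q) (t := b) (by linarith) hqb hbR
  exact (add_le_add ((add_le_add h1 h2).trans (setLIntegral_Ioo_add_le hap hpq _)) h3).trans
    (setLIntegral_Ioo_add_le (hap.trans hpq) hqb _)

theorem eventually_pointCost_le (hF : Continuous F) (hF0 : ∀ v, 0 ≤ F v)
    (hF1 : ∀ v, F v = 0 ↔ v = 1) (hH1 : ∀ ε ∈ Ioo (0 : ℝ) 1, IsH1 M (v ε)) (hΞ : IsB Ξ)
    (hv : GraphTendsto v Ξ) {C : ℝ≥0∞} (hC : C ≠ ∞) {x : M.Pt} {y₁ y₂ : ℝ} (hy₁ : y₁ ∈ Ξ x)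
    (hy₂ : y₂ ∈ Ξ x) (h1 : y₁ ≤ 1) (h2 : 1 ≤ y₂) {ρ η : ℝ} (hρ : 0 < ρ) (hη : 0 < η) :
    ∀ᶠ ε in 𝓝[>] 0, sMM M F ε (v ε) ≤ C → ENNReal.ofReal (pointCost M F x y₁ y₂ - η) ≤
      ∫⁻ t in Ioo M.left M.right ∩ M.param ⁻¹' Metric.ball x ρ,
        density F ε (v ε ∘ M.param) t := by
  obtain ⟨L, R, hW⟩ := exists_isWindow M x
  set c := M.coord x with hc
  obtain ⟨δ₀, hδ₀, hδ₀'⟩ := hW.mem_of_near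
  have hcont : ∀ y : ℝ, ∃ δ > 0, ∀ z, |z - y| < δ → |primH F z - primH F y| ≤ η / 6 := by
    intro y
    obtain ⟨δ, hδ, h⟩ := Metric.continuous_iff.1 (continuous_primH hF) y (η / 6) (by positivity)
    exact ⟨δ, hδ, fun z hz => (h z hz).le⟩
  obtain ⟨δ₁, hδ₁, hH₁⟩ := hcont y₁
  obtain ⟨δ₂, hδ₂, hH₂⟩ := hcont y₂
  obtain ⟨δ₃, hδ₃, hH₃⟩ := hcont 1
  rw [primH_one] at hH₃
  rw [primH_of_le_one hF h1] at hH₁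
  rw [primH_of_one_le hF h2] at hH₂
  obtain ⟨r, hr0, hrρ, hrδ, hrR, hrL⟩ : ∃ r > 0, r ≤ ρ ∧ r ≤ δ₀ ∧ (c < R → c + r ≤ R) ∧
      (L < c → L ≤ c - r) := by
    have key : ∀ d : ℝ, ∃ d' > 0, 0 < d → d' ≤ d := fun d => by
      by_cases h : 0 < d
      · exact ⟨d, h, fun _ => le_rfl⟩
      · exact ⟨1, one_pos, fun h' => absurd h' h⟩
    obtain ⟨d₁, hd₁, hd₁'⟩ := key (R - c)
    obtain ⟨d₂, hd₂, hd₂'⟩ := key (c - L)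
    refine ⟨min (min ρ δ₀) (min d₁ d₂), lt_min (lt_min hρ hδ₀) (lt_min hd₁ hd₂),
      (min_le_left _ _).trans (min_le_left _ _), (min_le_left _ _).trans (min_le_right _ _),
      fun h => ?_, fun h => ?_⟩
    · have := hd₁' (sub_pos.2 h)
      linarith [(min_le_right (min ρ δ₀) (min d₁ d₂)).trans (min_le_left _ _)]
    · have := hd₂' (sub_pos.2 h)
      linarith [(min_le_right (min ρ δ₀) (min d₁ d₂)).trans (min_le_right _ _)]
  have hr'0 : 0 < min (r / 2) (min δ₁ δ₂) := lt_min (half_pos hr0) (lt_min hδ₁ hδ₂)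
  -- Values near `1` are looked for at distances between `r / 2` and `r`, the extreme values within
  -- `r / 2`. The order of the points along the path is then automatic.
  have hright : ∀ᶠ ε in 𝓝[>] 0, c < R → sMM M F ε (v ε) ≤ C →
      ∃ b ∈ Ioo (c + r / 2) (c + r), |v ε (M.param b) - 1| < δ₃ := by
    by_cases h : c < R
    · filter_upwards [eventually_exists_near_one hF hF0 hF1 hΞ hv hW hC (s := c + r / 2)
        (t := c + r) (by linarith [hW.coord_mem.1]) (by linarith) (hrR h) hδ₃] with ε hε _
      exact hε
    · exact Eventually.of_forall fun ε h' => absurd h' h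
  have hleft : ∀ᶠ ε in 𝓝[>] 0, L < c → sMM M F ε (v ε) ≤ C →
      ∃ b ∈ Ioo (c - r) (c - r / 2), |v ε (M.param b) - 1| < δ₃ := by
    by_cases h : L < c
    · filter_upwards [eventually_exists_near_one hF hF0 hF1 hΞ hv hW hC (s := c - r)
        (t := c - r / 2) (hrL h) (by linarith) (by linarith [hW.coord_mem.2]) hδ₃] with ε hε _
      exact hε
    · exact Eventually.of_forall fun ε h' => absurd h' h
  filter_upwards [hright, hleft, hv.eventually_graph_near hr'0,
    Ioo_mem_nhdsGT (zero_lt_one (α := ℝ))] with ε hR hL hg hε hle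
  have hsub : ∀ a b, L ≤ a → b ≤ R → c - r ≤ a → b ≤ c + r →
      ∫⁻ τ in Ioo a b, density F ε (v ε ∘ M.param) τ ≤
        ∫⁻ t in Ioo M.left M.right ∩ M.param ⁻¹' Metric.ball x ρ,
          density F ε (v ε ∘ M.param) t := by
    intro a b ha hb ha' hb'
    rw [hW.lintegral_density_eq _ Metric.isOpen_ball.measurableSet]
    refine lintegral_mono_set fun τ hτ => ⟨⟨ha.trans_lt hτ.1, hτ.2.trans_le hb⟩, ?_⟩
    have e := M.dist_param_le τ (M.coord x)
    rw [M.param_coord] at e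
    refine (e.trans_lt (abs_lt.2 ⟨?_, ?_⟩)).trans_le hrρ
    · linarith [hτ.1]
    · linarith [hτ.2]
  obtain ⟨x₁, hx₁, hv₁⟩ := hg x y₁ hy₁
  obtain ⟨x₂, hx₂, hv₂⟩ := hg x y₂ hy₂
  obtain ⟨t₁, hc₁, ht₁, rfl⟩ := Dom.exists_param_eq_of_dist_lt hx₁
  obtain ⟨t₂, hc₂, ht₂, rfl⟩ := Dom.exists_param_eq_of_dist_lt hx₂
  have e₁ := hH₁ _ (hv₁.trans_le ((min_le_right _ _).trans (min_le_left _ _)))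
  have e₂ := hH₂ _ (hv₂.trans_le ((min_le_right _ _).trans (min_le_right _ _)))
  rw [sub_neg_eq_add] at e₁
  replace ht₁ := ht₁.trans_le (min_le_left _ _)
  replace ht₂ := ht₂.trans_le (min_le_left _ _)
  have hm₁ := hδ₀' t₁ hc₁ (by linarith)
  have hm₂ := hδ₀' t₂ hc₂ (by linarith)
  obtain ⟨p, q, hpq, hp, hq, hpc, hqc, hor⟩ : ∃ p q, p ≤ q ∧ p ∈ Icc L R ∧ q ∈ Icc L R ∧
      |p - c| < r / 2 ∧ |q - c| < r / 2 ∧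
      ((primH F (v ε (M.param p)) = primH F (v ε (M.param t₁)) ∧
        primH F (v ε (M.param q)) = primH F (v ε (M.param t₂))) ∨
      (primH F (v ε (M.param p)) = primH F (v ε (M.param t₂)) ∧
        primH F (v ε (M.param q)) = primH F (v ε (M.param t₁)))) := by
    rcases le_total t₁ t₂ with h | h
    · exact ⟨t₁, t₂, h, hm₁, hm₂, ht₁, ht₂, Or.inl ⟨rfl, rfl⟩⟩
    · exact ⟨t₂, t₁, h, hm₂, hm₁, ht₂, ht₁, Or.inr ⟨rfl, rfl⟩⟩
  rw [abs_lt] at hpc hqc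
  have hG₁ := potG_nonneg F y₁
  have hmax : 0 ≤ max (potG F y₁) (potG F y₂) := hG₁.trans (le_max_left _ _)
  have hcost : pointCost M F x y₁ y₂ ≤ 2 * (potG F y₁ + potG F y₂) := by
    have : 0 ≤ kappa M x := by
      unfold kappa
      split_ifs <;> norm_num
    unfold pointCost
    nlinarith [mul_nonneg this hmax]
  have hcost' : ¬ (L < c ∧ c < R) → pointCost M F x y₁ y₂ =
      2 * (potG F y₁ + potG F y₂) - max (potG F y₁) (potG F y₂) := by
    intro h
    have : kappa M x = 1 := if_neg fun hi => h (hW.coord_mem_of_inner hi)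
    rw [pointCost, this, one_mul]
  have hw := hH1 ε hε
  by_cases hcR : c < R
  · obtain ⟨b, hb, hb1⟩ := hR hcR hle
    have eb := hH₃ _ hb1
    rw [sub_zero] at eb
    have hbR : b ≤ R := hb.2.le.trans (hrR hcR)
    by_cases hcL : L < c
    · obtain ⟨a, ha, ha1⟩ := hL hcL hle
      have ea := hH₃ _ ha1
      rw [sub_zero] at ea
      have hLa : L ≤ a := (hrL hcL).trans ha.1.le
      refine le_trans (ENNReal.ofReal_le_ofReal ?_) ((hW.chain_le hF hF0 hε.1 hw hLa
        (by linarith [ha.2]) hpq (by linarith [hb.1]) hbR).trans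
          (hsub a b hLa hbR ha.1.le hb.2.le))
      linarith [two_mul_add_sub_le e₁ e₂ ea eb hor]
    · refine le_trans (ENNReal.ofReal_le_ofReal ?_) ((hW.chain_le hF hF0 hε.1 hw hp.1
        le_rfl hpq (by linarith [hb.1]) hbR).trans
          (hsub p b hp.1 hbR (by linarith) hb.2.le))
      rw [hcost' fun h => hcL h.1, sub_self, abs_zero, zero_add]
      linarith [two_mul_add_sub_max_le e₁ e₂ eb hor]
  · have hcL : L < c := hW.lt.trans_le (not_lt.1 hcR)
    obtain ⟨a, ha, ha1⟩ := hL hcL hle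
    have ea := hH₃ _ ha1
    rw [sub_zero] at ea
    have hLa : L ≤ a := (hrL hcL).trans ha.1.le
    refine le_trans (ENNReal.ofReal_le_ofReal ?_) ((hW.chain_le hF hF0 hε.1 hw hLa
      (by linarith [ha.2]) hpq le_rfl hq.2).trans
        (hsub a q hLa hq.2 ha.1.le (by linarith)))
    rw [hcost' fun h => hcR h.2, sub_self (primH F (v ε (M.param q))), abs_zero, add_zero]
    -- The path ends at the right end of the window here, so the estimate is applied to the reversed
    -- path.
    have key := two_mul_add_sub_max_le e₁ e₂ ea (hor.symm.imp And.symm And.symm)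
    rw [abs_sub_comm (primH F (v ε (M.param p))), abs_sub_comm (primH F (v ε (M.param a)))] at key
    linarith

theorem exists_pos_two_mul_le_dist {ι X : Type*} [MetricSpace X] (s : Finset ι) {p : ι → X}
    (hp : Set.InjOn p s) :
    ∃ ρ > 0, ∀ i ∈ s, ∀ j ∈ s, i ≠ j → 2 * ρ ≤ dist (p i) (p j) := by
  have : ∀ᶠ ρ : ℝ in 𝓝[>] 0, ∀ i ∈ s, ∀ j ∈ s, i ≠ j → 2 * ρ ≤ dist (p i) (p j) := by
    rw [eventually_all_finset]
    intro i hi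
    rw [eventually_all_finset]
    intro j hj
    by_cases hij : i = j
    · exact Eventually.of_forall fun _ h => absurd hij h
    · filter_upwards [Ioo_mem_nhdsGT (half_pos (dist_pos.2 fun h => hij (hp hi hj h)))] with ρ hρ _
      linarith [hρ.2]
  obtain ⟨ρ, h, hρ⟩ := (this.and self_mem_nhdsWithin).exists
  exact ⟨ρ, hρ, h⟩

/-- Balls around the finitely many points are disjoint, and each carries almost its own cost. A
single `ε` with energy at most `C` for which all local bounds hold is enough, so a bound along a
subsequence suffices. -/
theorem sum_pointCost_le (hF : Continuous F) (hF0 : ∀ v, 0 ≤ F v)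
    (hF1 : ∀ v, F v = 0 ↔ v = 1) (hH1 : ∀ ε ∈ Ioo (0 : ℝ) 1, IsH1 M (v ε)) (hΞ : IsB Ξ)
    (hv : GraphTendsto v Ξ) {C : ℝ≥0∞} (hC : C ≠ ∞)
    (hfreq : ∃ᶠ ε in 𝓝[>] 0, sMM M F ε (v ε) ≤ C) {y₁ y₂ : M.Pt → ℝ} (S : Finset M.Pt)
    (hy₁ : ∀ x ∈ S, y₁ x ∈ Ξ x) (hy₂ : ∀ x ∈ S, y₂ x ∈ Ξ x) (h1 : ∀ x ∈ S, y₁ x ≤ 1)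
    (h2 : ∀ x ∈ S, 1 ≤ y₂ x) :
    ∑ x ∈ S, ENNReal.ofReal (pointCost M F x (y₁ x) (y₂ x)) ≤ C := by
  obtain ⟨ρ, hρ, hdisj⟩ := exists_pos_two_mul_le_dist S (Function.injective_id.injOn)
  have key : ∀ η : ℝ, 0 < η → ∑ x ∈ S, ENNReal.ofReal (pointCost M F x (y₁ x) (y₂ x)) ≤
      C + S.card * ENNReal.ofReal η := by
    intro η hη
    have hev : ∀ᶠ ε in 𝓝[>] 0, ∀ x ∈ S, sMM M F ε (v ε) ≤ C →
        ENNReal.ofReal (pointCost M F x (y₁ x) (y₂ x) - η) ≤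
        ∫⁻ t in Ioo M.left M.right ∩ M.param ⁻¹' Metric.ball x ρ,
          density F ε (v ε ∘ M.param) t := by
      rw [eventually_all_finset]
      exact fun x hx => eventually_pointCost_le hF hF0 hF1 hH1 hΞ hv hC (hy₁ x hx) (hy₂ x hx)
        (h1 x hx) (h2 x hx) hρ hη
    obtain ⟨ε, hle, hε⟩ := (hfreq.and_eventually hev).exists
    calc ∑ x ∈ S, ENNReal.ofReal (pointCost M F x (y₁ x) (y₂ x))
        ≤ ∑ x ∈ S, (ENNReal.ofReal (pointCost M F x (y₁ x) (y₂ x) - η) + ENNReal.ofReal η) := by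
          refine Finset.sum_le_sum fun x _ => ?_
          refine le_trans (ENNReal.ofReal_le_ofReal ?_) ENNReal.ofReal_add_le
          linarith
      _ = ∑ x ∈ S, ENNReal.ofReal (pointCost M F x (y₁ x) (y₂ x) - η) +
          S.card * ENNReal.ofReal η := by
          rw [Finset.sum_add_distrib, Finset.sum_const, nsmul_eq_mul]
      _ ≤ C + S.card * ENNReal.ofReal η := by
          gcongr
          refine le_trans (Finset.sum_le_sum fun x hx => hε x hx hle) ?_
          refine le_trans ?_ hle
          rw [sMM_eq_lintegral_density, ← lintegral_biUnion_finset]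
          · exact lintegral_mono_set (iUnion₂_subset fun x _ => inter_subset_left)
          · intro x hx y hy hxy
            refine Set.disjoint_left.2 fun t ht ht' => ?_
            have e1 : dist (M.param t) x < ρ := ht.2
            have e2 : dist (M.param t) y < ρ := ht'.2
            have e3 : 2 * ρ ≤ dist x y := hdisj x hx y hy hxy
            have e4 := dist_triangle_left x y (M.param t)
            linarith
          · exact fun x _ => measurableSet_Ioo.inter
              (M.continuous_param.measurable Metric.isOpen_ball.measurableSet)
  have h4 : Tendsto (fun η : ℝ => C + S.card * ENNReal.ofReal η) (𝓝[>] 0) (𝓝 (C + 0)) := by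
    refine tendsto_const_nhds.add ?_
    have h5 : Tendsto (fun δ : ℝ => ENNReal.ofReal δ) (𝓝[>] 0) (𝓝 0) := by
      have := (ENNReal.continuous_ofReal.tendsto 0).mono_left (nhdsWithin_le_nhds (s := Ioi 0))
      rwa [ENNReal.ofReal_zero] at this
    have := ENNReal.Tendsto.const_mul h5 (Or.inr (ENNReal.natCast_ne_top S.card))
    rwa [mul_zero] at this
  rw [add_zero] at h4
  exact ge_of_tendsto h4 (eventually_nhdsWithin_of_forall fun η hη => key η hη)

/-- The maximum is at most the sum, so even at an end point the cost is at least the sum of the two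
`G`s. -/
theorem pointCost_pos (hF : Continuous F) (hF0 : ∀ v, 0 ≤ F v) (hF1 : ∀ v, F v = 0 ↔ v = 1)
    (x : M.Pt) {y₁ y₂ : ℝ} (h : y₁ ≠ 1 ∨ y₂ ≠ 1) : 0 < pointCost M F x y₁ y₂ := by
  have h1 := potG_nonneg F y₁
  have h2 := potG_nonneg F y₂
  have h3 : 0 < potG F y₁ + potG F y₂ := by
    rcases h with h | h
    · linarith [potG_pos hF hF0 hF1 h]
    · linarith [potG_pos hF hF0 hF1 h]
  have h4 : max (potG F y₁) (potG F y₂) ≤ potG F y₁ + potG F y₂ :=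
    max_le (by linarith) (by linarith)
  unfold pointCost kappa
  split_ifs <;> linarith

/-- Compactness and lower bound for graph convergent sequences of bounded energy. -/
theorem isA0_and_sMM0_le (hF : Continuous F) (hF0 : ∀ v, 0 ≤ F v)
    (hF1 : ∀ v, F v = 0 ↔ v = 1) (hH1 : ∀ ε ∈ Ioo (0 : ℝ) 1, IsH1 M (v ε)) (hΞ : IsB Ξ)
    (hv : GraphTendsto v Ξ) {C : ℝ≥0∞} (hC : C ≠ ∞)
    (hfreq : ∃ᶠ ε in 𝓝[>] 0, sMM M F ε (v ε) ≤ C) : IsA0 Ξ ∧ sMM0 M F Ξ ≤ C := by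
  have hone := one_mem_of_frequently hF hF0 hF1 hΞ hv hC hfreq
  have hcpt := hΞ.isCompact_value
  have hIcc : ∀ x, Ξ x = Icc (sInf (Ξ x)) (sSup (Ξ x)) := fun x =>
    eq_Icc_of_connected_compact ⟨⟨1, hone x⟩, (hv.ordConnected hH1 hΞ x).isPreconnected⟩ (hcpt x)
  have hle : ∀ x, sInf (Ξ x) ≤ 1 ∧ 1 ≤ sSup (Ξ x) := fun x => by
    have := hone x
    rw [hIcc x] at this
    exact this
  -- The sum runs over all points of `M`. Its finiteness is what makes the set where `Ξ` differs
  -- from `{1}` countable.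
  have hsum : ∑' x, ENNReal.ofReal (pointCost M F x (sInf (Ξ x)) (sSup (Ξ x))) ≤ C := by
    rw [ENNReal.tsum_eq_iSup_sum]
    exact iSup_le fun S => sum_pointCost_le hF hF0 hF1 hH1 hΞ hv hC hfreq S
      (fun x _ => (hcpt x).sInf_mem ⟨1, hone x⟩) (fun x _ => (hcpt x).sSup_mem ⟨1, hone x⟩)
      (fun x _ => (hle x).1) fun x _ => (hle x).2
  have hA : IsA0 Ξ := by
    refine ⟨hΞ, fun x => ⟨_, _, (hle x).1.trans (hle x).2, hIcc x⟩, ?_⟩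
    refine (Summable.countable_support_ennreal (ne_top_of_le_ne_top hC hsum)).mono fun x hx => ?_
    rw [Function.mem_support]
    refine (ENNReal.ofReal_pos.2 (pointCost_pos hF hF0 hF1 x ?_)).ne'
    by_contra! h
    refine hx ?_
    rw [hIcc x, h.1, h.2, Icc_self]
  refine ⟨hA, ?_⟩
  rw [sMM0, if_pos hA]
  exact (ENNReal.tsum_comp_le_tsum_of_injective Subtype.val_injective
    fun x => ENNReal.ofReal (pointCost M F x (sInf (Ξ x)) (sSup (Ξ x)))).trans hsum

theorem sMM0_le_liminf (hF : Continuous F) (hF0 : ∀ v, 0 ≤ F v)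
    (hF1 : ∀ v, F v = 0 ↔ v = 1) (hH1 : ∀ ε ∈ Ioo (0 : ℝ) 1, IsH1 M (v ε)) (hΞ : IsB Ξ)
    (hv : GraphTendsto v Ξ) :
    sMM0 M F Ξ ≤ liminf (fun ε => sMM M F ε (v ε)) (𝓝[>] 0) := by
  refine le_of_forall_gt_imp_ge_of_dense fun C hC => ?_
  rcases eq_or_ne C ∞ with rfl | hC'
  · exact le_top
  exact (isA0_and_sMM0_le hF hF0 hF1 hH1 hΞ hv hC' ((frequently_lt_of_liminf_lt
    (by isBoundedDefault) hC).mono fun _ h => h.le)).2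

end LowerBound

/-! ### The liminf inequality -/

section IsA0

variable {M : Dom} {Ξ : M.Pt → Set ℝ}

/-- The points with value `{1}` are dense and the graph is closed. -/
theorem IsA0.one_mem (hΞ : IsA0 Ξ) (x : M.Pt) : 1 ∈ Ξ x := by
  by_contra hx
  obtain ⟨δ, hδ, hbox⟩ := hΞ.isB.exists_forall_notMem hx
  obtain ⟨s, t, hst, hs, ht, hr⟩ := Dom.exists_subinterval x hδ
  obtain ⟨r, hrst, hrC⟩ := Dom.exists_param_notMem_of_countable hΞ.countable hst hs ht
  have h1 : Ξ (M.param r) = {1} := not_not.1 hrC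
  refine hbox (M.param r) 1 ?_ (by simpa using hδ) (by rw [h1]; rfl)
  have := M.dist_param_le r (M.coord x)
  rw [M.param_coord] at this
  exact this.trans_lt (hr r hrst)

theorem IsA0.eq_Icc (hΞ : IsA0 Ξ) (x : M.Pt) : Ξ x = Icc (sInf (Ξ x)) (sSup (Ξ x)) := by
  obtain ⟨p, q, hpq, h⟩ := hΞ.isInterval x
  rw [h, csInf_Icc hpq, csSup_Icc hpq]

theorem IsA0.sInf_le_one (hΞ : IsA0 Ξ) (x : M.Pt) : sInf (Ξ x) ≤ 1 := by
  have := hΞ.one_mem x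
  rw [hΞ.eq_Icc x] at this
  exact this.1

theorem IsA0.one_le_sSup (hΞ : IsA0 Ξ) (x : M.Pt) : 1 ≤ sSup (Ξ x) := by
  have := hΞ.one_mem x
  rw [hΞ.eq_Icc x] at this
  exact this.2

theorem IsA0.sInf_mem (hΞ : IsA0 Ξ) (x : M.Pt) : sInf (Ξ x) ∈ Ξ x := by
  rw [hΞ.eq_Icc x, csInf_Icc ((hΞ.sInf_le_one x).trans (hΞ.one_le_sSup x))]
  exact left_mem_Icc.2 ((hΞ.sInf_le_one x).trans (hΞ.one_le_sSup x))

theorem IsA0.eq_singleton (hΞ : IsA0 Ξ) {x : M.Pt} (hx : x ∉ exceptional Ξ) : Ξ x = {1} :=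
  (Set.not_nontrivial_iff.1 hx).eq_singleton_of_mem (hΞ.one_mem x)

theorem IsA0.countable_exceptional (hΞ : IsA0 Ξ) : (exceptional Ξ).Countable :=
  hΞ.countable.mono fun x hx => by
    have h' : (Ξ x).Nontrivial := hx
    exact fun h => Set.not_nontrivial_singleton (h ▸ h')

/-- Every such point has `ξ⁻ ≤ 1 / 2` and hence contributes at least `G(1/2) > 0` to a convergent
sum. -/
theorem IsA0.finite_of_sMM0_ne_top {F : ℝ → ℝ} (hF : Continuous F) (hF0 : ∀ v, 0 ≤ F v)
    (hF1 : ∀ v, F v = 0 ↔ v = 1) (hΞ : IsA0 Ξ) (h : sMM0 M F Ξ ≠ ∞) :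
    {x | ∃ y ∈ Ξ x, |y| ≤ 1 / 2}.Finite := by
  rw [sMM0, if_pos hΞ] at h
  have hpos : 0 < potG F (1 / 2) := potG_pos hF hF0 hF1 (by norm_num)
  refine ((ENNReal.finite_const_le_of_tsum_ne_top h (ENNReal.ofReal_pos.2 hpos).ne').image
    Subtype.val).subset ?_
  rintro x ⟨y, hy, hy2⟩
  have hy3 : y ≤ 1 / 2 := (le_abs_self y).trans hy2
  have hex : x ∈ exceptional Ξ := ⟨y, hy, 1, hΞ.one_mem x, by linarith⟩
  refine ⟨⟨x, hex⟩, ?_, rfl⟩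
  refine ENNReal.ofReal_le_ofReal ?_
  have h1 : sInf (Ξ x) ≤ 1 / 2 := by
    rw [hΞ.eq_Icc x] at hy
    exact hy.1.trans hy3
  have h2 := monotone_primH hF h1
  rw [primH_of_le_one hF (hΞ.sInf_le_one x), primH_of_le_one hF (by norm_num)] at h2
  have h3 := potG_nonneg F (sInf (Ξ x))
  have h4 := potG_nonneg F (sSup (Ξ x))
  have h5 : max (potG F (sInf (Ξ x))) (potG F (sSup (Ξ x))) ≤
      potG F (sInf (Ξ x)) + potG F (sSup (Ξ x)) := max_le (by linarith) (by linarith)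
  simp only [kappa]
  split_ifs <;> linarith

end IsA0

theorem const_mul_liminf_add_liminf_le {f : Filter ℝ} [f.NeBot] {c : ℝ≥0∞} (hc : c ≠ ∞)
    (u v : ℝ → ℝ≥0∞) :
    c * liminf u f + liminf v f ≤ liminf (fun ε => c * u ε + v ε) f := by
  have h1 : c * liminf u f = liminf (fun ε => c * u ε) f :=
    Monotone.map_liminf_of_continuousAt (f := fun z => c * z)
      (fun a b h => mul_le_mul_right h c) u
      (ENNReal.continuous_const_mul hc).continuousAt
  rw [h1]
  rcases eq_or_ne (liminf (fun ε => c * u ε) f) 0 with h0 | h0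
  · rw [h0, zero_add]
    exact liminf_le_liminf (Eventually.of_forall fun ε => le_add_of_nonneg_left zero_le)
  rcases eq_or_ne (liminf v f) 0 with h0' | h0'
  · rw [h0', add_zero]
    exact liminf_le_liminf (Eventually.of_forall fun ε => le_add_of_nonneg_right zero_le)
  refine le_of_forall_lt fun b hb => ?_
  obtain ⟨y, hy, z, hz, hyz⟩ := ENNReal.exists_lt_add_of_lt_add hb h0 h0'
  refine hyz.trans_le (le_liminf_of_le (by isBoundedDefault) ?_)
  filter_upwards [eventually_lt_of_lt_liminf hy, eventually_lt_of_lt_liminf hz] with ε h2 h3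
  exact add_le_add h2.le h3.le

theorem energy0_le_liminf {M : Dom} {F : ℝ → ℝ} (hF : Continuous F) (hF0 : ∀ v, 0 ≤ F v)
    (hF1 : ∀ v, F v = 0 ↔ v = 1) {σ : ℝ} (hσ : 0 ≤ σ) {v u : ℝ → M.Pt → ℝ}
    {Ξ : M.Pt → Set ℝ} {u₀ : M.Pt → ℝ} (hH1 : ∀ ε ∈ Ioo (0 : ℝ) 1, IsH1 M (v ε))
    (hu : ∀ ε ∈ Ioo (0 : ℝ) 1, IsL1 M (u ε)) (hΞ : IsB Ξ) (hu₀ : IsL1 M u₀)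
    (hv : GraphTendsto v Ξ) (hut : L1Tendsto M u u₀) (hBV : σ = 0 → IsBV M u₀)
    (hmin : IsBV M u₀ → ∀ x ∈ jumpSet M u₀ ∩ exceptional Ξ, 0 ≤ sInf (Ξ x)) :
    energy0 M F σ u₀ Ξ ≤ liminf (fun ε => energy M F σ ε (u ε) (v ε)) (𝓝[>] 0) := by
  rcases eq_or_ne (liminf (fun ε => energy M F σ ε (u ε) (v ε)) (𝓝[>] 0)) ∞ with htop | htop
  · rw [htop]
    exact le_top
  have hsplit := const_mul_liminf_add_liminf_le (f := 𝓝[>] (0 : ℝ))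
    (ENNReal.ofReal_ne_top (r := σ))
    (fun ε => weightedTV M (fun x => v ε x ^ 2) univ (u ε)) (fun ε => sMM M F ε (v ε))
  change _ ≤ liminf (fun ε => energy M F σ ε (u ε) (v ε)) (𝓝[>] 0) at hsplit
  have hfin := ne_top_of_le_ne_top htop hsplit
  rw [ENNReal.add_ne_top] at hfin
  -- Any finite level above the liminf bounds the Modica–Mortola energy frequently, which is all
  -- that the compactness result needs.
  obtain ⟨C, hC1, hC2⟩ := exists_between (lt_top_iff_ne_top.2 hfin.2)
  have hfreq : ∃ᶠ ε in 𝓝[>] 0, sMM M F ε (v ε) ≤ C :=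
    (frequently_lt_of_liminf_lt (by isBoundedDefault) hC1).mono fun _ h => h.le
  obtain ⟨hA, hle⟩ := isA0_and_sMM0_le hF hF0 hF1 hH1 hΞ hv hC2.ne hfreq
  have hBV' : IsBV M u₀ := by
    rcases hσ.eq_or_lt with h0 | h0
    · exact hBV h0.symm
    refine isBV_of_liminf_lt_top hu hu₀ hut hv
      (hA.finite_of_sMM0_ne_top hF hF0 hF1 (ne_top_of_le_ne_top hC2.ne hle)) ?_
    refine lt_top_iff_ne_top.2 fun h => hfin.1 ?_
    rw [h, ENNReal.mul_top (ENNReal.ofReal_pos.2 h0).ne']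
  refine le_trans ?_ hsplit
  rw [energy0, if_pos ⟨hBV', hA⟩, ← mul_add]
  refine add_le_add (mul_le_mul_right ?_ _) (sMM0_le_liminf hF hF0 hF1 hH1 hΞ hv)
  obtain ⟨μ, hμ⟩ := hBV'.exists_isVariationMeasure
  classical
  -- At an exceptional point without jump `ξ⁻` may be negative, and `(ξ⁻)²` is then no lower bound
  -- of the squares. Such points are `μ`-null, so the weight may be replaced by `0` there.
  set m : M.Pt → ℝ := fun x => if x ∈ exceptional Ξ \ jumpSet M u₀ then 0 else sInf (Ξ x) ^ 2
    with hm
  have hmJ : ∀ x ∈ jumpSet M u₀, m x = sInf (Ξ x) ^ 2 := fun x hx => if_neg fun h => h.2 hx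
  have hmS : ∀ x, x ∉ exceptional Ξ → m x = 1 := fun x hx => by
    simp only [hm]
    rw [if_neg fun h => hx h.1, hA.eq_singleton hx, csInf_singleton, one_pow]
  have e1 : ∑' x : ↥(jumpSet M u₀ ∩ exceptional Ξ), ENNReal.ofReal
      (jump M u₀ x * sInf (Ξ x) ^ 2) =
      ∑' x : ↥(jumpSet M u₀ ∩ exceptional Ξ), ENNReal.ofReal (jump M u₀ x * m x) :=
    tsum_congr fun x => by rw [hmJ x x.2.1]
  rw [e1, ← hμ.lintegral_eq hA.countable_exceptional hmS]
  refine hμ.lintegral_le_liminf hu hu₀ hut hΞ hv (fun x => ⟨1, hA.one_mem x⟩) fun x y hy => ?_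
  by_cases hx : x ∈ exceptional Ξ
  · by_cases hJ : x ∈ jumpSet M u₀
    · rw [hmJ x hJ]
      have h0 := hmin hBV' x ⟨hJ, hx⟩
      rw [hA.eq_Icc x] at hy
      exact pow_le_pow_left₀ h0 hy.1 2
    · simp only [hm]
      rw [if_pos ⟨hx, hJ⟩]
      positivity
  · rw [hmS x hx]
    rw [hA.eq_singleton hx] at hy
    rw [hy, one_pow]

/-! ### Optimal profiles -/

/-- Inverse of a primitive of `1 / Φ`: a solution of the autonomous equation `w' = Φ(w)`. -/
theorem exists_autonomous_solution {Φ : ℝ → ℝ} (hΦ : Continuous Φ) {m K : ℝ} (hm : 0 < m)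
    (hm' : ∀ y, m ≤ Φ y) (hK : ∀ y, Φ y ≤ K) (y₀ : ℝ) :
    ∃ w : ℝ → ℝ, w 0 = y₀ ∧ StrictMono w ∧ Function.Surjective w ∧
      ∀ z, HasDerivAt w (Φ (w z)) z := by
  have hpos : ∀ y, 0 < Φ y := fun y => hm.trans_le (hm' y)
  have hK0 : 0 < K := (hpos 0).trans_le (hK 0)
  have hc : Continuous fun y => (Φ y)⁻¹ := hΦ.inv₀ fun y => (hpos y).ne'
  set T : ℝ → ℝ := fun y => ∫ τ in y₀..y, (Φ τ)⁻¹ with hT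
  have hT' : ∀ y, HasDerivAt T (Φ y)⁻¹ y := fun y =>
    intervalIntegral.integral_hasDerivAt_right (hc.intervalIntegrable _ _)
      hc.stronglyMeasurable.stronglyMeasurableAtFilter hc.continuousAt
  have hTc : Continuous T := continuous_iff_continuousAt.2 fun y => (hT' y).continuousAt
  have hTm : StrictMono T := strictMono_of_hasDerivAt_pos hT' fun y => inv_pos.2 (hpos y)
  have hT0 : T y₀ = 0 := intervalIntegral.integral_same
  -- The integrand is at least `1 / K`, so `T` grows at least linearly in both directions and is
  -- onto.
  have hlin : Monotone fun y => T y - K⁻¹ * y := by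
    refine monotone_of_hasDerivAt_nonneg (fun y => (hT' y).sub ((hasDerivAt_id y).const_mul _)) ?_
    intro y
    simp only [mul_one, sub_nonneg, Pi.zero_apply]
    exact inv_anti₀ (hpos y) (hK y)
  have hsurj : Function.Surjective T := by
    refine hTc.surjective ?_ ?_
    · have h1 : Tendsto (fun y => K⁻¹ * y + (T y₀ - K⁻¹ * y₀)) atTop atTop :=
        tendsto_atTop_add_const_right _ _ (tendsto_id.const_mul_atTop (inv_pos.2 hK0))
      refine tendsto_atTop_mono' _ ?_ h1
      filter_upwards [eventually_ge_atTop y₀] with y hy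
      have := hlin hy
      simp only at this
      linarith
    · have h1 : Tendsto (fun y => K⁻¹ * y + (T y₀ - K⁻¹ * y₀)) atBot atBot :=
        tendsto_atBot_add_const_right _ _ (tendsto_id.const_mul_atBot (inv_pos.2 hK0))
      refine tendsto_atBot_mono' _ ?_ h1
      filter_upwards [eventually_le_atBot y₀] with y hy
      have := hlin hy
      simp only at this
      linarith
  set e := hTm.orderIsoOfSurjective T hsurj with he
  have hinv : ∀ z, T (e.symm z) = z := fun z => e.apply_symm_apply z
  refine ⟨e.symm, ?_, e.symm.strictMono, e.symm.surjective, fun z => ?_⟩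
  · rw [← hT0]
    exact e.symm_apply_apply y₀
  · have := HasDerivAt.of_local_left_inverse (f := T) (g := e.symm) (a := z)
      e.symm.continuous.continuousAt (hT' (e.symm z)) (inv_ne_zero (hpos _).ne')
      (Eventually.of_forall hinv)
    rwa [inv_inv] at this

/-- Upward profile of nearly optimal energy around `0`. -/
theorem exists_tent_of_one_le {F : ℝ → ℝ} (hF : Continuous F) (hF0 : ∀ v, 0 ≤ F v)
    (hF1 : F 1 = 0) {y δ : ℝ} (hy : 1 ≤ y) (hδ : 0 < δ) :
    ∃ Λ : ℝ, 0 ≤ Λ ∧ ∀ ε : ℝ, 0 < ε → ∃ q : ℝ → ℝ, (∃ K, LipschitzWith K q) ∧ q 0 = y ∧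
      (∀ d, ε * Λ ≤ |d| → q d = 1) ∧ (∀ d, q d ∈ uIcc 1 y) ∧ (∀ d, q (-d) = q d) ∧
      ∫⁻ t in Ioi 0, density F ε q t ≤ ENNReal.ofReal (potG F y + δ) := by
  -- Since `F 1 = 0`, the optimal profile may need infinite time to leave `1`. Adding `η` under the
  -- root makes that time finite and costs at most `√η (y - 1)`.
  obtain ⟨η, hη, hηδ⟩ : ∃ η : ℝ, 0 < η ∧ Real.sqrt η * (y - 1) ≤ δ := by
    refine ⟨(δ / y) ^ 2, by positivity, ?_⟩
    rw [Real.sqrt_sq (by positivity), div_mul_eq_mul_div, div_le_iff₀ (by linarith)]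
    nlinarith
  set Φ : ℝ → ℝ := fun τ => Real.sqrt (F (max 1 (min τ y)) + η) with hΦ
  have hΦc : Continuous Φ := by fun_prop
  have hclamp : ∀ τ ∈ Icc 1 y, max 1 (min τ y) = τ := fun τ hτ => by
    rw [min_eq_left hτ.2, max_eq_right hτ.1]
  obtain ⟨B, hB⟩ := isCompact_Icc.exists_bound_of_continuousOn (hF.continuousOn (s := Icc 1 y))
  obtain ⟨w, hw0, hwm, hws, hw'⟩ := exists_autonomous_solution hΦc (m := Real.sqrt η)
    (K := Real.sqrt (B + η)) (Real.sqrt_pos.2 hη)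
    (fun τ => Real.sqrt_le_sqrt (by linarith [hF0 (max 1 (min τ y))]))
    (fun τ => Real.sqrt_le_sqrt (by
      have := (le_abs_self _).trans (hB (max 1 (min τ y)) ⟨le_max_left _ _,
        max_le hy (min_le_right _ _)⟩)
      linarith)) 1
  have hΦK : ∀ τ, |Φ τ| ≤ Real.sqrt (B + η) := fun τ => by
    rw [abs_of_nonneg (Real.sqrt_nonneg _)]
    exact Real.sqrt_le_sqrt (by
      have := (le_abs_self _).trans (hB (max 1 (min τ y)) ⟨le_max_left _ _,
        max_le hy (min_le_right _ _)⟩)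
      linarith)
  have hwc : Continuous w := continuous_iff_continuousAt.2 fun z => (hw' z).continuousAt
  obtain ⟨Λ, hΛ⟩ := hws y
  have hΛ0 : 0 ≤ Λ := by
    rw [← hwm.le_iff_le, hw0, hΛ]
    exact hy
  refine ⟨Λ, hΛ0, fun ε hε => ?_⟩
  have hwL : LipschitzWith ⟨Real.sqrt (B + η), Real.sqrt_nonneg _⟩ w :=
    lipschitzWith_of_nnnorm_deriv_le (fun z => (hw' z).differentiableAt) fun z => by
      rw [(hw' z).deriv]
      exact hΦK _
  -- The solution is run backwards from `y` at time scale `ε` and stopped at `1`; `Λ` is the time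
  -- from `1` to `y`.
  set q : ℝ → ℝ := fun d => w (max 0 (Λ - |d| / ε)) with hq
  have hmem : ∀ d, q d ∈ Icc 1 y := by
    intro d
    constructor
    · rw [← hw0]
      exact hwm.monotone (le_max_left _ _)
    · rw [← hΛ]
      refine hwm.monotone (max_le hΛ0 ?_)
      have : 0 ≤ |d| / ε := by positivity
      linarith
  have hone : ∀ d, ε * Λ ≤ |d| → q d = 1 := by
    intro d hd
    have : Λ ≤ |d| / ε := by
      rw [le_div_iff₀ hε]
      linarith
    simp only [hq]
    rw [max_eq_left (by linarith), hw0]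
  have hqL : ∃ K, LipschitzWith K q := by
    have h1 : LipschitzWith ⟨ε⁻¹, (inv_pos.2 hε).le⟩ fun d : ℝ => max 0 (Λ - |d| / ε) := by
      refine LipschitzWith.of_dist_le_mul fun d d' => ?_
      rw [Real.dist_eq, Real.dist_eq, max_comm 0, max_comm 0]
      refine (abs_max_sub_max_le_abs _ _ _).trans ?_
      have e : Λ - |d| / ε - (Λ - |d'| / ε) = ε⁻¹ * (|d'| - |d|) := by
        field_simp
        ring
      rw [e, abs_mul, abs_of_pos (inv_pos.2 hε)]
      refine mul_le_mul_of_nonneg_left ?_ (inv_pos.2 hε).le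
      rw [abs_sub_comm d d']
      exact abs_abs_sub_abs_le _ _
    exact ⟨_, hwL.comp h1⟩
  refine ⟨q, hqL, ?_, hone, fun d => ?_, fun d => ?_, ?_⟩
  · simp only [hq, abs_zero, zero_div, sub_zero]
    rw [max_eq_right hΛ0, hΛ]
  · rw [uIcc_of_le hy]
    exact hmem d
  · simp only [hq, abs_neg]
  · set A := ε * Λ with hA
    have hA0 : 0 ≤ A := by positivity
    have hz : ∀ t ∈ Ioi A, density F ε q t = 0 := by
      intro t ht
      have h1 : q =ᶠ[𝓝 t] fun _ => 1 := by
        filter_upwards [Ioi_mem_nhds (mem_Ioi.1 ht)] with s hs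
        exact hone s (le_of_lt (lt_of_lt_of_le hs (le_abs_self s)))
      have h2 : q t = 1 := h1.eq_of_nhds
      rw [density, h1.deriv_eq, h2, hF1]
      simp
    set Ψ : ℝ → ℝ := fun v => ∫ τ in (1 : ℝ)..v, Φ τ with hΨ
    have hΨ' : ∀ v, HasDerivAt Ψ (Φ v) v := fun v =>
      intervalIntegral.integral_hasDerivAt_right (hΦc.intervalIntegrable _ _)
        hΦc.stronglyMeasurable.stronglyMeasurableAtFilter hΦc.continuousAt
    set k : ℝ → ℝ := fun t => Φ (w (Λ - t / ε)) * (Φ (w (Λ - t / ε)) * ε⁻¹) with hk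
    have hkc : Continuous k := by
      have : Continuous fun t => Φ (w (Λ - t / ε)) := hΦc.comp (hwc.comp (by fun_prop))
      exact this.mul (this.mul continuous_const)
    have hk0 : ∀ t, 0 ≤ k t := fun t => by
      have : 0 ≤ Φ (w (Λ - t / ε)) := Real.sqrt_nonneg _
      simp only [hk]
      positivity
    have hqd : ∀ t ∈ Ioo 0 A, density F ε q t ≤ ENNReal.ofReal (k t) := by
      intro t ht
      have h1 : q =ᶠ[𝓝 t] fun s => w (Λ - s / ε) := by
        filter_upwards [Ioo_mem_nhds ht.1 ht.2] with s hs
        simp only [hq]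
        rw [abs_of_pos hs.1, max_eq_right]
        rw [sub_nonneg, div_le_iff₀ hε]
        linarith [hs.2]
      have h2 : q t = w (Λ - t / ε) := h1.eq_of_nhds
      have h3 : HasDerivAt (fun s : ℝ => Λ - s / ε) (-(1 / ε)) t :=
        ((hasDerivAt_id t).div_const ε).const_sub Λ
      have h4 : deriv q t = Φ (w (Λ - t / ε)) * (-(1 / ε)) := by
        rw [h1.deriv_eq]
        exact ((hw' _).comp t h3).deriv
      have h5 : Φ (q t) ^ 2 = F (q t) + η := by
        simp only [hΦ]
        rw [Real.sq_sqrt (by linarith [hF0 (max 1 (min (q t) y))]), hclamp _ (hmem t)]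
      have h6 := hF0 (q t)
      rw [density, h4, ← h2, ← ENNReal.ofReal_mul (by positivity),
        ← ENNReal.ofReal_mul (by positivity), ← ENNReal.ofReal_add (by positivity) (by positivity)]
      refine ENNReal.ofReal_le_ofReal ?_
      simp only [hk]
      rw [← h2]
      -- As `w' = Φ(w)`, both energy terms have denominator `2ε`, and `F ≤ Φ²` bounds the density by
      -- `Φ² / ε`, an exact derivative along the profile.
      have e1 : ε / 2 * (Φ (q t) * -(1 / ε)) ^ 2 + 1 / (2 * ε) * F (q t) =
          (Φ (q t) ^ 2 + F (q t)) * (2 * ε)⁻¹ := by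
        field_simp
      have e2 : Φ (q t) * (Φ (q t) * ε⁻¹) = (Φ (q t) ^ 2 + Φ (q t) ^ 2) * (2 * ε)⁻¹ := by
        field_simp
        ring
      rw [e1, e2]
      refine mul_le_mul_of_nonneg_right ?_ (by positivity)
      linarith
    have hInt : ∫ t in (0 : ℝ)..A, k t = Ψ y := by
      have h1 : ∀ t ∈ uIcc 0 A, HasDerivAt (fun t => -Ψ (w (Λ - t / ε))) (k t) t := by
        intro t _
        have h3 : HasDerivAt (fun s : ℝ => Λ - s / ε) (-(1 / ε)) t :=
          ((hasDerivAt_id t).div_const ε).const_sub Λ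
        have h4 := (((hΨ' _).comp _ (hw' _)).comp t h3).neg
        refine h4.congr_deriv ?_
        simp only [hk]
        field_simp
      rw [intervalIntegral.integral_eq_sub_of_hasDerivAt h1 (hkc.intervalIntegrable _ _)]
      have e1 : A / ε = Λ := by
        rw [hA]
        field_simp
      rw [e1, sub_self, hw0, zero_div, sub_zero, hΛ]
      simp [hΨ]
    have hΨy : Ψ y ≤ potG F y + δ := by
      rw [← primH_of_one_le hF hy]
      have h1 : Ψ y ≤ ∫ τ in (1 : ℝ)..y, (Real.sqrt (F τ) + Real.sqrt η) := by
        refine intervalIntegral.integral_mono_on hy (hΦc.intervalIntegrable _ _)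
          ((hF.sqrt.add continuous_const).intervalIntegrable _ _) fun τ hτ => ?_
        simp only [hΦ]
        rw [hclamp τ hτ]
        refine Real.sqrt_le_iff.2 ⟨by positivity, ?_⟩
        nlinarith [Real.sq_sqrt (hF0 τ), Real.sq_sqrt hη.le,
          mul_nonneg (Real.sqrt_nonneg (F τ)) (Real.sqrt_nonneg η)]
      rw [intervalIntegral.integral_add (hF.sqrt.intervalIntegrable _ _)
        (intervalIntegrable_const), intervalIntegral.integral_const, smul_eq_mul] at h1
      have h2 : primH F y = ∫ τ in (1 : ℝ)..y, Real.sqrt (F τ) := rfl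
      linarith
    calc ∫⁻ t in Ioi 0, density F ε q t
        ≤ ∫⁻ t in Ioc 0 A ∪ Ioi A, density F ε q t := by
          refine lintegral_mono_set fun t ht => ?_
          rcases le_or_gt t A with h | h
          · exact Or.inl ⟨ht, h⟩
          · exact Or.inr h
      _ ≤ (∫⁻ t in Ioc 0 A, density F ε q t) + ∫⁻ t in Ioi A, density F ε q t :=
          lintegral_union_le _ _ _
      _ = ∫⁻ t in Ioo 0 A, density F ε q t := by
          rw [setLIntegral_congr_fun measurableSet_Ioi hz, lintegral_zero, add_zero]
          exact setLIntegral_congr Ioo_ae_eq_Ioc.symm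
      _ ≤ ∫⁻ t in Ioo 0 A, ENNReal.ofReal (k t) := setLIntegral_mono' measurableSet_Ioo hqd
      _ = ENNReal.ofReal (∫ t in Ioo 0 A, k t) :=
          (ofReal_integral_eq_lintegral_ofReal
            ((hkc.integrableOn_Icc (a := 0) (b := A)).mono_set Ioo_subset_Icc_self)
            (Eventually.of_forall hk0)).symm
      _ ≤ ENNReal.ofReal (potG F y + δ) := by
          refine ENNReal.ofReal_le_ofReal ?_
          rw [← integral_Ioc_eq_integral_Ioo, ← intervalIntegral.integral_of_le hA0, hInt]
          exact hΨy

/-- The reflection `v ↦ 2 - v` fixes `1` and reduces profiles below `1` to profiles above it. -/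
theorem potG_comp_sub_left (F : ℝ → ℝ) (y : ℝ) : potG (fun v => F (2 - v)) (2 - y) = potG F y := by
  have h := intervalIntegral.integral_comp_sub_left (a := 1) (b := 2 - y)
    (fun τ => Real.sqrt (F τ)) 2
  unfold potG
  rw [h]
  norm_num
  rw [intervalIntegral.integral_symm, abs_neg]

theorem density_sub_left (F : ℝ → ℝ) (ε : ℝ) (q : ℝ → ℝ) (t : ℝ) :
    density F ε (fun d => 2 - q d) t = density (fun v => F (2 - v)) ε q t := by
  simp only [density, deriv_const_sub, neg_sq]

theorem exists_tent {F : ℝ → ℝ} (hF : Continuous F) (hF0 : ∀ v, 0 ≤ F v)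
    (hF1 : F 1 = 0) (y : ℝ) {δ : ℝ} (hδ : 0 < δ) :
    ∃ Λ : ℝ, 0 ≤ Λ ∧ ∀ ε : ℝ, 0 < ε → ∃ q : ℝ → ℝ, (∃ K, LipschitzWith K q) ∧ q 0 = y ∧
      (∀ d, ε * Λ ≤ |d| → q d = 1) ∧ (∀ d, q d ∈ uIcc 1 y) ∧ (∀ d, q (-d) = q d) ∧
      ∫⁻ t in Ioi 0, density F ε q t ≤ ENNReal.ofReal (potG F y + δ) := by
  rcases le_total 1 y with hy | hy
  · exact exists_tent_of_one_le hF hF0 hF1 hy hδ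
  obtain ⟨Λ, hΛ, h⟩ := exists_tent_of_one_le (F := fun v => F (2 - v)) (by fun_prop)
    (fun v => hF0 _) (by norm_num [hF1]) (y := 2 - y) (by linarith) hδ
  refine ⟨Λ, hΛ, fun ε hε => ?_⟩
  obtain ⟨q, ⟨K, hK⟩, hq0, hq1, hq2, hq3, hq4⟩ := h ε hε
  refine ⟨fun d => 2 - q d, ⟨0 + K, (LipschitzWith.const 2).sub hK⟩, by simp only [hq0]; ring,
    fun d hd => by simp only [hq1 d hd]; norm_num, fun d => ?_, fun d => by simp only [hq3], ?_⟩
  · have := hq2 d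
    rw [uIcc_of_le (by linarith)] at this
    rw [uIcc_of_ge hy]
    exact ⟨by linarith [this.2], by linarith [this.1]⟩
  · rw [potG_comp_sub_left] at hq4
    simp only [density_sub_left]
    exact hq4

theorem density_comp_sub_right (F : ℝ → ℝ) (ε : ℝ) (q : ℝ → ℝ) (c t : ℝ) :
    density F ε (fun s => q (s - c)) t = density F ε q (t - c) := by
  simp only [density, deriv_comp_sub_const]

theorem setLIntegral_Ioi_density_comp_sub (F : ℝ → ℝ) (ε : ℝ) (q : ℝ → ℝ) (c : ℝ) :
    ∫⁻ t in Ioi c, density F ε (fun s => q (s - c)) t = ∫⁻ t in Ioi 0, density F ε q t := by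
  have := (measurePreserving_sub_right volume c).setLIntegral_comp_preimage_emb
    (measurableEmbedding_subRight c) (density F ε q) (Ioi 0)
  rw [← this]
  simp [density_comp_sub_right]

theorem setLIntegral_Iio_density_comp_sub (F : ℝ → ℝ) (ε : ℝ) {q : ℝ → ℝ}
    (hq : ∀ d, q (-d) = q d) (c : ℝ) :
    ∫⁻ t in Iio c, density F ε (fun s => q (s - c)) t = ∫⁻ t in Ioi 0, density F ε q t := by
  have hd : ∀ t, density F ε q (-t) = density F ε q t := by
    intro t
    have h1 : deriv q (-t) = -deriv q t := by
      have h2 := deriv_comp_neg q t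
      simp only [hq] at h2
      rw [h2, neg_neg]
    simp only [density, h1, neg_sq, hq]
  have := (volume.measurePreserving_sub_left c).setLIntegral_comp_preimage_emb
    (MeasurableEquiv.subLeft c).measurableEmbedding (density F ε q) (Ioi 0)
  rw [← this]
  simp only [preimage_const_sub_Ioi, sub_zero, density_comp_sub_right]
  refine lintegral_congr fun t => ?_
  rw [← hd, neg_sub]

/-! ### Superposition of profiles -/

theorem isH1_of_lipschitzWith {M : Dom} {f : M.Pt → ℝ} {K : NNReal} (hf : LipschitzWith K f) :
    IsH1 M f := by
  have h1 : LipschitzWith K (f ∘ M.param) := by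
    have := hf.comp M.lipschitzWith_param
    rwa [mul_one] at this
  refine ⟨h1.lipschitzOnWith.absolutelyContinuousOnInterval, ?_⟩
  have : IsFiniteMeasure M.leb :=
    ⟨by rw [Dom.leb, Measure.restrict_apply_univ, Real.volume_Ioo]; exact ENNReal.ofReal_lt_top⟩
  exact MemLp.of_bound (measurable_deriv _).aestronglyMeasurable K
    (Eventually.of_forall fun t => norm_deriv_le_of_lipschitz h1)

theorem density_congr {F : ℝ → ℝ} {ε : ℝ} {g h : ℝ → ℝ} {t : ℝ} (hgh : g =ᶠ[𝓝 t] h) :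
    density F ε g t = density F ε h t := by
  rw [density, density, hgh.deriv_eq, hgh.eq_of_nhds]

/-- A tent has two flanks of equal energy, and at an end point of an interval only one of them lies
in `M`. -/
theorem IsWindow.setLIntegral_tent_le {M : Dom} {x : M.Pt} {L R : ℝ} (hW : IsWindow M x L R)
    {F : ℝ → ℝ} {ε C : ℝ} (hC : 0 ≤ C) {q : ℝ → ℝ} (hq : ∀ d, q (-d) = q d)
    (h : ∫⁻ t in Ioi 0, density F ε q t ≤ ENNReal.ofReal C) :
    ∫⁻ t in Ioo L R, density F ε (fun s => q (s - M.coord x)) t ≤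
      ENNReal.ofReal ((2 - kappa M x) * C) := by
  set c := M.coord x with hc
  have h1 := setLIntegral_Ioi_density_comp_sub F ε q c
  have h2 := setLIntegral_Iio_density_comp_sub F ε hq c
  by_cases hx : x ∈ M.inner
  · have hk : kappa M x = 0 := if_pos hx
    rw [hk, sub_zero, two_mul]
    rw [ENNReal.ofReal_add hC hC]
    calc ∫⁻ t in Ioo L R, density F ε (fun s => q (s - c)) t
        ≤ ∫⁻ t in Iic c ∪ Ioi c, density F ε (fun s => q (s - c)) t :=
          lintegral_mono_set (by rw [Iic_union_Ioi]; exact subset_univ _)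
      _ ≤ (∫⁻ t in Iic c, density F ε (fun s => q (s - c)) t) +
          ∫⁻ t in Ioi c, density F ε (fun s => q (s - c)) t := lintegral_union_le _ _ _
      _ ≤ ENNReal.ofReal C + ENNReal.ofReal C := by
          rw [setLIntegral_congr Iio_ae_eq_Iic.symm, h1, h2]
          exact add_le_add h h
  · have hk : kappa M x = 1 := if_neg hx
    have e : (2 - kappa M x) * C = C := by rw [hk]; ring
    rw [e]
    rcases hW.coord_eq_of_notMem_inner hx with h3 | h3
    · refine le_trans (lintegral_mono_set fun t ht => ?_) (h1.trans_le h)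
      rw [mem_Ioi, hc, h3]
      exact ht.1
    · refine le_trans (lintegral_mono_set fun t ht => ?_) (h2.trans_le h)
      rw [mem_Iio, hc, h3]
      exact ht.2

/-- Deviations from `1` of tents in the distance to each centre are superposed. For small `ε` their
supports are disjoint, so near each centre the sum is a single tent. -/
theorem eventually_exists_bumps {M : Dom} {F : ℝ → ℝ} (hF : Continuous F) (hF0 : ∀ v, 0 ≤ F v)
    (hF1 : F 1 = 0) {ι : Type*} (s : Finset ι) {pos : ι → M.Pt} (hpos : Set.InjOn pos s)
    (val : ι → ℝ) {r δ : ℝ} (hr : 0 < r) (hδ : 0 < δ) :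
    ∀ᶠ ε in 𝓝[>] 0, ∃ f : M.Pt → ℝ, IsH1 M f ∧ (∀ i ∈ s, f (pos i) = val i) ∧
      (∀ x, f x = 1 ∨ ∃ i ∈ s, dist x (pos i) < r ∧ f x ∈ uIcc 1 (val i)) ∧
      sMM M F ε f ≤ ∑ i ∈ s, ENNReal.ofReal ((2 - kappa M (pos i)) * (potG F (val i) + δ)) := by
  choose Λ hΛ0 hΛ using fun i => exists_tent hF hF0 hF1 (val i) hδ
  obtain ⟨ρ₀, hρ₀, hsep⟩ := exists_pos_two_mul_le_dist s hpos
  set ρ := min r ρ₀ with hρ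
  have hρ0 : 0 < ρ := lt_min hr hρ₀
  have hev : ∀ᶠ ε : ℝ in 𝓝[>] 0, ∀ i ∈ s, ε * Λ i < ρ := by
    rw [eventually_all_finset]
    intro i _
    have hp : 0 < Λ i + 1 := by linarith [hΛ0 i]
    filter_upwards [Ioo_mem_nhdsGT (div_pos hρ0 hp)] with ε hε
    have := hε.2
    rw [lt_div_iff₀ hp] at this
    linarith [hε.1]
  filter_upwards [hev, self_mem_nhdsWithin] with ε hερ hε0
  have hε : 0 < ε := hε0
  choose q hqL hq0 hq1 hqmem hqeven hqE using fun i => hΛ i ε hε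
  set f : M.Pt → ℝ := fun x => 1 + ∑ i ∈ s, (q i (dist x (pos i)) - 1) with hf
  have hone : ∀ i x, ε * Λ i ≤ dist x (pos i) → q i (dist x (pos i)) = 1 := fun i x h =>
    hq1 i _ (by rwa [abs_of_nonneg dist_nonneg])
  have hloc : ∀ i ∈ s, ∀ x, dist x (pos i) < ρ → f x = q i (dist x (pos i)) := by
    intro i hi x hx
    simp only [hf]
    rw [Finset.sum_eq_single_of_mem i hi]
    · ring
    · intro j hj hji
      rw [hone j x, sub_self]
      have h1 := hsep i hi j hj hji.symm
      have h2 := dist_triangle_left (pos i) (pos j) x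
      have h3 : ρ ≤ ρ₀ := min_le_right _ _
      linarith [hερ j hj]
  have hoff : ∀ x, (∀ i ∈ s, ε * Λ i < dist x (pos i)) → f x = 1 := by
    intro x hx
    simp only [hf]
    rw [Finset.sum_eq_zero fun i hi => by rw [hone i x (hx i hi).le, sub_self], add_zero]
  have hL : ∃ K, LipschitzWith K f := by
    have h1 : ∀ s' : Finset ι, ∃ K, LipschitzWith K
        fun x => 1 + ∑ i ∈ s', (q i (dist x (pos i)) - 1) := by
      classical
      intro s'
      induction s' using Finset.induction_on with
      | empty => exact ⟨0, by simp⟩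
      | insert i s' hi ih =>
        obtain ⟨K, hK⟩ := ih
        obtain ⟨K', hK'⟩ := hqL i
        have h2 : LipschitzWith K' fun x => q i (dist x (pos i)) := by
          have := hK'.comp (LipschitzWith.dist_left (pos i))
          rwa [mul_one] at this
        have h3 : (fun x => 1 + ∑ j ∈ insert i s', (q j (dist x (pos j)) - 1)) =
            fun x => (1 + ∑ j ∈ s', (q j (dist x (pos j)) - 1)) + q i (dist x (pos i)) - 1 := by
          funext x
          rw [Finset.sum_insert hi]
          ring
        rw [h3]
        exact ⟨_, (hK.add h2).sub (LipschitzWith.const (1 : ℝ))⟩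
    exact h1 s
  obtain ⟨K, hK⟩ := hL
  have hH1 : IsH1 M f := isH1_of_lipschitzWith hK
  refine ⟨f, hH1, fun i hi => ?_, fun x => ?_, ?_⟩
  · rw [hloc i hi _ (by rwa [dist_self]), dist_self, hq0]
  · by_cases h : ∃ i ∈ s, dist x (pos i) < ρ
    · obtain ⟨i, hi, hd⟩ := h
      refine Or.inr ⟨i, hi, hd.trans_le (min_le_left _ _), ?_⟩
      rw [hloc i hi x hd]
      exact hqmem i _
    · push Not at h
      exact Or.inl (hoff x fun i hi => (hερ i hi).trans_le (h i hi))
  · rw [sMM_eq_lintegral_density]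
    set D := density F ε (f ∘ M.param) with hD
    have hDm : Measurable D :=
      measurable_density hF ε (hK.continuous.comp M.continuous_param)
    have hbm : ∀ i, MeasurableSet (M.param ⁻¹' Metric.ball (pos i) ρ) := fun i =>
      M.continuous_param.measurable Metric.isOpen_ball.measurableSet
    have hpt : ∀ t, D t ≤ ∑ i ∈ s, (M.param ⁻¹' Metric.ball (pos i) ρ).indicator D t := by
      intro t
      by_cases h : ∃ i ∈ s, dist (M.param t) (pos i) < ρ
      · obtain ⟨i, hi, hd⟩ := h
        have h1 : D t = (M.param ⁻¹' Metric.ball (pos i) ρ).indicator D t :=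
          (indicator_of_mem (show t ∈ _ from hd) D).symm
        refine h1.le.trans (Finset.single_le_sum (f := fun i =>
          (M.param ⁻¹' Metric.ball (pos i) ρ).indicator D t) (fun _ _ => zero_le) hi)
      · push Not at h
        have h1 : f ∘ M.param =ᶠ[𝓝 t] fun _ => 1 := by
          have h2 : ∀ᶠ τ in 𝓝 t, ∀ i ∈ s, ε * Λ i < dist (M.param τ) (pos i) := by
            rw [eventually_all_finset]
            intro i hi
            have hc : Continuous fun τ => dist (M.param τ) (pos i) :=
              M.continuous_param.dist continuous_const
            exact hc.continuousAt.eventually (lt_mem_nhds ((hερ i hi).trans_le (h i hi)))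
          filter_upwards [h2] with τ hτ
          exact hoff _ hτ
        have h3 : D t = 0 := by
          rw [hD, density_congr h1, density]
          simp [hF1]
        rw [h3]
        exact zero_le
    calc ∫⁻ t in Ioo M.left M.right, D t
        ≤ ∫⁻ t in Ioo M.left M.right,
            ∑ i ∈ s, (M.param ⁻¹' Metric.ball (pos i) ρ).indicator D t := lintegral_mono hpt
      _ = ∑ i ∈ s, ∫⁻ t in Ioo M.left M.right ∩ M.param ⁻¹' Metric.ball (pos i) ρ, D t := by
          rw [lintegral_finsetSum _ fun i _ => hDm.indicator (hbm i)]
          refine Finset.sum_congr rfl fun i _ => ?_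
          rw [lintegral_indicator (hbm i), Measure.restrict_restrict (hbm i), inter_comm]
      _ ≤ _ := by
          refine Finset.sum_le_sum fun i hi => ?_
          obtain ⟨L, R, hW⟩ := exists_isWindow M (pos i)
          rw [hD, hW.lintegral_density_eq _ Metric.isOpen_ball.measurableSet]
          refine le_trans ?_ (hW.setLIntegral_tent_le
            (add_nonneg (potG_nonneg F _) hδ.le) (hqeven i) (hqE i))
          refine le_trans ?_ (lintegral_mono_set
            (inter_subset_left (t := M.param ⁻¹' Metric.ball (pos i) ρ)))
          refine (setLIntegral_congr_fun (measurableSet_Ioo.inter (hbm i)) fun t ht => ?_).le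
          refine density_congr ?_
          filter_upwards [(isOpen_Ioo.inter (Metric.isOpen_ball.preimage
            M.continuous_param)).mem_nhds ht] with τ hτ
          have h1 : dist (M.param τ) (pos i) < ρ := hτ.2
          rw [Function.comp_apply, hloc i hi _ h1, hW.dist_eq τ (Ioo_subset_Icc_self hτ.1)]
          -- Evenness of the tent replaces the distance by the signed coordinate difference.
          rcases abs_choice (τ - M.coord (pos i)) with h2 | h2
          · rw [h2]
          · rw [h2, hqeven]

/-! ### Approximation of the limit configuration at fixed accuracy -/

theorem exists_param_near {M : Dom} (x : M.Pt) {θ : ℝ} (hθ : 0 < θ) :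
    ∃ t, |t - M.coord x| < θ ∧ M.param t ≠ x ∧ M.param t ∈ M.inner := by
  obtain ⟨s, t, hst, hs, ht, hr⟩ := Dom.exists_subinterval x hθ
  obtain ⟨r, hrst, hrC⟩ := Dom.exists_param_notMem_of_countable (countable_singleton x) hst hs ht
  exact ⟨r, hr r hrst, hrC, Dom.param_mem_inner ⟨hs.trans_lt hrst.1, hrst.2.trans_le ht⟩⟩

/-- The atoms in a countable set have a convergent sum, so tails are small. The bound persists for
larger finite sets, which leaves room to add points for other purposes. -/
theorem exists_finset_measure_diff_le {X : Type*} [MeasurableSpace X] [MeasurableSingletonClass X]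
    (μ : Measure X) [IsFiniteMeasure μ] {C : Set X} (hC : C.Countable) {β : ℝ≥0∞} (hβ : 0 < β) :
    ∃ S : Finset X, ↑S ⊆ C ∧ ∀ T : Finset X, S ⊆ T → μ (C \ T) ≤ β := by
  have := hC.to_subtype
  have h1 : ∑' x : C, μ {(x : X)} ≠ ∞ := by
    refine ne_top_of_le_ne_top (measure_ne_top μ _) (tsum_meas_le_meas_iUnion_of_disjoint μ
      (As := fun x : C => {(x : X)}) (fun x => measurableSet_singleton _) fun x y hxy => ?_)
    exact disjoint_singleton.2 fun h => hxy (Subtype.ext h)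
  obtain ⟨s, hs⟩ := ((ENNReal.tendsto_tsum_compl_atTop_zero h1).eventually_lt_const hβ).exists
  refine ⟨s.map (Function.Embedding.subtype _), ?_, fun T hT => ?_⟩
  · intro x hx
    simp only [Finset.coe_map, Function.Embedding.subtype_apply, mem_image] at hx
    obtain ⟨y, -, rfl⟩ := hx
    exact y.2
  · refine le_trans ?_ hs.le
    have h2 : C \ ↑T ⊆ ⋃ x : {x : C // x ∉ s}, {(x : X)} := by
      rintro x ⟨hx, hxT⟩
      refine mem_iUnion.2 ⟨⟨⟨x, hx⟩, fun h => hxT (hT ?_)⟩, rfl⟩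
      exact Finset.mem_map.2 ⟨⟨x, hx⟩, h, rfl⟩
    exact (measure_mono h2).trans (measure_iUnion_le _)

/-- Punctured balls decrease to the empty set, and `μ` is finite. -/
theorem eventually_measure_punctured_ball_le {X : Type*} [MetricSpace X] [MeasurableSpace X]
    [BorelSpace X] (μ : Measure X) [IsFiniteMeasure μ] (x : X) {β : ℝ≥0∞} (hβ : 0 < β) :
    ∀ᶠ ρ in 𝓝[>] (0 : ℝ), μ (Metric.ball x ρ \ {x}) ≤ β := by
  have h1 := tendsto_measure_biInter_gt (μ := μ) (a := (0 : ℝ))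
    (s := fun ρ => Metric.ball x ρ \ {x})
    (fun r _ => (Metric.isOpen_ball.measurableSet.diff
      (measurableSet_singleton x)).nullMeasurableSet)
    (fun i j _ hij => sdiff_subset_sdiff_left (Metric.ball_subset_ball hij))
    ⟨1, one_pos, measure_ne_top _ _⟩
  have h2 : ⋂ r > (0 : ℝ), (Metric.ball x r \ {x}) = ∅ := by
    refine eq_empty_of_forall_notMem fun z hz => ?_
    simp only [mem_iInter] at hz
    have h3 : z ≠ x := (hz 1 one_pos).2
    have h4 : dist z x < dist z x := (hz (dist z x) (dist_pos.2 h3)).1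
    exact lt_irrefl _ h4
  rw [h2, measure_empty] at h1
  filter_upwards [h1.eventually_lt_const hβ] with ρ hρ
  exact hρ.le

theorem lintegral_le_add_of_eq_off {X : Type*} [MeasurableSpace X] {μ : Measure X} {f g : X → ℝ≥0∞}
    {B : Set X} (hB : MeasurableSet B) {c : ℝ≥0∞} (h : ∀ᵐ x ∂μ, x ∉ B → f x = g x)
    (hf : ∀ x, f x ≤ c) : ∫⁻ x, f x ∂μ ≤ ∫⁻ x, g x ∂μ + c * μ B := by
  rw [← lintegral_indicator_const hB c,
    ← lintegral_add_right _ (measurable_const.indicator hB)]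
  refine lintegral_mono_ae ?_
  filter_upwards [h] with x hx
  by_cases hxB : x ∈ B
  · rw [indicator_of_mem hxB]
    exact (hf x).trans (le_add_of_nonneg_left zero_le)
  · rw [hx hxB]
    exact le_add_of_nonneg_right zero_le

/-- `m` is the value to be taken at `x` itself, `s` the one taken beside it. In the interior `m`
must be `ξ⁻`, because `μ` sees the value at the atom. At an end point the costlier value goes to the
end, where it is paid once instead of twice. -/
theorem exists_pointCost_values {M : Dom} {Ξ : M.Pt → Set ℝ} (F : ℝ → ℝ) (x : M.Pt) :
    ∃ m s : ℝ, ((m = sInf (Ξ x) ∧ s = sSup (Ξ x)) ∨ (m = sSup (Ξ x) ∧ s = sInf (Ξ x))) ∧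
      (x ∈ M.inner → m = sInf (Ξ x)) ∧
      (2 - kappa M x) * potG F m + 2 * potG F s =
        pointCost M F x (sInf (Ξ x)) (sSup (Ξ x)) := by
  by_cases hx : x ∈ M.inner
  · have hk : kappa M x = 0 := if_pos hx
    exact ⟨_, _, Or.inl ⟨rfl, rfl⟩, fun _ => rfl, by rw [pointCost, hk]; ring⟩
  · have hk : kappa M x = 1 := if_neg hx
    rcases le_total (potG F (sSup (Ξ x))) (potG F (sInf (Ξ x))) with h | h
    · refine ⟨_, _, Or.inl ⟨rfl, rfl⟩, fun h' => absurd h' hx, ?_⟩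
      rw [pointCost, hk, max_eq_left h]
      ring
    · refine ⟨_, _, Or.inr ⟨rfl, rfl⟩, fun h' => absurd h' hx, ?_⟩
      rw [pointCost, hk, max_eq_right h]
      ring

theorem IsB.exists_finset_net {X : Type} [MetricSpace X] {Ξ : X → Set ℝ} (hΞ : IsB Ξ) (C : Set X)
    {δ : ℝ} (hδ : 0 < δ) :
    ∃ S : Finset X, ↑S ⊆ C ∧
      ∀ z ∈ C, ∀ y ∈ Ξ z, ∃ z' ∈ S, ∃ y' ∈ Ξ z', dist z z' < δ ∧ |y - y'| < δ := by
  classical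
  have h1 : TotallyBounded {p : X × ℝ | p.1 ∈ C ∧ p.2 ∈ Ξ p.1} :=
    hΞ.isCompact_prod.totallyBounded.subset fun p hp => hp.2
  obtain ⟨t, ht, htf, hcov⟩ := Metric.finite_approx_of_totallyBounded h1 δ hδ
  refine ⟨htf.toFinset.image Prod.fst, ?_, fun z hz y hy => ?_⟩
  · intro x hx
    simp only [Finset.coe_image, Finite.coe_toFinset, mem_image] at hx
    obtain ⟨p, hp, rfl⟩ := hx
    exact (ht hp).1
  · obtain ⟨p, hp, hd⟩ := mem_iUnion₂.1 (hcov (show (z, y) ∈ _ from ⟨hz, hy⟩))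
    rw [Metric.mem_ball, Prod.dist_eq, max_lt_iff] at hd
    exact ⟨p.1, Finset.mem_image.2 ⟨p, htf.mem_toFinset.2 hp, rfl⟩, p.2, (ht hp).2, hd⟩

/-! ### Recovery functions at fixed accuracy -/

section Recovery

variable {M : Dom} {F : ℝ → ℝ} {Ξ : M.Pt → Set ℝ}

/-- A continuous function that takes two values near `z` takes all values between them there. -/
theorem exists_eq_of_mem_uIcc {w : M.Pt → ℝ} (hw : Continuous w) {z : M.Pt} {t θ : ℝ}
    (ht : |t - M.coord z| < θ) {y : ℝ} (hy : y ∈ uIcc (w z) (w (M.param t))) :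
    ∃ x, dist x z < θ ∧ w x = y := by
  have hc : Continuous (w ∘ M.param) := hw.comp M.continuous_param
  have h1 : y ∈ uIcc ((w ∘ M.param) (M.coord z)) ((w ∘ M.param) t) := by
    simpa only [Function.comp_apply, M.param_coord] using hy
  obtain ⟨τ, hτ, hτy⟩ := intermediate_value_uIcc hc.continuousOn h1
  refine ⟨M.param τ, ?_, hτy⟩
  have h2 := M.dist_param_le τ (M.coord z)
  rw [M.param_coord] at h2
  refine (h2.trans ?_).trans_lt ht
  exact abs_sub_left_of_mem_uIcc hτ

/-- Near each selected point `w` takes the whole limit value by the intermediate value theorem, and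
away from these points it equals `1`, which belongs to every value of `Ξ`. A point of the limit
graph is reached through a selected one, at distance `2 * δ`; passing to the Euclidean metric
doubles this. -/
theorem hausdorffEDist_graph_le (hΞ : IsA0 Ξ) {w : M.Pt → ℝ} (hw : Continuous w) {S : Set M.Pt}
    {t : M.Pt → ℝ} {δ : ℝ} (hδ : 0 < δ) (ht : ∀ z ∈ S, |t z - M.coord z| < δ)
    (hS : ∀ z ∈ S, Ξ z = uIcc (w z) (w (M.param (t z))))
    (hnear : ∀ x, w x = 1 ∨ ∃ z ∈ S, dist x z < δ ∧ w x ∈ Ξ z)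
    (hnet : ∀ z ∈ exceptional Ξ, ∀ y ∈ Ξ z, ∃ z' ∈ S, ∃ y' ∈ Ξ z', dist z z' < δ ∧ |y - y'| < δ) :
    Metric.hausdorffEDist (graph fun x => {w x}) (graph Ξ) ≤ ENNReal.ofReal (4 * δ) := by
  have e4 : 4 * δ = 2 * (2 * δ) := by ring
  have hval : ∀ z ∈ S, ∀ y ∈ Ξ z, ∃ x, dist x z < δ ∧ w x = y := fun z hz y hy => by
    rw [hS z hz] at hy
    exact exists_eq_of_mem_uIcc hw (ht z hz) hy
  refine Metric.hausdorffEDist_le_of_mem_edist ?_ ?_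
  · rintro ⟨x, y⟩ hxy
    have hy : y = w x := hxy
    subst hy
    rcases hnear x with h | ⟨z, hz, hd, hm⟩
    · refine ⟨WithLp.toLp 2 (x, w x), ?_, by simp⟩
      change w x ∈ Ξ x
      rw [h]
      exact hΞ.one_mem x
    · refine ⟨WithLp.toLp 2 (z, w x), hm, ?_⟩
      rw [e4]
      exact edist_toLp_le (by linarith) (by rw [sub_self, abs_zero]; linarith)
  · rintro ⟨z, y⟩ hzy
    have hy : y ∈ Ξ z := hzy
    suffices h : ∃ x, dist z x ≤ 2 * δ ∧ |y - w x| ≤ 2 * δ by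
      obtain ⟨x, h1, h2⟩ := h
      refine ⟨WithLp.toLp 2 (x, w x), rfl, ?_⟩
      rw [e4]
      exact edist_toLp_le h1 h2
    by_cases hz : z ∈ exceptional Ξ
    · obtain ⟨z', hz', y', hy', hd, hyy⟩ := hnet z hz y hy
      obtain ⟨x, hx, hwx⟩ := hval z' hz' y' hy'
      refine ⟨x, ?_, by rw [hwx]; linarith⟩
      have := dist_triangle_right z x z'
      linarith
    · rw [hΞ.eq_singleton hz] at hy
      rw [mem_singleton_iff.1 hy]
      rcases hnear z with h | ⟨z', hz', hd, -⟩
      · exact ⟨z, by rw [dist_self]; linarith, by rw [h, sub_self, abs_zero]; linarith⟩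
      · obtain ⟨x, hx, hwx⟩ := hval z' hz' 1 (hΞ.one_mem z')
        refine ⟨x, ?_, by rw [hwx, sub_self, abs_zero]; linarith⟩
        have := dist_triangle_right z x z'
        linarith

/-- One finite set captures the mass of `μ` on the exceptional points, another is a net for the
graph over them; both properties survive in the union. The radius is chosen last, as it depends on
the number of points. -/
theorem IsA0.exists_finset {μ : Measure M.Pt} [IsFiniteMeasure μ] (hΞ : IsA0 Ξ) {δ : ℝ}
    (hδ : 0 < δ) :
    ∃ (S : Finset M.Pt) (ρ : ℝ), ↑S ⊆ exceptional Ξ ∧ 0 < ρ ∧ ρ ≤ δ ∧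
      (∀ x ∈ S, ∀ y ∈ S, x ≠ y → 2 * ρ ≤ dist x y) ∧
      (∀ z ∈ exceptional Ξ, ∀ y ∈ Ξ z, ∃ z' ∈ S, ∃ y' ∈ Ξ z', dist z z' < δ ∧ |y - y'| < δ) ∧
      μ ((exceptional Ξ \ S) ∪ ⋃ x ∈ S, Metric.ball x ρ \ {x}) ≤ ENNReal.ofReal δ := by
  classical
  have hβ : 0 < ENNReal.ofReal (δ / 2) := ENNReal.ofReal_pos.2 (half_pos hδ)
  obtain ⟨S₁, hS₁, hμ₁⟩ := exists_finset_measure_diff_le μ hΞ.countable_exceptional hβ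
  obtain ⟨S₂, hS₂, hnet⟩ := hΞ.isB.exists_finset_net (exceptional Ξ) hδ
  obtain ⟨ρ₀, hρ₀, hsep⟩ := exists_pos_two_mul_le_dist (S₁ ∪ S₂)
    (Function.injective_id (α := M.Pt)).injOn
  have hβ' : 0 < ENNReal.ofReal (δ / 2 / ((S₁ ∪ S₂).card + 1)) :=
    ENNReal.ofReal_pos.2 (by positivity)
  have hev : ∀ᶠ ρ in 𝓝[>] (0 : ℝ), ∀ x ∈ S₁ ∪ S₂,
      μ (Metric.ball x ρ \ {x}) ≤ ENNReal.ofReal (δ / 2 / ((S₁ ∪ S₂).card + 1)) := by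
    rw [eventually_all_finset]
    exact fun x _ => eventually_measure_punctured_ball_le μ x hβ'
  obtain ⟨ρ, hρ, hρ1, hρ2⟩ := (hev.and ((eventually_mem_set.2 (Ioo_mem_nhdsGT hδ)).and
    (eventually_mem_set.2 (Ioo_mem_nhdsGT hρ₀)))).exists
  refine ⟨S₁ ∪ S₂, ρ, ?_, hρ1.1, hρ1.2.le, fun x hx y hy hxy => ?_, fun z hz y hy => ?_, ?_⟩
  · rw [Finset.coe_union]
    exact union_subset hS₁ hS₂
  · have : 2 * ρ₀ ≤ dist x y := hsep x hx y hy hxy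
    linarith [hρ2.2]
  · obtain ⟨z', hz', h⟩ := hnet z hz y hy
    exact ⟨z', Finset.mem_union_right _ hz', h⟩
  · have h1 := hμ₁ (S₁ ∪ S₂) Finset.subset_union_left
    have h2 : μ (⋃ x ∈ S₁ ∪ S₂, Metric.ball x ρ \ {x}) ≤ ENNReal.ofReal (δ / 2) := by
      refine (measure_biUnion_finset_le _ _).trans ((Finset.sum_le_sum hρ).trans ?_)
      rw [Finset.sum_const, nsmul_eq_mul, ← ENNReal.ofReal_natCast,
        ← ENNReal.ofReal_mul (Nat.cast_nonneg _)]
      refine ENNReal.ofReal_le_ofReal ?_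
      rw [mul_div_assoc', div_le_iff₀ (by positivity)]
      nlinarith
    calc _ ≤ _ := measure_union_le _ _
      _ ≤ ENNReal.ofReal (δ / 2) + ENNReal.ofReal (δ / 2) := add_le_add h1 h2
      _ = ENNReal.ofReal δ := by
        rw [← ENNReal.ofReal_add (by positivity) (by positivity), add_halves]

theorem IsA0.eventually_exists_recovery (hF : Continuous F) (hF0 : ∀ v, 0 ≤ F v) (hF1 : F 1 = 0)
    (hΞ : IsA0 Ξ) {μ : Measure M.Pt} [IsFiniteMeasure μ] (hμ : μ M.innerᶜ = 0) {δ : ℝ}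
    (hδ : 0 < δ) :
    ∀ᶠ ε in 𝓝[>] 0, ∃ w : M.Pt → ℝ, IsH1 M w ∧
      Metric.hausdorffEDist (graph fun x => {w x}) (graph Ξ) ≤ ENNReal.ofReal δ ∧
      sMM M F ε w ≤ sMM0 M F Ξ + ENNReal.ofReal δ ∧
      ∫⁻ x, ENNReal.ofReal (w x ^ 2) ∂μ ≤
        ∫⁻ x, ENNReal.ofReal (sInf (Ξ x) ^ 2) ∂μ + ENNReal.ofReal δ ∧
      ∫⁻ x, ENNReal.ofReal (sInf (Ξ x) ^ 2) ∂μ ≤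
        ∫⁻ x, ENNReal.ofReal (w x ^ 2) ∂μ + ENNReal.ofReal δ := by
  classical
  obtain ⟨B, hB0, hB⟩ := hΞ.isB.exists_bound
  -- The Hausdorff estimate needs `4 * δ₁ ≤ δ`; the weight error needs `B² * δ₁ ≤ δ`.
  set δ₁ := δ / (4 * (B ^ 2 + 1)) with hδ₁
  have hδ₁0 : 0 < δ₁ := by positivity
  have hδ₁B : δ₁ * (4 * (B ^ 2 + 1)) = δ := div_mul_cancel₀ _ (by positivity)
  have hδ₁4 : 4 * δ₁ ≤ δ := by nlinarith [mul_pos hδ₁0 (pow_pos hB0 2)]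
  obtain ⟨S, ρ, hSE, hρ0, hρδ, hsep, hnet, hμS⟩ := hΞ.exists_finset (μ := μ) hδ₁0
  choose t ht htne htin using fun x : M.Pt => exists_param_near x (half_pos hρ0)
  choose m s hms hm hcost using fun x : M.Pt => exists_pointCost_values (Ξ := Ξ) F x
  have htd : ∀ x, dist (M.param (t x)) x < ρ / 2 := fun x => by
    have h2 := M.dist_param_le (t x) (M.coord x)
    rw [M.param_coord] at h2
    exact h2.trans_lt (ht x)
  set pos : M.Pt × Bool → M.Pt := fun i => if i.2 then M.param (t i.1) else i.1 with hpos
  set val : M.Pt × Bool → ℝ := fun i => if i.2 then s i.1 else m i.1 with hval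
  have hposd : ∀ i, dist (pos i) i.1 < ρ / 2 := by
    rintro ⟨x, b⟩
    cases b
    · simpa [hpos] using hρ0
    · simpa [hpos] using htd x
  have hinj : Set.InjOn pos ↑(S ×ˢ (Finset.univ : Finset Bool)) := by
    rintro ⟨x, b⟩ hx ⟨x', b'⟩ hx' h
    rw [Finset.mem_coe, Finset.mem_product] at hx hx'
    have hxx : x = x' := by
      by_contra hne
      have h1 := hsep x hx.1 x' hx'.1 hne
      have h2 := hposd (x, b)
      have h3 := hposd (x', b')
      rw [h] at h2
      have h4 := dist_triangle_left x x' (pos (x', b'))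
      simp only at h2 h3
      linarith
    subst hxx
    have hbb : b = b' := by
      cases b <;> cases b'
      · rfl
      · exact absurd h.symm (by simpa [hpos] using htne x)
      · exact absurd h (by simpa [hpos] using htne x)
      · rfl
    rw [hbb]
  -- The two bumps of a point have at most four flanks, and there are fewer than `S.card + 1`
  -- points.
  have hδ₂ : 0 < δ / (4 * (S.card + 1)) := by positivity
  filter_upwards [eventually_exists_bumps hF hF0 hF1 (S ×ˢ (Finset.univ : Finset Bool)) hinj val
    (half_pos hρ0) hδ₂] with ε hε
  obtain ⟨w, hwH, hwval, hwnear, hwE⟩ := hε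
  have hwm : ∀ x ∈ S, w x = m x := fun x hx => by
    simpa [hpos, hval] using hwval (x, false) (by simp [hx])
  have hws : ∀ x ∈ S, w (M.param (t x)) = s x := fun x hx => by
    simpa [hpos, hval] using hwval (x, true) (by simp [hx])
  have hΞms : ∀ x, Ξ x = uIcc (m x) (s x) := fun x => by
    have h1 := (hΞ.sInf_le_one x).trans (hΞ.one_le_sSup x)
    rcases hms x with ⟨h2, h3⟩ | ⟨h2, h3⟩
    · rw [h2, h3, uIcc_of_le h1]
      exact hΞ.eq_Icc x
    · rw [h2, h3, uIcc_of_ge h1]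
      exact hΞ.eq_Icc x
  have hvalmem : ∀ i, val i ∈ Ξ i.1 := by
    rintro ⟨x, b⟩
    rw [hΞms x]
    cases b
    · simp [hval]
    · simp [hval]
  have hord : ∀ x, (Ξ x).OrdConnected := fun x => by
    rw [hΞ.eq_Icc x]
    exact ordConnected_Icc
  have hwnear' : ∀ x, w x = 1 ∨ ∃ z ∈ S, dist x z < ρ ∧ w x ∈ Ξ z := by
    intro x
    rcases hwnear x with h | ⟨i, hi, hd, hmem⟩
    · exact Or.inl h
    · refine Or.inr ⟨i.1, (Finset.mem_product.1 hi).1, ?_, ?_⟩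
      · linarith [dist_triangle x (pos i) i.1, hposd i]
      · exact (hord i.1).uIcc_subset (hΞ.one_mem i.1) (hvalmem i) hmem
  have hwB : ∀ x, |w x| ≤ B := by
    intro x
    rcases hwnear' x with h | ⟨z, -, -, h⟩
    · rw [h]
      exact hB x 1 (hΞ.one_mem x)
    · exact hB z _ h
  have hbad : MeasurableSet ((exceptional Ξ \ S) ∪ ⋃ x ∈ S, Metric.ball x ρ \ {x}) :=
    ((hΞ.countable_exceptional.mono sdiff_subset).measurableSet).union
      (S.measurableSet_biUnion fun x _ => Metric.isOpen_ball.measurableSet.diff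
        (measurableSet_singleton x))
  -- Off the bad set a point is either selected, where `w` was set to `ξ⁻`, or not exceptional and
  -- away from all bumps, where both sides are `1`. End points of an interval carry no mass.
  have heq : ∀ᵐ x ∂μ, x ∉ (exceptional Ξ \ S) ∪ ⋃ x ∈ S, Metric.ball x ρ \ {x} →
      w x = sInf (Ξ x) := by
    filter_upwards [compl_mem_ae_iff.2 hμ] with x hx hxb
    have hxi : x ∈ M.inner := not_not.1 hx
    by_cases hxS : x ∈ S
    · rw [hwm x hxS, hm x hxi]
    · have hxE : x ∉ exceptional Ξ := fun h => hxb (Or.inl ⟨h, hxS⟩)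
      rw [hΞ.eq_singleton hxE, csInf_singleton]
      rcases hwnear' x with h | ⟨z, hz, hd, -⟩
      · exact h
      · refine (hxb ?_).elim
        refine Or.inr (mem_iUnion₂.2 ⟨z, hz, ⟨hd, fun h => hxS ?_⟩⟩)
        rw [mem_singleton_iff.1 h]
        exact hz
  have hsq : ∀ a : ℝ, |a| ≤ B → ENNReal.ofReal (a ^ 2) ≤ ENNReal.ofReal (B ^ 2) := fun a ha => by
    refine ENNReal.ofReal_le_ofReal ?_
    rw [← sq_abs a]
    exact pow_le_pow_left₀ (abs_nonneg a) ha 2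
  have hBμ : ENNReal.ofReal (B ^ 2) *
      μ ((exceptional Ξ \ S) ∪ ⋃ x ∈ S, Metric.ball x ρ \ {x}) ≤ ENNReal.ofReal δ := by
    refine (mul_le_mul_right hμS _).trans ?_
    rw [← ENNReal.ofReal_mul (by positivity)]
    refine ENNReal.ofReal_le_ofReal ?_
    nlinarith [mul_pos hδ₁0 (pow_pos hB0 2)]
  refine ⟨w, hwH, ?_, ?_, ?_, ?_⟩
  · refine (hausdorffEDist_graph_le hΞ hwH.continuous (S := ↑S) (t := t) hδ₁0
      (fun z _ => (ht z).trans_le (by linarith)) (fun z hz => ?_) (fun x => ?_) hnet).trans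
      (ENNReal.ofReal_le_ofReal hδ₁4)
    · rw [hwm z hz, hws z hz]
      exact hΞms z
    · exact (hwnear' x).imp id fun ⟨z, hz, hd, h⟩ => ⟨z, hz, hd.trans_le hρδ, h⟩
  · refine hwE.trans ?_
    rw [Finset.sum_product]
    have hx : ∀ x ∈ S, ∑ b : Bool, ENNReal.ofReal ((2 - kappa M (pos (x, b))) *
        (potG F (val (x, b)) + δ / (4 * (S.card + 1)))) ≤
        ENNReal.ofReal (pointCost M F x (sInf (Ξ x)) (sSup (Ξ x))) +
          ENNReal.ofReal (δ / (S.card + 1)) := by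
      intro x _
      have hk1 : kappa M (M.param (t x)) = 0 := if_pos (htin x)
      have hk2 : 0 ≤ kappa M x ∧ kappa M x ≤ 1 := by
        unfold kappa
        split_ifs <;> norm_num
      have hG1 := potG_nonneg F (m x)
      have hG2 := potG_nonneg F (s x)
      rw [Fintype.sum_bool]
      simp only [hpos, hval, if_true, Bool.false_eq_true, if_false, hk1, sub_zero]
      rw [← ENNReal.ofReal_add (by positivity) (mul_nonneg (by linarith) (by positivity))]
      refine le_trans (ENNReal.ofReal_le_ofReal ?_) ENNReal.ofReal_add_le
      rw [← hcost x]
      have e : δ / (S.card + 1) = 4 * (δ / (4 * (S.card + 1))) := by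
        field_simp
      rw [e]
      nlinarith [mul_nonneg hk2.1 hδ₂.le]
    refine (Finset.sum_le_sum hx).trans ?_
    rw [Finset.sum_add_distrib]
    refine add_le_add ?_ ?_
    · rw [sMM0, if_pos hΞ]
      have h1 : ∑ x ∈ S, ENNReal.ofReal (pointCost M F x (sInf (Ξ x)) (sSup (Ξ x))) =
          ∑ x ∈ S.subtype (· ∈ exceptional Ξ),
            ENNReal.ofReal (pointCost M F x (sInf (Ξ x)) (sSup (Ξ x))) :=
        (Finset.sum_subtype_of_mem (fun x =>
          ENNReal.ofReal (pointCost M F x (sInf (Ξ x)) (sSup (Ξ x)))) fun x hx => hSE hx).symm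
      rw [h1]
      exact ENNReal.sum_le_tsum _
    · rw [Finset.sum_const, nsmul_eq_mul, ← ENNReal.ofReal_natCast,
        ← ENNReal.ofReal_mul (Nat.cast_nonneg _)]
      refine ENNReal.ofReal_le_ofReal ?_
      rw [mul_div_assoc', div_le_iff₀ (by positivity)]
      nlinarith
  · refine (lintegral_le_add_of_eq_off hbad (g := fun x => ENNReal.ofReal (sInf (Ξ x) ^ 2))
      (heq.mono fun x hx h => ?_) fun x => hsq _ (hwB x)).trans (add_le_add_right hBμ _)
    rw [hx h]
  · refine (lintegral_le_add_of_eq_off hbad (g := fun x => ENNReal.ofReal (w x ^ 2))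
      (heq.mono fun x hx h => ?_) fun x => hsq _ (hB x _ (hΞ.sInf_mem x))).trans
      (add_le_add_right hBμ _)
    rw [hx h]

end Recovery

/-! ### The limsup inequality -/

/-- `N ε` is the best accuracy up to `⌊1/ε⌋` attainable at `ε`. It tends to infinity because each
accuracy is eventually attainable and the cap diverges. The fallback `a₀` keeps the family defined,
and regular, for every `ε`. -/
theorem exists_diagonal {α : Type*} (a₀ : α) {P : ℕ → ℝ → α → Prop}
    (h : ∀ n, ∀ᶠ ε in 𝓝[>] 0, ∃ a, P n ε a) :
    ∃ (a : ℝ → α) (N : ℝ → ℕ), Tendsto N (𝓝[>] 0) atTop ∧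
      (∀ᶠ ε in 𝓝[>] 0, P (N ε) ε (a ε)) ∧ ∀ ε, a ε = a₀ ∨ P (N ε) ε (a ε) := by
  classical
  set N : ℝ → ℕ := fun ε => Nat.findGreatest (fun n => ∃ a, P n ε a) ⌊ε⁻¹⌋₊ with hN
  have hbig : ∀ K : ℕ, ∀ᶠ ε : ℝ in 𝓝[>] 0, K ≤ ⌊ε⁻¹⌋₊ := fun K => by
    filter_upwards [tendsto_inv_nhdsGT_zero.eventually_ge_atTop (K : ℝ)] with ε hε
    exact Nat.le_floor hε
  set a : ℝ → α := fun ε => if h : ∃ a, P (N ε) ε a then h.choose else a₀ with ha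
  have hspec : ∀ ε, (∃ a, P (N ε) ε a) → P (N ε) ε (a ε) := fun ε hε => by
    simp only [ha, dif_pos hε]
    exact hε.choose_spec
  refine ⟨a, N, tendsto_atTop.2 fun K => ?_, ?_, fun ε => ?_⟩
  · filter_upwards [h K, hbig K] with ε h1 h2
    exact Nat.le_findGreatest h2 h1
  · filter_upwards [h 0] with ε h1
    exact hspec ε (Nat.findGreatest_spec (P := fun n => ∃ a, P n ε a) (Nat.zero_le _) h1)
  · by_cases hε : ∃ a, P (N ε) ε a
    · exact Or.inr (hspec ε hε)
    · exact Or.inl (dif_neg hε)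

theorem exists_recovery {M : Dom} {F : ℝ → ℝ} (hF : Continuous F) (hF0 : ∀ v, 0 ≤ F v)
    (hF1 : ∀ v, F v = 0 ↔ v = 1) (σ : ℝ) {Ξ : M.Pt → Set ℝ} {u₀ : M.Pt → ℝ} (hΞ : IsA0 Ξ)
    (hu₀ : IsBV M u₀) :
    ∃ w : ℝ → M.Pt → ℝ, (∀ ε, IsH1 M (w ε)) ∧ GraphTendsto w Ξ ∧
      Tendsto (fun ε => energy M F σ ε u₀ (w ε)) (𝓝[>] 0) (𝓝 (energy0 M F σ u₀ Ξ)) := by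
  obtain ⟨μ, hμ⟩ := hu₀.exists_isVariationMeasure
  have hfin := hμ.isFinite
  have hone : IsH1 M fun _ => (1 : ℝ) := isH1_of_lipschitzWith (LipschitzWith.const 1)
  have hδ : ∀ n : ℕ, 0 < 1 / ((n : ℝ) + 1) := fun n => by positivity
  obtain ⟨w, N, hN, hP, hw⟩ := exists_diagonal (fun _ => (1 : ℝ)) fun n =>
    hΞ.eventually_exists_recovery hF hF0 ((hF1 1).2 rfl) hμ.compl_inner (hδ n)
  have hH1 : ∀ ε, IsH1 M (w ε) := fun ε => by
    rcases hw ε with h | h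
    · rw [h]
      exact hone
    · exact h.1
  have hc : Tendsto (fun ε => ENNReal.ofReal (1 / ((N ε : ℝ) + 1))) (𝓝[>] 0) (𝓝 0) := by
    have h1 := (ENNReal.continuous_ofReal.tendsto 0).comp
      (tendsto_one_div_add_atTop_nhds_zero_nat.comp hN)
    rwa [ENNReal.ofReal_zero] at h1
  have hG : GraphTendsto w Ξ :=
    tendsto_of_tendsto_of_tendsto_of_le_of_le' tendsto_const_nhds hc
      (Eventually.of_forall fun _ => zero_le) (hP.mono fun ε h => h.2.1)
  refine ⟨w, hH1, hG, ?_⟩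
  -- The construction gives the upper bound and the liminf inequality the lower one, so an infinite
  -- limit energy needs no separate case.
  have hMM : Tendsto (fun ε => sMM M F ε (w ε)) (𝓝[>] 0) (𝓝 (sMM0 M F Ξ)) := by
    refine tendsto_of_le_liminf_of_limsup_le
      (sMM0_le_liminf hF hF0 hF1 (fun ε _ => hH1 ε) hΞ.isB hG) ?_
    have h1 := (tendsto_const_nhds (x := sMM0 M F Ξ)).add hc
    rw [add_zero] at h1
    rw [← h1.limsup_eq]
    exact limsup_le_limsup (hP.mono fun ε h => h.2.2.1)
  set W₀ := ∫⁻ x, ENNReal.ofReal (sInf (Ξ x) ^ 2) ∂μ with hW₀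
  -- Finiteness makes truncated subtraction continuous at `W₀`, as the lower squeeze requires.
  have hW₀top : W₀ ≠ ∞ := by
    obtain ⟨B, -, hB⟩ := hΞ.isB.exists_bound
    refine ne_top_of_le_ne_top (b := ENNReal.ofReal (B ^ 2) * μ univ)
      (ENNReal.mul_ne_top ENNReal.ofReal_ne_top (measure_ne_top _ _)) ?_
    rw [← lintegral_const]
    refine lintegral_mono fun x => ENNReal.ofReal_le_ofReal ?_
    rw [← sq_abs]
    exact pow_le_pow_left₀ (abs_nonneg _) (hB x _ (hΞ.sInf_mem x)) 2
  have hWeq : ∀ ε, weightedTV M (fun x => w ε x ^ 2) univ u₀ =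
      ∫⁻ x, ENNReal.ofReal (w ε x ^ 2) ∂μ := fun ε => by
    rw [hμ.weightedTV_eq (fun x => w ε x ^ 2) ((hH1 ε).continuous.pow 2) (fun x => sq_nonneg _)
      univ isOpen_univ, Measure.restrict_univ]
  have hW : Tendsto (fun ε => weightedTV M (fun x => w ε x ^ 2) univ u₀) (𝓝[>] 0) (𝓝 W₀) := by
    have h1 := (tendsto_const_nhds (x := W₀)).add hc
    have h2 := ENNReal.Tendsto.sub (tendsto_const_nhds (x := W₀)) hc (Or.inl hW₀top)
    rw [add_zero] at h1
    rw [tsub_zero] at h2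
    refine tendsto_of_tendsto_of_tendsto_of_le_of_le' h2 h1 ?_ ?_
    · filter_upwards [hP] with ε h
      rw [hWeq, tsub_le_iff_right]
      exact h.2.2.2.2
    · filter_upwards [hP] with ε h
      rw [hWeq]
      exact h.2.2.2.1
  have hE : energy0 M F σ u₀ Ξ = ENNReal.ofReal σ * W₀ + sMM0 M F Ξ := by
    rw [energy0, if_pos ⟨hu₀, hΞ⟩, ← mul_add, hW₀,
      hμ.lintegral_eq hΞ.countable_exceptional (m := fun x => sInf (Ξ x) ^ 2) fun x hx => by
        rw [hΞ.eq_singleton hx, csInf_singleton, one_pow]]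
  rw [hE]
  exact (ENNReal.Tendsto.const_mul hW (Or.inr ENNReal.ofReal_ne_top)).add hMM

end KWC

theorem theorem2p3 (M : Dom) (F : ℝ → ℝ)
    (hF : Continuous F) (hF0 : ∀ v, 0 ≤ F v) (hF1 : ∀ v, F v = 0 ↔ v = 1)
    (hF2 : 0 < liminf (fun v => ENNReal.ofReal (F v)) (cocompact ℝ))
    (σ : ℝ) (hσ : 0 ≤ σ) :
    -- liminf inequality
    (∀ (v u : ℝ → M.Pt → ℝ) (Ξ : M.Pt → Set ℝ) (u₀ : M.Pt → ℝ),
      (∀ ε ∈ Ioo (0 : ℝ) 1, IsH1 M (v ε)) →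
      (∀ ε ∈ Ioo (0 : ℝ) 1, IsL1 M (u ε)) →
      IsB Ξ → IsL1 M u₀ →
      GraphTendsto v Ξ → L1Tendsto M u u₀ →
      (σ = 0 → IsBV M u₀) →
      (IsBV M u₀ → ∀ x ∈ jumpSet M u₀ ∩ exceptional Ξ, 0 ≤ sInf (Ξ x)) →
      energy0 M F σ u₀ Ξ ≤ liminf (fun ε => energy M F σ ε (u ε) (v ε)) (𝓝[>] 0)) ∧
    -- limsup inequality
    (∀ (Ξ : M.Pt → Set ℝ) (u₀ : M.Pt → ℝ), IsA0 Ξ → IsBV M u₀ →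
      ∃ w u : ℝ → M.Pt → ℝ,
        (∀ ε ∈ Ioo (0 : ℝ) 1, IsH1 M (w ε)) ∧
        (∀ ε ∈ Ioo (0 : ℝ) 1, IsL1 M (u ε)) ∧
        GraphTendsto w Ξ ∧ L1Tendsto M u u₀ ∧
        Tendsto (fun ε => energy M F σ ε (u ε) (w ε)) (𝓝[>] 0) (𝓝 (energy0 M F σ u₀ Ξ))) := by
  refine ⟨fun v u Ξ u₀ hv hu hΞ hu₀ hG hL hBV hmin =>
    energy0_le_liminf hF hF0 hF1 hσ hv hu hΞ hu₀ hG hL hBV hmin, fun Ξ u₀ hΞ hu₀ => ?_⟩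
  obtain ⟨w, hw, hG, hE⟩ := exists_recovery hF hF0 hF1 σ hΞ hu₀
  refine ⟨w, fun _ => u₀, fun ε _ => hw ε, fun _ _ => hu₀.1, hG, ?_, hE⟩
  simp [L1Tendsto]
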